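/- **Setting.** Let $d\in\{2,3\}$, $Y=(0,1)^d$, let $D_{\rm in}\subset\mathbb R^d$ be a bounded open set with $C^{1,1}$ boundary $\Gamma$ and outward unit normal $\boldsymbol\nu$, and let $s>0$. For $d=2$, vectors $(v_1,v_2)$ are identified with $(v_1,v_2,0)\in\mathbb C^3$ and derivatives in the missing third direction are $0$; so vector potentials are always $\mathbb C^3$-valued and $\nabla\times$, $\nabla\cdot$, $\times$ have their usual three-dimensional meaning. $\boldsymbol H^1_\sharp(Y)$ is the space of zero-mean elements of $\boldsymbol H^1_{\rm per}(Y)$, the closure of the smooth $Y$-periodic fields in the $H^1(Y)$ norm. For $f$ periodic, with Fourier coefficients $f^{\alpha}=\int_Y f(\mathbf y)e^{-2\pi i\alpha\cdot \mathbf y}\,d\mathbf y$, put $|f|_{H^s(Y)}^2=\sum_{\alpha\in\mathbb Z^d}(2\pi|\alpha|)^{2s}|f^{\alpha}|^2$ and $\|f\|_{H^s(Y)}^2=\sum_{m=0}^{\lfloor s\rfloor}|f|_{H^m(Y)}^2$, plus $|f|_{H^s(Y)}^2$ if $s\notin\mathbb Z$; for matrices sum the squares over the entries. For $v$ on $D_{\rm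 in}\times Y$, $v^\varepsilon(\mathbf x)=v(\mathbf x,\mathbf x/\varepsilon)$, with $v(\mathbf x,\cdot)$ evaluated through its continuous periodic representative. $H^{1/2}(\Gamma)$ is the trace space of $H^1(D_{\rm in})$ with the quotient norm, $H^{-1/2}(\Gamma)$ is its dual, and for a divergence-free $\mathbf c\in \boldsymbol L^2(D_{\rm in})$ the normal trace $\mathbf c\cdot\boldsymbol\nu\in H^{-1/2}(\Gamma)$ is the functional $w|_\Gamma\mapsto\int_{D_{\rm in}}\mathbf c\cdot\nabla w$, $w\in H^1(D_{\rm in})$. **Theorem.** For all $K_1,K_2\ge0$ there are a constant $C_1$, depending only on $D_{\rm in},d,s,K_1,K_2$, and, for each $c_0>0$, a constant $C_2=C_2(c_0)$, depending only on these and $c_0$, such that the following holds. Let $\widehat M$ be a $Y$-periodic $\mathbb C^{d\times d}$-valued field with zero mean, independent of $y_d$, with $\|\widehat M\|_{H^s(Y)}\le K_1$, $\|\widehat M\|_{L^\infty(Y)}\le K_2$, and $\nabla_y\cdot(\widehat M\mathbf w)=0$ in the sense of periodic distributions for every constant $\mathbf w\in\mathbb C^d$. Let $u_0\in H^2(D_{\rm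 in})$. Then there is a unique (up to equality for a.e. $\mathbf x$) $\boldsymbol q\in H^1(D_{\rm in},\boldsymbol H^1_\sharp(Y))$ such that, for a.e. $\mathbf x\in D_{\rm in}$, $$\nabla_y\times\boldsymbol q(\mathbf x,\cdot)=\widehat M\,\nabla u_0(\mathbf x),\qquad \nabla_y\cdot\boldsymbol q(\mathbf x,\cdot)=0 .$$ For a.e. $\mathbf x\in D_{\rm in}$, $\boldsymbol q(\mathbf x,\cdot)$ and $\partial_{x_j}\boldsymbol q(\mathbf x,\cdot)$ have continuous periodic representatives, $\boldsymbol q(\mathbf x,\cdot)$ does not depend on $y_d$, and $\|\boldsymbol q(\mathbf x,\cdot)\|_{L^\infty(Y)}\le C_1|\nabla u_0(\mathbf x)|$. Moreover, for every $\varepsilon>0$, $(\nabla_x\times\boldsymbol q)^\varepsilon\in \boldsymbol L^2(D_{\rm in})$ and $\boldsymbol q^\varepsilon\in \boldsymbol H(\mathrm{curl},D_{\rm in})$, with $$\|(\nabla_x\times\boldsymbol q)^\varepsilon\|_{\boldsymbol L^2(D_{\rm in})}\le C_1|u_0|_{H^2(D_{\rm in})},\qquad \|\boldsymbol q^\varepsilon\times\boldsymbol\nu\|_{\boldsymbol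 L^2(\Gamma)}\le C_1\|\nabla u_0\|_{\boldsymbol L^2(\Gamma)},$$ where $\nabla u_0$ on $\Gamma$ is the trace of the full gradient; and, if $D_{\rm in}\subset B_{R_0}$, $k>0$ and $kR_0\ge c_0$, then $$\|\nabla\times\boldsymbol q^\varepsilon\cdot\boldsymbol\nu\|_{H^{-1/2}(\Gamma)}\le C_2\,\bigl(1+(k\varepsilon)^{-1/2}\bigr)\bigl(k\|u_0\|_{H^1(D_{\rm in})}+\|u_0\|_{H^2(D_{\rm in})}\bigr).$$ -/

import Mathlib

open MeasureTheory Filter Topology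
open scoped NNReal ENNReal

noncomputable section

namespace PeriodicPotential

/-! ### Euclidean space and vector algebra

Space dimension is `d` (later `d = 2` or `d = 3`).  Vector potentials take values in `ℂ³`.  For
`d = 2` the usual convention is used: a planar vector `(v₁, v₂)` is identified with `(v₁, v₂, 0)`,
and derivatives in the missing third direction are zero.  For `d = 3` nothing is modified. -/

/-- `ℝᵈ` with its Euclidean norm. -/
abbrev E (d : ℕ) := EuclideanSpace ℝ (Fin d)

/-- `ℂ³` with its Euclidean norm. -/
abbrev C3 := EuclideanSpace ℂ (Fin 3)

/-- The `i`-th canonical basis vector of `ℝᵈ` (counted from `0`); zero if `i ≥ d`. -/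
def basisVec (d i : ℕ) : E d :=
  if h : i < d then EuclideanSpace.single (⟨i, h⟩ : Fin d) (1 : ℝ) else 0

/-- Extension of a `d`-tuple to a triple by zero (the identity for `d = 3`). -/
def ext3 {d : ℕ} {X : Type*} [Zero X] (a : Fin d → X) : Fin 3 → X :=
  fun i => if h : i.val < d then a ⟨i.val, h⟩ else 0

/-- A vector of `ℂᵈ` as a vector of `ℂ³`. -/
def toC3 {d : ℕ} (a : Fin d → ℂ) : C3 := WithLp.toLp 2 (ext3 a)

/-- The cross product on `ℂ³`. -/
def cross (a b : C3) : C3 :=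
  !₂[a 1 * b 2 - a 2 * b 1, a 2 * b 0 - a 0 * b 2, a 0 * b 1 - a 1 * b 0]

/-- The bilinear dot product on `ℂ³`. -/
def dot (a b : C3) : ℂ := ∑ k, a k * b k

/-- The curl computed from the triple `G = (∂₁ f, ∂₂ f, ∂₃ f)` of partial derivatives of `f`. -/
def curlOf (G : Fin 3 → C3) : C3 :=
  !₂[G 1 2 - G 2 1, G 2 0 - G 0 2, G 0 1 - G 1 0]

/-- The divergence computed from the triple of partial derivatives. -/
def divOf (G : Fin 3 → C3) : ℂ := ∑ k, G k k

/-- The partial derivatives of a differentiable function on `ℝᵈ`. -/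
def pderivs {d : ℕ} {X : Type*} [NormedAddCommGroup X] [NormedSpace ℝ X] (f : E d → X) (x : E d) :
    Fin d → X :=
  fun i => fderiv ℝ f x (basisVec d i)

/-- The classical curl of a differentiable field `ℝᵈ → ℂ³`. -/
def curl {d : ℕ} (f : E d → C3) (x : E d) : C3 := curlOf (ext3 (pderivs f x))

/-! ### Domains, outward normal, surface measure -/

/-- `D` is a bounded open set with `C^{1,1}` boundary: near every boundary point, `D` is the set of
points below the graph of a `C^{1,1}` function `γ` (a function of the coordinates orthogonal to a
unit vector `e`, i.e. invariant under translation along `e`), height being measured along `e`. -/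
def IsC11Domain {d : ℕ} (D : Set (E d)) : Prop :=
  IsOpen D ∧ Bornology.IsBounded D ∧
  ∀ x ∈ frontier D, ∃ (e : E d) (γ : E d → ℝ), ‖e‖ = 1 ∧ ContDiff ℝ 1 γ ∧
    (∃ L : ℝ≥0, LipschitzWith L (fderiv ℝ γ)) ∧
    (∀ (y : E d) (t : ℝ), γ (y + t • e) = γ y) ∧
    ∃ U ∈ 𝓝 x, ∀ y ∈ U, (y ∈ D ↔ inner ℝ e y < γ y)

/-- `n` is the outward unit normal of `D` at the point `x`: close to `x`, every cone strictly inside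
`{z | (z - x) · n < 0}` is in `D` and every cone strictly inside `{z | (z - x) · n > 0}` is
outside. (There is at most one such `n`.) -/
def IsOutwardNormal {d : ℕ} (D : Set (E d)) (x n : E d) : Prop :=
  ‖n‖ = 1 ∧ ∀ η > (0 : ℝ), ∃ δ > (0 : ℝ), ∀ y : E d, ‖y - x‖ < δ →
    (inner ℝ (y - x) n < -η * ‖y - x‖ → y ∈ D) ∧ (η * ‖y - x‖ < inner ℝ (y - x) n → y ∉ D)

open Classical in
/-- The outward unit normal `ν` (zero where there is none). -/
def outwardNormal {d : ℕ} (D : Set (E d)) (x : E d) : E d :=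
  if h : ∃ n, IsOutwardNormal D x n then h.choose else 0

/-- The outward unit normal as a vector of `ℂ³`. -/
def nu {d : ℕ} (D : Set (E d)) (x : E d) : C3 := toC3 (fun i => ((outwardNormal D x i : ℝ) : ℂ))

/-- Surface measure on `Γ = ∂D`: `(d-1)`-dimensional Hausdorff measure. -/
def surf {d : ℕ} (D : Set (E d)) : Measure (E d) := (μHE[d - 1]).restrict (frontier D)

/-- Lebesgue measure on `D`. -/
abbrev vol {d : ℕ} (D : Set (E d)) : Measure (E d) := volume.restrict D

/-! ### Sobolev spaces on `D` -/

section Sobolev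

variable {d : ℕ} {V : Type*} [NormedAddCommGroup V] [NormedSpace ℝ V]

/-- `f ∈ H¹(D; V)` with weak partial derivatives `df i = ∂ᵢ f`. -/
structure IsH1 (D : Set (E d)) (f : E d → V) (df : Fin d → E d → V) : Prop where
  memLp : MemLp f 2 (vol D)
  memLp_deriv : ∀ i, MemLp (df i) 2 (vol D)
  weak_deriv : ∀ (i : Fin d) (φ : E d → ℝ), ContDiff ℝ (⊤ : ℕ∞) φ → HasCompactSupport φ →
    tsupport φ ⊆ D →
    ∫ x in D, (fderiv ℝ φ x (basisVec d i)) • f x = -∫ x in D, φ x • df i x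

/-- `u ∈ H²(D)` with gradient `g i = ∂ᵢ u` and Hessian `h i j = ∂ⱼ ∂ᵢ u`. -/
def IsH2 (D : Set (E d)) (u : E d → ℂ) (g : Fin d → E d → ℂ) (h : Fin d → Fin d → E d → ℂ) :
    Prop :=
  IsH1 D u g ∧ ∀ i, IsH1 D (g i) (h i)

/-- The norm of `H¹(D)`. -/
def h1Norm (D : Set (E d)) (u : E d → ℂ) (g : Fin d → E d → ℂ) : ℝ≥0∞ :=
  (eLpNorm u 2 (vol D) ^ 2 + ∑ i, eLpNorm (g i) 2 (vol D) ^ 2) ^ (1 / 2 : ℝ)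

/-- The semi-norm of `H²(D)`. -/
def h2Semi (D : Set (E d)) (h : Fin d → Fin d → E d → ℂ) : ℝ≥0∞ :=
  (∑ i, ∑ j, eLpNorm (h i j) 2 (vol D) ^ 2) ^ (1 / 2 : ℝ)

/-- The norm of `H²(D)`. -/
def h2Norm (D : Set (E d)) (u : E d → ℂ) (g : Fin d → E d → ℂ) (h : Fin d → Fin d → E d → ℂ) :
    ℝ≥0∞ :=
  (eLpNorm u 2 (vol D) ^ 2 + ∑ i, eLpNorm (g i) 2 (vol D) ^ 2
    + ∑ i, ∑ j, eLpNorm (h i j) 2 (vol D) ^ 2) ^ (1 / 2 : ℝ)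

/-- `γ ∈ L²(Γ)` is the trace on `Γ` of `w ∈ H¹(D)` (with weak gradient `dw`): it is the limit in
`L²(Γ)` of the restrictions to `Γ` of smooth functions that converge to `w` in `H¹(D)`. -/
def IsTrace (D : Set (E d)) (w : E d → ℂ) (dw : Fin d → E d → ℂ) (γ : E d → ℂ) : Prop :=
  IsH1 D w dw ∧ MemLp γ 2 (surf D) ∧
  ∃ φ : ℕ → E d → ℂ, (∀ n, ContDiff ℝ (⊤ : ℕ∞) (φ n)) ∧
    Tendsto (fun n => h1Norm D (φ n - w) (fun i x => pderivs (φ n) x i - dw i x)) atTop (𝓝 0) ∧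
    Tendsto (fun n => eLpNorm (φ n - γ) 2 (surf D)) atTop (𝓝 0)

/-- `u ∈ H(curl; D)` with weak curl `c`. -/
structure IsHcurl (D : Set (E d)) (u c : E d → C3) : Prop where
  memLp : MemLp u 2 (vol D)
  memLp_curl : MemLp c 2 (vol D)
  weak_curl : ∀ ψ : E d → C3, ContDiff ℝ (⊤ : ℕ∞) ψ → HasCompactSupport ψ → tsupport ψ ⊆ D →
    ∫ x in D, dot (u x) (curl ψ x) = ∫ x in D, dot (c x) (ψ x)

/-- `τ ∈ L²(Γ)` is the tangential trace `u × ν` of the field `u ∈ H(curl; D)` with curl `c`: it is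
the limit in `L²(Γ)` of `φₙ × ν` for smooth fields `φₙ` that converge to `u` in `H(curl; D)`. -/
def IsTangentialTrace (D : Set (E d)) (u c τ : E d → C3) : Prop :=
  IsHcurl D u c ∧ MemLp τ 2 (surf D) ∧
  ∃ φ : ℕ → E d → C3, (∀ n, ContDiff ℝ (⊤ : ℕ∞) (φ n)) ∧
    Tendsto (fun n => eLpNorm (φ n - u) 2 (vol D)) atTop (𝓝 0) ∧
    Tendsto (fun n => eLpNorm (fun x => curl (φ n) x - c x) 2 (vol D)) atTop (𝓝 0) ∧
    Tendsto (fun n => eLpNorm (fun x => cross (φ n x) (nu D x) - τ x) 2 (surf D)) atTop (𝓝 0)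

/-- The `H^{1/2}(Γ)` norm of the trace of `w ∈ H¹(D)`.  Here `H^{1/2}(Γ)` is the trace space of
`H¹(D)` with its quotient norm, that is `H¹(D) / H¹₀(D)`, where `H¹₀(D)` is the closure of the
smooth functions with compact support in `D`. -/
def traceHalfNorm (D : Set (E d)) (w : E d → ℂ) (dw : Fin d → E d → ℂ) : ℝ≥0∞ :=
  ⨅ ρ : {ρ : E d → ℂ // ContDiff ℝ (⊤ : ℕ∞) ρ ∧ HasCompactSupport ρ ∧ tsupport ρ ⊆ D},
    h1Norm D (w - ρ.1) (fun i x => dw i x - pderivs ρ.1 x i)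

/-- The `H^{-1/2}(Γ)` norm of the normal trace `c · ν` of a divergence-free field `c ∈ L²(D)`.  The
normal trace is the functional `γ w ↦ ∫_D c · ∇w` (`w ∈ H¹(D)`) on `H^{1/2}(Γ)`, and its norm is the
dual norm. -/
def normalTraceNorm (D : Set (E d)) (c : E d → C3) : ℝ≥0∞ :=
  sInf {B : ℝ≥0∞ | ∀ (w : E d → ℂ) (dw : Fin d → E d → ℂ), IsH1 D w dw →
    ‖∫ x in D, dot (c x) (toC3 (fun i => dw i x))‖ₑ ≤ B * traceHalfNorm D w dw}

end Sobolev

/-! ### Periodic functions -/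

section Periodic

variable (d : ℕ)

/-- The unit cell `Y = (0,1)ᵈ`. -/
def cell : Set (E d) := {y | ∀ i, 0 < y i ∧ y i < 1}

/-- Lebesgue measure on the unit cell. -/
abbrev cellVol : Measure (E d) := volume.restrict (cell d)

variable {d}

/-- `Y`-periodic functions on `ℝᵈ`. -/
def IsPeriodic {X : Type*} (f : E d → X) : Prop :=
  ∀ (i : Fin d) (y : E d), f (y + basisVec d i) = f y

/-- Smooth `Y`-periodic functions. -/
def IsSmoothPeriodic {X : Type*} [NormedAddCommGroup X] [NormedSpace ℝ X] (f : E d → X) : Prop :=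
  ContDiff ℝ (⊤ : ℕ∞) f ∧ IsPeriodic f

variable (d)

/-- `L²(Y; ℂ³)`. -/
abbrev L2Y := Lp C3 2 (cellVol d)

/-- Pairs `(w, (∂ᵢ w)ᵢ)` of elements of `L²(Y; ℂ³)`, with norm
`(‖w‖² + ∑ᵢ ‖∂ᵢ w‖²)^{1/2}`. -/
abbrev GraphSpace := WithLp 2 (L2Y d × PiLp 2 (fun _ : Fin d => L2Y d))

/-- `H¹_per(Y; ℂ³)`: the closure of the smooth periodic functions in the `H¹(Y)` norm, each function
being stored together with its gradient. -/
def H1per : Submodule ℂ (GraphSpace d) :=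
  (Submodule.span ℂ {w : GraphSpace d | ∃ f : E d → C3, IsSmoothPeriodic f ∧
    (w.fst =ᵐ[cellVol d] f) ∧
    ∀ i, (w.snd i =ᵐ[cellVol d] fun y => pderivs f y i)}).topologicalClosure

/-- The elements with zero mean: those orthogonal to the constants in `L²(Y; ℂ³)`. -/
def zeroMean : Submodule ℂ (GraphSpace d) :=
  (Submodule.span ℂ {v : L2Y d | ∃ a : C3, v =ᵐ[cellVol d] fun _ => a})ᗮ.comap
    (WithLp.fstL 2 ℂ (L2Y d) (PiLp 2 (fun _ : Fin d => L2Y d))).toLinearMap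

/-- `H¹_♯(Y; ℂ³)`: periodic functions in `H¹` with zero mean, a Hilbert space. -/
abbrev H1sharp := ↥(H1per d ⊓ zeroMean d)

instance : CompleteSpace (H1sharp d) := by
  have hcl : IsClosed ((H1per d ⊓ zeroMean d : Submodule ℂ (GraphSpace d)) : Set (GraphSpace d)) := by
    rw [Submodule.coe_inf]
    refine IsClosed.inter (Submodule.isClosed_topologicalClosure _) ?_
    exact (Submodule.isClosed_orthogonal _).preimage
      (WithLp.fstL 2 ℂ (L2Y d) (PiLp 2 (fun _ : Fin d => L2Y d))).continuous
  exact hcl.completeSpace_coe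

variable {d}

/-- The function underlying an element of `H¹_♯(Y)`, as an element of `L²(Y)`. -/
def H1sharp.val (w : H1sharp d) : L2Y d := w.1.fst

/-- The partial derivative `∂ᵢ w`, as an element of `L²(Y)`. -/
def H1sharp.grad (w : H1sharp d) (i : Fin d) : L2Y d := w.1.snd i

/-- The curl of an element of `H¹_♯(Y)`. -/
def H1sharp.curl (w : H1sharp d) (y : E d) : C3 := curlOf (ext3 (fun i => H1sharp.grad w i y))

/-- The divergence of an element of `H¹_♯(Y)`. -/
def H1sharp.div (w : H1sharp d) (y : E d) : ℂ := divOf (ext3 (fun i => H1sharp.grad w i y))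

/-- `f` is the continuous periodic representative (on `ℝᵈ`) of `w ∈ H¹_♯(Y)`. -/
def IsContRep (w : H1sharp d) (f : E d → C3) : Prop :=
  Continuous f ∧ IsPeriodic f ∧ (H1sharp.val w =ᵐ[cellVol d] f)

open Classical in
/-- For a two-scale function `q : D → H¹_♯(Y)`, the function `q^ε(x) = q(x, x/ε)`, where `q(x, ·)`
is evaluated through its continuous periodic representative (zero if there is none). -/
def osc (ε : ℝ) (q : E d → H1sharp d) (x : E d) : C3 :=
  if h : ∃ f, IsContRep (q x) f then h.choose (ε⁻¹ • x) else 0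

/-- Fourier coefficients `∫_Y f(y) e^{-2πi α·y} dy`. -/
def fourierCoef (f : E d → ℂ) (α : Fin d → ℤ) : ℂ :=
  ∫ y in cell d, f y * Complex.exp (-(2 * Real.pi * Complex.I * ∑ j, (α j : ℂ) * (y j : ℂ)))

/-- The squared periodic semi-norm `|f|²_{H^s(Y)} = ∑_α (2π|α|)^{2s} |f^α|²`. -/
def hsSemiSq (s : ℝ) (f : E d → ℂ) : ℝ≥0∞ :=
  ∑' α : Fin d → ℤ, ENNReal.ofReal
    ((2 * Real.pi * Real.sqrt (∑ j, (α j : ℝ) ^ 2)) ^ (2 * s) * ‖fourierCoef f α‖ ^ 2)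

/-- The squared periodic norm: all integer orders up to `⌊s⌋`, plus the order `s` if `s` is not an
integer. -/
def hsNormSq (s : ℝ) (f : E d → ℂ) : ℝ≥0∞ :=
  ∑ m ∈ Finset.range (⌊s⌋₊ + 1), hsSemiSq (m : ℝ) f
    + if (⌊s⌋₊ : ℝ) = s then 0 else hsSemiSq s f

/-- The norm `‖M‖_{H^s(Y)}` of a periodic matrix field. -/
def matHsNorm (s : ℝ) (M : E d → Matrix (Fin d) (Fin d) ℂ) : ℝ≥0∞ :=
  (∑ i, ∑ j, hsNormSq s (fun y => M y i j)) ^ (1 / 2 : ℝ)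

/-- The norm `‖M‖_{L^∞(Y)}` of a periodic matrix field, with the matrix norm induced by the Euclidean
norm of `ℂᵈ`. -/
def matLinfNorm (M : E d → Matrix (Fin d) (Fin d) ℂ) : ℝ≥0∞ :=
  essSup (fun y => ‖Matrix.toEuclideanCLM (n := Fin d) (𝕜 := ℂ) (M y)‖ₑ) (cellVol d)

/-- Periodic matrix fields with zero mean, independent of the last variable, such that
`div (M w) = 0` in the periodic distributional sense for every constant vector `w`. -/
structure IsAdmissible (M : E d → Matrix (Fin d) (Fin d) ℂ) : Prop where
  measurable : ∀ i j, AEStronglyMeasurable (fun y => M y i j) volume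
  periodic : IsPeriodic M
  indep : ∀ t : ℝ, ∀ᵐ y : E d, M (y + t • basisVec d (d - 1)) = M y
  zero_mean : ∀ i j, ∫ y in cell d, M y i j = 0
  div_free : ∀ (w : Fin d → ℂ) (ψ : E d → ℂ), IsSmoothPeriodic ψ →
    ∫ y in cell d, ∑ i, (M y).mulVec w i * pderivs ψ y i = 0

/-- `q ∈ H¹(D; H¹_♯(Y))`, with weak derivatives `dq i = ∂_{xᵢ} q`, and for almost every `x ∈ D`
`curl_y q(x, ·) = M g(x)` and `div_y q(x, ·) = 0`. -/
structure IsVectorPotential (D : Set (E d)) (M : E d → Matrix (Fin d) (Fin d) ℂ)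
    (g : Fin d → E d → ℂ) (q : E d → H1sharp d) (dq : Fin d → E d → H1sharp d) : Prop where
  isH1 : IsH1 D q dq
  curl_eq : ∀ᵐ x ∂(vol D), ∀ᵐ y ∂(cellVol d),
    H1sharp.curl (q x) y = toC3 ((M y).mulVec (fun i => g i x))
  div_eq : ∀ᵐ x ∂(vol D), ∀ᵐ y ∂(cellVol d), H1sharp.div (q x) y = 0

/-- The function `(curl_x q)^ε`. -/
def curlXOsc (ε : ℝ) (dq : Fin d → E d → H1sharp d) (x : E d) : C3 :=
  curlOf (ext3 (fun i => osc ε (dq i) x))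

end Periodic

end PeriodicPotential

end

open PeriodicPotential

noncomputable section

namespace PeriodicPotential

/-! ### Fourier series on the unit cell -/

section FourierCell

-- The problem is linear in `∇u₀`. If `W_j` solves the cell problem for the `j`-th column of `M`,
-- then `q(x,·) = ∑ⱼ ∂ⱼu₀(x) W_j`. What remains is to study the `d` fixed fields `W_j` on the cell
-- and to estimate sums `∑ⱼ gⱼ Q_j(·/ε)` with `gⱼ` in `H¹(D)`.
--
-- Cell problem. A column `m` satisfies `α · m^α = 0`, so `q^α = i/(2π|α|²) α × m^α` solves both the
-- curl and the divergence equation, and these equations together with the zero mean determine all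
-- coefficients (`H1sharp_eq_zero`). Independence of `y_d` confines `α` to a lattice of dimension at
-- most two, on which `|α|^{-(2+2s)}` is summable. Weighing this against the `H^s` norm makes the
-- Fourier series absolutely convergent (`summable_colCoef`). Hence `W_j` has a bounded continuous
-- representative `Q_j`, a uniform limit of trigonometric polynomials whose curls converge in `L²`
-- (`exists_columnPotential`).
--
-- Rescaling. `R = Q_j(·/ε)` is bounded independently of `ε`, and its curl is bounded by a multiple
-- of `ε⁻¹`. The product rule `curl (gR) = ∇g × R + g curl R` is justified by a diagonal
-- approximation with smooth fields (`IsRoughField.exists_diagonal`). As the convergence to `R` is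
-- uniform on the whole space, hence also on `Γ`, the same approximation produces the tangential
-- trace (`exists_isTangentialTrace`).
--
-- Normal trace. For `U = ∑ⱼ gⱼRⱼ` and a cut-off `β` with compact support in `D`, `curl (βU)` is
-- orthogonal to gradients, so `curl U` may be replaced by `curl ((1-β)U)`, which lives in a
-- boundary strip of width `δ = min ε 1` (`exists_localized`). There it is controlled by `|∇g| +
-- δ⁻¹|g|`. The `L²` norm of `g` on the strip is at most a multiple of `√δ` times the geometric mean
-- of its `L²` norm and its `H¹` norm (`IsChart.exists_setLIntegral_strip_le`). The total is of
-- order `δ^{-1/2}` times that mean, and splitting the mean with the weight `k` gives the factor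
-- `(kε)^{-1/2}` (`inv_mul_sqrt_le`).

local instance : MeasureSpace UnitAddCircle := ⟨AddCircle.haarAddCircle⟩

local instance : Measure.IsAddHaarMeasure (volume : Measure UnitAddCircle) :=
  inferInstanceAs (Measure.IsAddHaarMeasure AddCircle.haarAddCircle)

local instance : IsProbabilityMeasure (volume : Measure UnitAddCircle) :=
  inferInstanceAs (IsProbabilityMeasure AddCircle.haarAddCircle)

variable {d : ℕ}

/-- The section of the covering map `ℝᵈ → ℝᵈ/ℤᵈ` with values in `(0,1]ᵈ`. -/
def cellSection (t : UnitAddTorus (Fin d)) : E d :=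
  WithLp.toLp 2 (UnitAddTorus.measurableEquivPiIoc (0 : Fin d → ℝ) t).1

lemma cellSection_coe (t : UnitAddTorus (Fin d)) (i : Fin d) :
    ((cellSection t i : ℝ) : UnitAddCircle) = t i := by
  have := (UnitAddTorus.measurableEquivPiIoc (0 : Fin d → ℝ)).symm_apply_apply t
  exact congrFun this i

lemma measurableEmbedding_cellSection :
    MeasurableEmbedding (cellSection : UnitAddTorus (Fin d) → E d) := by
  have h1 : MeasurableEmbedding (UnitAddTorus.measurableEquivPiIoc (0 : Fin d → ℝ)) :=
    (UnitAddTorus.measurableEquivPiIoc (0 : Fin d → ℝ)).measurableEmbedding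
  have h2 : MeasurableEmbedding (Subtype.val :
      {x : Fin d → ℝ // ∀ i, x i ∈ Set.Ioc ((0 : Fin d → ℝ) i) ((0 : Fin d → ℝ) i + 1)} → _) :=
    MeasurableEmbedding.subtype_coe (MeasurableSet.univ_pi' (fun i => measurableSet_Ioc))
  have h3 : MeasurableEmbedding (WithLp.toLp 2 : (Fin d → ℝ) → E d) :=
    (MeasurableEquiv.toLp 2 (Fin d → ℝ)).measurableEmbedding
  exact h3.comp (h2.comp h1)

lemma cellSection_range_ae :
    (WithLp.ofLp ⁻¹' {x : Fin d → ℝ | ∀ i, x i ∈ Set.Ioc ((0 : Fin d → ℝ) i) ((0 : Fin d → ℝ) i + 1)}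
      : Set (E d)) =ᵐ[volume] cell d := by
  have h1 : ({x : Fin d → ℝ | ∀ i, x i ∈ Set.Ioc ((0 : Fin d → ℝ) i) ((0 : Fin d → ℝ) i + 1)})
      =ᵐ[volume] {x : Fin d → ℝ | ∀ i, 0 < x i ∧ x i < 1} := by
    have e1 : {x : Fin d → ℝ | ∀ i, x i ∈ Set.Ioc ((0 : Fin d → ℝ) i) ((0 : Fin d → ℝ) i + 1)} =
      Set.univ.pi fun i => Set.Ioc 0 1 := by ext; simp
    have e2 : {x : Fin d → ℝ | ∀ i, 0 < x i ∧ x i < 1} = Set.univ.pi fun i => Set.Ioo 0 1 := by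
      ext; simp
    rw [e1, e2]
    exact (Measure.univ_pi_Ioc_ae_eq_Icc (μ := fun _ : Fin d => volume)).trans
      (Measure.univ_pi_Ioo_ae_eq_Icc (μ := fun _ : Fin d => volume)).symm
  exact (PiLp.volume_preserving_ofLp (Fin d)).quasiMeasurePreserving.preimage_ae_eq h1

/-- Transports Parseval, Riesz–Fischer and translation invariance from the torus to the cell. The
section takes values in the half-open cube, which differs from the open cell by a null set. -/
lemma measurePreserving_cellSection :
    MeasurePreserving (cellSection : UnitAddTorus (Fin d) → E d) volume (cellVol d) := by
  have hm : MeasurableSet {x : Fin d → ℝ | ∀ i, x i ∈ Set.Ioc ((0 : Fin d → ℝ) i)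
      ((0 : Fin d → ℝ) i + 1)} := MeasurableSet.univ_pi' (fun i => measurableSet_Ioc)
  have h1 := UnitAddTorus.measurePreserving_equivPiIoc (0 : Fin d → ℝ)
  have h2 : MeasurePreserving (Subtype.val :
      {x : Fin d → ℝ // ∀ i, x i ∈ Set.Ioc ((0 : Fin d → ℝ) i) ((0 : Fin d → ℝ) i + 1)} → _)
      (Measure.comap Subtype.val volume) (volume.restrict _) :=
    ⟨measurable_subtype_coe, map_comap_subtype_coe hm _⟩
  have h3 := (PiLp.volume_preserving_toLp (Fin d)).restrict_preimage
    (s := WithLp.ofLp ⁻¹' {x : Fin d → ℝ | ∀ i, x i ∈ Set.Ioc ((0 : Fin d → ℝ) i)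
      ((0 : Fin d → ℝ) i + 1)}) (by exact (PiLp.volume_preserving_ofLp (Fin d)).measurable hm)
  rw [Measure.restrict_congr_set cellSection_range_ae] at h3
  exact h3.comp (h2.comp h1)

instance : IsProbabilityMeasure (cellVol d) := by
  rw [← (measurePreserving_cellSection (d := d)).map_eq]
  exact Measure.isProbabilityMeasure_map measurableEmbedding_cellSection.measurable.aemeasurable

/-- The character `y ↦ e^{2πi α·y}`. -/
def expo (α : Fin d → ℤ) (y : E d) : ℂ :=
  Complex.exp (2 * Real.pi * Complex.I * ∑ j, (α j : ℂ) * (y j : ℂ))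

lemma expo_cellSection (α : Fin d → ℤ) (t : UnitAddTorus (Fin d)) :
    expo α (cellSection t) = UnitAddTorus.mFourier α t := by
  simp only [UnitAddTorus.mFourier, ContinuousMap.coe_mk, expo, Finset.mul_sum, Complex.exp_sum]
  refine Finset.prod_congr rfl fun i _ => ?_
  rw [← cellSection_coe t i, fourier_coe_apply]
  congr 1
  push_cast
  ring

lemma expo_neg (α : Fin d → ℤ) (y : E d) : expo (-α) y =
    Complex.exp (-(2 * Real.pi * Complex.I * ∑ j, (α j : ℂ) * (y j : ℂ))) := by
  simp [expo]

lemma fourierCoef_eq_expo (f : E d → ℂ) (α : Fin d → ℤ) :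
    fourierCoef f α = ∫ y in cell d, f y * expo (-α) y := by
  simp only [fourierCoef, expo_neg]

lemma fourierCoef_eq_mFourierCoeff (f : E d → ℂ) (α : Fin d → ℤ) :
    fourierCoef f α = UnitAddTorus.mFourierCoeff (fun t => f (cellSection t)) α := by
  rw [fourierCoef_eq_expo,
    ← measurePreserving_cellSection.integral_comp measurableEmbedding_cellSection]
  simp [UnitAddTorus.mFourierCoeff, expo_cellSection, mul_comm]

lemma norm_expo (α : Fin d → ℤ) (y : E d) : ‖expo α y‖ = 1 := by
  rw [expo, Complex.norm_exp]
  have : (2 * Real.pi * Complex.I * ∑ j, (α j : ℂ) * (y j : ℂ)) =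
      ((2 * Real.pi * ∑ j, (α j : ℝ) * y j : ℝ) : ℂ) * Complex.I := by
    push_cast; ring
  rw [this]; simp

lemma expo_add (α : Fin d → ℤ) (y z : E d) : expo α (y + z) = expo α y * expo α z := by
  simp only [expo, ← Complex.exp_add, PiLp.add_apply, ← mul_add, ← Finset.sum_add_distrib]
  congr 2
  refine Finset.sum_congr rfl fun i _ => ?_
  push_cast; ring

lemma contDiff_expo (α : Fin d → ℤ) : ContDiff ℝ (⊤ : ℕ∞) (expo α) := by
  unfold expo
  refine ContDiff.cexp (contDiff_const.mul (ContDiff.sum fun i _ => contDiff_const.mul ?_))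
  exact Complex.ofRealCLM.contDiff.comp (by fun_prop)

lemma continuous_expo (α : Fin d → ℤ) : Continuous (expo α) := (contDiff_expo α).continuous

lemma basisVec_apply (i : Fin d) (j : Fin d) : basisVec d i j = if j = i then 1 else 0 := by
  simp [basisVec]

lemma expo_smul_basisVec (α : Fin d → ℤ) (i : Fin d) (t : ℝ) :
    expo α (t • basisVec d i) = Complex.exp (2 * Real.pi * Complex.I * (α i * t)) := by
  rw [expo, Finset.sum_eq_single i] <;> simp +contextual [basisVec_apply]

lemma isPeriodic_expo (α : Fin d → ℤ) : IsPeriodic (expo α) := by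
  intro i y
  have := expo_smul_basisVec α i 1
  rw [one_smul] at this
  rw [expo_add, this]
  have : Complex.exp (2 * Real.pi * Complex.I * (α i * (1 : ℝ))) = 1 := by
    rw [Complex.exp_eq_one_iff]
    exact ⟨α i, by push_cast; ring⟩
  rw [this, mul_one]

lemma isSmoothPeriodic_expo (α : Fin d → ℤ) : IsSmoothPeriodic (expo α) :=
  ⟨contDiff_expo α, isPeriodic_expo α⟩

lemma hasFDerivAt_expo (α : Fin d → ℤ) (y : E d) :
    HasFDerivAt (expo α) (expo α y • ((2 * Real.pi * Complex.I) •
      ∑ j, (α j : ℂ) • (Complex.ofRealCLM.comp (EuclideanSpace.proj j : E d →L[ℝ] ℝ)))) y := by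
  unfold expo
  refine HasFDerivAt.cexp (HasFDerivAt.const_mul ?_ _)
  refine HasFDerivAt.fun_sum fun j _ => HasFDerivAt.const_mul ?_ _
  exact (Complex.ofRealCLM.comp (EuclideanSpace.proj j : E d →L[ℝ] ℝ)).hasFDerivAt

lemma fderiv_expo (α : Fin d → ℤ) (y : E d) (i : Fin d) :
    fderiv ℝ (expo α) y (basisVec d i) = (2 * Real.pi * Complex.I * α i) * expo α y := by
  rw [(hasFDerivAt_expo α y).fderiv]
  simp [basisVec_apply, apply_ite]
  ring

lemma IsPeriodic.add_int_smul {X : Type*} {f : E d → X} (hf : IsPeriodic f) (i : Fin d) (n : ℤ)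
    (y : E d) : f (y + (n : ℝ) • basisVec d i) = f y := by
  induction n using Int.induction_on with
  | zero => simp
  | succ n ih =>
    rw [← ih, ← hf i (y + ((n : ℤ) : ℝ) • basisVec d i)]
    congr 1; push_cast; rw [add_smul, one_smul, add_assoc]
  | pred n ih =>
    rw [← ih, ← hf i (y + _)]
    congr 1; push_cast; rw [sub_smul, one_smul]; abel

lemma sum_smul_basisVec (v : E d) : ∑ i : Fin d, v i • basisVec d i = v := by
  ext j
  simp [basisVec_apply]

lemma IsPeriodic.add_lattice {X : Type*} {f : E d → X} (hf : IsPeriodic f) (n : Fin d → ℤ)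
    (y v : E d) (hv : ∀ i, v i = n i) : f (y + v) = f y := by
  have key : ∀ S : Finset (Fin d), f (y + ∑ i ∈ S, (n i : ℝ) • basisVec d i) = f y := by
    intro S
    induction S using Finset.induction_on with
    | empty => simp
    | insert a S ha ih =>
      rw [Finset.sum_insert ha, add_comm (_ • _), ← add_assoc, hf.add_int_smul, ih]
  have := key Finset.univ
  rw [← this]
  congr 2
  rw [← sum_smul_basisVec v]
  simp [hv]

lemma IsPeriodic.eq_of_coe_eq {X : Type*} {f : E d → X} (hf : IsPeriodic f) {y z : E d}
    (h : ∀ i, ((y i : ℝ) : UnitAddCircle) = (z i : ℝ)) : f y = f z := by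
  have : ∀ i, ∃ n : ℤ, y i - z i = n := by
    intro i
    have := (AddCircle.coe_eq_coe_iff_of_mem_Ico (p := 1) (a := 0)
      (x := y i) (y := z i))
    have h0 := h i
    rw [QuotientAddGroup.eq] at h0
    obtain ⟨n, hn⟩ := AddSubgroup.mem_zmultiples_iff.1 h0
    refine ⟨-n, ?_⟩
    simp at hn
    push_cast
    linarith
  choose n hn using this
  have := hf.add_lattice n z (y - z) (by simpa using hn)
  rw [← this]; congr 1; abel

lemma IsPeriodic.comp_cellSection_add {X : Type*} {f : E d → X} (hf : IsPeriodic f) (v : E d)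
    (t : UnitAddTorus (Fin d)) : f (cellSection t + v) =
      f (cellSection (t + fun i => ((v i : ℝ) : UnitAddCircle))) := by
  refine hf.eq_of_coe_eq fun i => ?_
  rw [cellSection_coe]
  simp [cellSection_coe]

/-- On the torus this is the translation invariance of Haar measure. -/
lemma IsPeriodic.setIntegral_cell_add {X : Type*} [NormedAddCommGroup X] [NormedSpace ℝ X]
    {f : E d → X} (hf : IsPeriodic f) (v : E d) :
    ∫ y in cell d, f (y + v) = ∫ y in cell d, f y := by
  rw [← measurePreserving_cellSection.integral_comp measurableEmbedding_cellSection,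
    ← measurePreserving_cellSection.integral_comp measurableEmbedding_cellSection]
  simp only [hf.comp_cellSection_add v]
  exact integral_add_right_eq_self (fun t => f (cellSection t)) _

/-- The Fourier series of a square integrable function on the unit cell converges to it. -/
lemma tendsto_fourier_series {f : E d → ℂ} (hf : MemLp f 2 (cellVol d)) :
    Tendsto (fun S : Finset (Fin d → ℤ) =>
      eLpNorm (fun y => f y - ∑ α ∈ S, fourierCoef f α * expo α y) 2 (cellVol d)) atTop (𝓝 0) := by
  have hF : MemLp (fun t => f (cellSection t)) 2 volume :=
    hf.comp_measurePreserving measurePreserving_cellSection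
  have hs := UnitAddTorus.hasSum_mFourier_series_L2 hF.toLp
  have hs' := hs
  rw [HasSum, SummationFilter.unconditional_filter] at hs'
  rw [tendsto_iff_edist_tendsto_0] at hs'
  refine hs'.congr fun S => ?_
  rw [edist_comm, Lp.edist_def]
  have hmeas : AEStronglyMeasurable
      (fun y => f y - ∑ α ∈ S, fourierCoef f α * expo α y) (cellVol d) := by
    refine hf.1.sub (Continuous.aestronglyMeasurable ?_)
    exact continuous_finsetSum _ fun α _ => continuous_const.mul (continuous_expo α)
  rw [← eLpNorm_comp_measurePreserving hmeas measurePreserving_cellSection]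
  refine eLpNorm_congr_ae ?_
  have h1 := hF.coeFn_toLp
  have h2 : ((∑ α ∈ S, UnitAddTorus.mFourierCoeff (hF.toLp) α •
      UnitAddTorus.mFourierLp 2 α : Lp ℂ 2 (volume : Measure (UnitAddTorus (Fin d)))) :
        UnitAddTorus (Fin d) → ℂ) =ᵐ[volume]
      fun t => ∑ α ∈ S, UnitAddTorus.mFourierCoeff (hF.toLp) α * UnitAddTorus.mFourier α t := by
    refine (Lp.coeFn_finsetSum S _).trans ?_
    have : ∀ α ∈ S, ∀ᵐ t, (UnitAddTorus.mFourierCoeff (hF.toLp) α •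
      UnitAddTorus.mFourierLp 2 α : Lp ℂ 2 (volume : Measure (UnitAddTorus (Fin d)))) t =
        UnitAddTorus.mFourierCoeff (hF.toLp) α * UnitAddTorus.mFourier α t := by
      intro α _
      filter_upwards [Lp.coeFn_smul (UnitAddTorus.mFourierCoeff (hF.toLp) α)
        (UnitAddTorus.mFourierLp (d := Fin d) 2 α), UnitAddTorus.coeFn_mFourierLp 2 α] with t h1 h2
      rw [h1, Pi.smul_apply, h2, smul_eq_mul]
    rw [← Finset.eventually_all] at this
    filter_upwards [this] with t ht
    rw [Finset.sum_apply]
    exact Finset.sum_congr rfl fun α hα => ht α hα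
  filter_upwards [h1, h2] with t h1 h2
  simp only [Function.comp, Pi.sub_apply]
  rw [h1, h2]
  congr 1
  refine Finset.sum_congr rfl fun α _ => ?_
  rw [expo_cellSection, fourierCoef_eq_mFourierCoeff]
  congr 1
  refine integral_congr_ae ?_
  filter_upwards [hF.coeFn_toLp] with t ht
  rw [ht]

/-- A square integrable function on the cell is determined by its Fourier coefficients. -/
lemma ae_eq_zero_of_fourierCoef_eq_zero {f : E d → ℂ} (hf : MemLp f 2 (cellVol d))
    (h : ∀ α, fourierCoef f α = 0) : f =ᵐ[cellVol d] 0 := by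
  have := tendsto_fourier_series hf
  simp only [h, zero_mul, Finset.sum_const_zero, sub_zero] at this
  have h0 := tendsto_nhds_unique this tendsto_const_nhds
  exact (eLpNorm_eq_zero_iff hf.1 (by norm_num)).1 h0.symm

end FourierCell

/-! ### Periodic functions on the whole space -/

section PeriodicSpace

variable {d : ℕ}

/-- A tuple of integers as a point of `ℝᵈ`. -/
def intVec (n : Fin d → ℤ) : E d := WithLp.toLp 2 fun i => (n i : ℝ)

lemma IsPeriodic.add_intVec {X : Type*} {f : E d → X} (hf : IsPeriodic f) (n : Fin d → ℤ)
    (y : E d) : f (y + intVec n) = f y :=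
  hf.add_lattice n y _ fun _ => rfl

lemma IsPeriodic.sub_intVec {X : Type*} {f : E d → X} (hf : IsPeriodic f) (n : Fin d → ℤ)
    (y : E d) : f (y - intVec n) = f y := by
  rw [← hf.add_intVec n (y - intVec n), sub_add_cancel]

/-- The half-open unit cube. -/
def cube (d : ℕ) : Set (E d) := {y | ∀ i, 0 < y i ∧ y i ≤ 1}

lemma cube_ae_eq_cell : cube d =ᵐ[volume] cell d := by
  have h : cube d = (WithLp.ofLp ⁻¹' {x : Fin d → ℝ | ∀ i, x i ∈ Set.Ioc ((0 : Fin d → ℝ) i)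
      ((0 : Fin d → ℝ) i + 1)} : Set (E d)) := by
    ext y; simp [cube]
  rw [h]
  exact cellSection_range_ae

/-- The integer part of a point. -/
def cubeIndex (y : E d) : Fin d → ℤ := fun i => ⌈y i⌉ - 1

lemma sub_cubeIndex_mem (y : E d) : y - intVec (cubeIndex y) ∈ cube d := by
  intro i
  simp only [intVec, cubeIndex, PiLp.sub_apply]
  push_cast
  have h1 := Int.le_ceil (y i)
  have h2 := Int.ceil_lt_add_one (y i)
  constructor <;> linarith

lemma cube_subset_closedBall : cube d ⊆ Metric.closedBall 0 (Real.sqrt d) := by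
  intro y hy
  rw [mem_closedBall_zero_iff, EuclideanSpace.norm_eq]
  refine Real.sqrt_le_sqrt ?_
  calc ∑ i, ‖y i‖ ^ 2 ≤ ∑ i : Fin d, (1 : ℝ) := by
        refine Finset.sum_le_sum fun i _ => ?_
        obtain ⟨h1, h2⟩ := hy i
        rw [Real.norm_of_nonneg h1.le]
        nlinarith
    _ = d := by simp

/-- The integer translates of the half-open cube cover the space and are countable in number, so the
exceptional set is a countable union of translates of a null set. -/
lemma IsPeriodic.ae_of_ae_cell {p : E d → Prop} (hp : IsPeriodic p)
    (h : ∀ᵐ y ∂(cellVol d), p y) : ∀ᵐ y : E d, p y := by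
  rw [cellVol, ← Measure.restrict_congr_set cube_ae_eq_cell, ae_iff] at h
  have h0 : volume ({y : E d | ¬ p y} ∩ cube d) = 0 :=
    le_antisymm ((Measure.le_restrict_apply _ _).trans h.le) zero_le
  rw [ae_iff]
  refine measure_mono_null (t := ⋃ n : Fin d → ℤ, (fun y => y + -intVec n) ⁻¹'
    ({y : E d | ¬ p y} ∩ cube d)) ?_ ?_
  · intro y hy
    refine Set.mem_iUnion.2 ⟨cubeIndex y, ?_, ?_⟩
    · simp only [Set.mem_ofPred_eq, ← sub_eq_add_neg] at hy ⊢
      rwa [hp.sub_intVec]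
    · simp only [← sub_eq_add_neg]; exact sub_cubeIndex_mem y
  · refine measure_iUnion_null fun n => ?_
    rw [measure_preimage_add_right, h0]

/-- A bounded set meets only finitely many integer translates of the cube, and `N` is their number.
-/
lemma IsPeriodic.exists_setLIntegral_le {B : Set (E d)} (hB : Bornology.IsBounded B) :
    ∃ N : ℝ≥0, ∀ f : E d → ℝ≥0∞, IsPeriodic f → ∫⁻ y in B, f y ≤ N * ∫⁻ y in cell d, f y := by
  obtain ⟨R, hR⟩ := hB.subset_closedBall 0
  have hfin : (Set.range fun y : B => cubeIndex (y : E d)).Finite := by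
    refine (Set.Finite.pi' fun i : Fin d => Set.finite_Icc (⌈-R⌉ - 1) (⌈R⌉ - 1)).subset ?_
    rintro _ ⟨⟨y, hy⟩, rfl⟩ i
    have h1 : |y i| ≤ R := by
      have := hR hy
      rw [mem_closedBall_zero_iff] at this
      exact (PiLp.norm_apply_le y i).trans this
    rw [abs_le] at h1
    exact ⟨sub_le_sub_right (Int.ceil_le_ceil h1.1) 1, sub_le_sub_right (Int.ceil_le_ceil h1.2) 1⟩
  refine ⟨hfin.toFinset.card, fun f hf => ?_⟩
  have hsub : B ⊆ ⋃ n ∈ hfin.toFinset, (fun y => y + -intVec n) ⁻¹' cube d := by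
    intro y hy
    simp only [Set.mem_iUnion]
    refine ⟨cubeIndex y, hfin.mem_toFinset.2 ⟨⟨y, hy⟩, rfl⟩, ?_⟩
    rw [Set.mem_preimage, ← sub_eq_add_neg]
    exact sub_cubeIndex_mem y
  calc ∫⁻ y in B, f y ≤ ∫⁻ y in ⋃ n ∈ hfin.toFinset, (fun y => y + -intVec n) ⁻¹' cube d, f y :=
        lintegral_mono_set hsub
    _ ≤ ∑ n ∈ hfin.toFinset, ∫⁻ y in (fun y => y + -intVec n) ⁻¹' cube d, f y := by
        rw [← Finset.sum_coe_sort, ← tsum_fintype (L := SummationFilter.unconditional _)]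
        refine le_trans (le_of_eq ?_) (lintegral_iUnion_le
          (fun n : hfin.toFinset => (fun y => y + -intVec (n : Fin d → ℤ)) ⁻¹' cube d) f)
        congr 2
        exact Set.biUnion_eq_iUnion (hfin.toFinset : Set (Fin d → ℤ))
          (fun n _ => (fun y => y + -intVec n) ⁻¹' cube d)
    _ = ∑ n ∈ hfin.toFinset, ∫⁻ y in cell d, f y := by
        refine Finset.sum_congr rfl fun n _ => ?_
        have := (measurePreserving_add_right (volume : Measure (E d)) (-intVec n)
          ).setLIntegral_comp_preimage_emb
          (measurableEmbedding_addRight (-intVec n)) f (cube d)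
        simp only [← sub_eq_add_neg, hf.sub_intVec] at this ⊢
        rw [this, setLIntegral_congr cube_ae_eq_cell]
    _ = _ := by simp

lemma IsPeriodic.exists_norm_le {X : Type*} [NormedAddCommGroup X] {f : E d → X}
    (hf : IsPeriodic f) (hc : Continuous f) : ∃ C : ℝ, ∀ y, ‖f y‖ ≤ C := by
  obtain ⟨C, hC⟩ := (isCompact_closedBall (0 : E d) (Real.sqrt d)).exists_bound_of_continuousOn
    hc.continuousOn
  refine ⟨C, fun y => ?_⟩
  rw [← hf.sub_intVec (cubeIndex y)]
  exact hC _ (cube_subset_closedBall (sub_cubeIndex_mem y))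

lemma IsPeriodic.fderiv_apply {X : Type*} [NormedAddCommGroup X] [NormedSpace ℝ X] {f : E d → X}
    (hf : IsPeriodic f) : IsPeriodic (fderiv ℝ f) := by
  intro i y
  rw [← fderiv_comp_add_right]
  congr 1
  funext z
  exact hf i z

/-- Along each segment of length one in the direction `i`, the derivative integrates to zero by
periodicity. Integrating this over the cell and exchanging the integrals gives an average over `t`
of cell integrals of translates, all of which equal the integral sought. -/
lemma IsPeriodic.integral_fderiv_eq_zero {f : E d → ℂ} (hf : IsPeriodic f)
    (hc : ContDiff ℝ 1 f) (i : Fin d) : ∫ y in cell d, fderiv ℝ f y (basisVec d i) = 0 := by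
  have hcont : Continuous fun y => fderiv ℝ f y (basisVec d i) :=
    (hc.continuous_fderiv one_ne_zero).clm_apply continuous_const
  have hper : IsPeriodic fun y => fderiv ℝ f y (basisVec d i) := fun j y => by
    simp only [hf.fderiv_apply j y]
  obtain ⟨C, hC⟩ := hper.exists_norm_le hcont
  have h1 : ∫ y in cell d, (∫ t in (0 : ℝ)..1, fderiv ℝ f (y + t • basisVec d i) (basisVec d i)) = 0 := by
    have : ∀ y : E d, (∫ t in (0 : ℝ)..1, fderiv ℝ f (y + t • basisVec d i) (basisVec d i)) = 0 := by
      intro y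
      have hd : ∀ t ∈ Set.uIcc (0 : ℝ) 1, HasDerivAt (fun t : ℝ => f (y + t • basisVec d i))
          (fderiv ℝ f (y + t • basisVec d i) (basisVec d i)) t := by
        intro t _
        have h2 : HasDerivAt (fun t : ℝ => y + t • basisVec d i) (basisVec d i) t := by
          simpa using ((hasDerivAt_id t).smul_const (basisVec d i)).const_add y
        exact ((hc.differentiable one_ne_zero _).hasFDerivAt).comp_hasDerivAt t h2
      rw [intervalIntegral.integral_eq_sub_of_hasDerivAt hd]
      · rw [one_smul, zero_smul, add_zero, hf i y, sub_self]
      · exact Continuous.intervalIntegrable (by fun_prop) _ _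
    simp [this]
  simp only [intervalIntegral.integral_of_le zero_le_one] at h1
  rw [integral_integral_swap] at h1
  · simp only [hper.setIntegral_cell_add] at h1
    simpa using h1
  · refine Integrable.of_bound (C := C) ?_ ?_
    · refine Continuous.aestronglyMeasurable ?_
      simp only [Function.uncurry_def]
      fun_prop
    · exact Eventually.of_forall fun p => hC _

end PeriodicSpace

/-! ### Fourier description of `H¹_♯(Y)` -/

section FourierSharp

/-- Riesz–Fischer: square summable families are families of Fourier coefficients. -/
lemma exists_fourierCoef_eq {d : ℕ} (b : (Fin d → ℤ) → ℂ) (hb : Summable fun α => ‖b α‖ ^ 2) :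
    ∃ f : E d → ℂ, MemLp f 2 (cellVol d) ∧ ∀ α, fourierCoef f α = b α := by
  have hb' : Memℓp b 2 := by
    rw [memℓp_gen_iff (by norm_num)]
    simpa using hb
  let F := (UnitAddTorus.mFourierBasis (d := Fin d)).repr.symm ⟨b, hb'⟩
  -- The function on `ℝᵈ` is `F` composed with the covering map. Its pull-back along the section is
  -- then `F` exactly, with no choice of representative to control.
  have hcomp : (fun y : E d => F (fun i => ((y i : ℝ) : UnitAddCircle))) ∘ cellSection = F := by
    funext t
    simp only [Function.comp]
    congr 1
    funext i
    exact cellSection_coe t i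
  refine ⟨fun y => F (fun i => ((y i : ℝ) : UnitAddCircle)), ?_, fun α => ?_⟩
  · rw [← measurePreserving_cellSection.map_eq,
      measurableEmbedding_cellSection.memLp_map_measure_iff, hcomp]
    exact Lp.memLp F
  · rw [fourierCoef_eq_mFourierCoeff]
    have : (fun t : UnitAddTorus (Fin d) => F (fun i => ((cellSection t i : ℝ) : UnitAddCircle)))
      = F := hcomp
    simp only [this]
    rw [← UnitAddTorus.mFourierBasis_repr]
    simp [F]

variable {d : ℕ}

/-- The vector of Fourier coefficients of a `ℂ³`-valued function. -/
def vcoef (f : E d → C3) (α : Fin d → ℤ) : C3 :=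
  WithLp.toLp 2 fun k => fourierCoef (fun y => f y k) α

/-- The partial sums of the Fourier series. -/
def fpart (q : (Fin d → ℤ) → C3) (S : Finset (Fin d → ℤ)) (y : E d) : C3 :=
  ∑ α ∈ S, expo α y • q α

lemma fpart_apply (q : (Fin d → ℤ) → C3) (S : Finset (Fin d → ℤ)) (y : E d) (k : Fin 3) :
    fpart q S y k = ∑ α ∈ S, q α k * expo α y := by
  simp [fpart, mul_comm]

lemma isSmoothPeriodic_fpart (q : (Fin d → ℤ) → C3) (S : Finset (Fin d → ℤ)) :
    IsSmoothPeriodic (fpart q S) := by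
  refine ⟨?_, fun i y => ?_⟩
  · unfold fpart
    exact ContDiff.sum fun α _ => (contDiff_expo α).smul contDiff_const
  · simp only [fpart, isPeriodic_expo _ i y]

lemma pderivs_fpart (q : (Fin d → ℤ) → C3) (S : Finset (Fin d → ℤ)) (y : E d) (i : Fin d) :
    pderivs (fpart q S) y i =
      fpart (fun α => (2 * Real.pi * Complex.I * α i) • q α) S y := by
  have h : HasFDerivAt (fpart q S) (∑ α ∈ S, (fderiv ℝ (expo α) y).smulRight (q α)) y := by
    unfold fpart
    refine HasFDerivAt.fun_sum fun α _ => ?_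
    exact (((contDiff_expo α).differentiable (by simp)) y).hasFDerivAt.smul_const (q α)
  rw [pderivs, h.fderiv]
  simp only [fpart, sum_apply, ContinuousLinearMap.smulRight_apply,
    fderiv_expo, smul_smul]
  exact Finset.sum_congr rfl fun α _ => by rw [mul_comm]

lemma eLpNorm_le_sum_apply {X : Type*} [MeasurableSpace X] {μ : Measure X} {f : X → C3}
    (hf : AEStronglyMeasurable f μ) :
    eLpNorm f 2 μ ≤ ∑ k, eLpNorm (fun y => f y k) 2 μ := by
  have hk : ∀ k : Fin 3, AEStronglyMeasurable (fun y => f y k) μ := fun k =>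
    (EuclideanSpace.proj (𝕜 := ℂ) k).continuous.comp_aestronglyMeasurable hf
  calc eLpNorm f 2 μ ≤ eLpNorm (∑ k : Fin 3, fun y => ‖f y k‖) 2 μ := by
        refine eLpNorm_mono_real fun y => ?_
        have h := EuclideanSpace.norm_eq (f y)
        rw [h, Finset.sum_apply]
        exact Real.sqrt_le_iff.2 ⟨Finset.sum_nonneg fun _ _ => norm_nonneg _,
          Finset.sum_sq_le_sq_sum_of_nonneg fun _ _ => norm_nonneg _⟩
    _ ≤ ∑ k, eLpNorm (fun y => ‖f y k‖) 2 μ :=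
        eLpNorm_sum_le (fun k _ => (hk k).norm) (by norm_num)
    _ = _ := by simp only [eLpNorm_norm]

lemma tendsto_fpart {f : E d → C3} (hf : MemLp f 2 (cellVol d)) :
    Tendsto (fun S => eLpNorm (fun y => f y - fpart (vcoef f) S y) 2 (cellVol d)) atTop (𝓝 0) := by
  have h : Tendsto (fun S => ∑ k : Fin 3, eLpNorm
      (fun y => f y k - ∑ α ∈ S, fourierCoef (fun y => f y k) α * expo α y) 2 (cellVol d))
      atTop (𝓝 0) := by
    have := tendsto_finsetSum Finset.univ fun (k : Fin 3) _ =>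
      tendsto_fourier_series (hf.eval_piLp k)
    simpa using this
  refine tendsto_of_tendsto_of_tendsto_of_le_of_le tendsto_const_nhds h (fun _ => zero_le)
    fun S => ?_
  refine (eLpNorm_le_sum_apply
    (hf.1.sub (isSmoothPeriodic_fpart _ S).1.continuous.aestronglyMeasurable)).trans (le_of_eq ?_)
  refine Finset.sum_congr rfl fun k _ => ?_
  congr 1
  funext y
  simp [fpart_apply, vcoef]

/-- The character as an element of `L²(Y)`. -/
def expoLp (α : Fin d → ℤ) : Lp ℂ 2 (cellVol d) :=
  MemLp.toLp (expo α) (MemLp.of_bound (continuous_expo α).aestronglyMeasurable 1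
    (Eventually.of_forall fun y => (norm_expo α y).le))

lemma conj_expo (α : Fin d → ℤ) (y : E d) : (starRingEnd ℂ) (expo α y) = expo (-α) y := by
  simp only [expo, ← Complex.exp_conj]
  congr 1
  simp only [map_mul, map_sum, Complex.conj_ofReal, Complex.conj_I, map_ofNat, map_intCast,
    Pi.neg_apply, Int.cast_neg, neg_mul, Finset.sum_neg_distrib, mul_neg]

/-- The Fourier coefficient as a continuous linear functional on `L²(Y; ℂ³)`. -/
def coefL (α : Fin d → ℤ) (k : Fin 3) : L2Y d →L[ℂ] ℂ :=
  (innerSL ℂ (expoLp α)).comp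
    (ContinuousLinearMap.compLpL 2 (cellVol d) (EuclideanSpace.proj (𝕜 := ℂ) k))

lemma coefL_apply (α : Fin d → ℤ) (k : Fin 3) (v : L2Y d) :
    coefL α k v = fourierCoef (fun y => v y k) α := by
  rw [coefL, ContinuousLinearMap.comp_apply, innerSL_apply_apply, L2.inner_def, fourierCoef_eq_expo]
  refine integral_congr_ae ?_
  filter_upwards [MemLp.coeFn_toLp (MemLp.of_bound (continuous_expo α).aestronglyMeasurable 1
    (Eventually.of_forall fun y => (norm_expo α y).le) : MemLp (expo α) 2 (cellVol d)),
    ContinuousLinearMap.coeFn_compLpL (EuclideanSpace.proj (𝕜 := ℂ) k) v] with y h1 h2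
  rw [expoLp, h1, h2]
  simp [conj_expo]

lemma vcoef_apply (v : L2Y d) (α : Fin d → ℤ) (k : Fin 3) : vcoef v α k = coefL α k v := by
  rw [coefL_apply]; rfl

lemma fourierCoef_congr {f g : E d → ℂ} (h : f =ᵐ[cellVol d] g) (α : Fin d → ℤ) :
    fourierCoef f α = fourierCoef g α := by
  rw [fourierCoef_eq_expo, fourierCoef_eq_expo]
  refine integral_congr_ae ?_
  filter_upwards [h] with y hy
  rw [hy]

/-- Integration by parts on the torus: the derivative of the periodic function `f · expo (-α)` has
zero integral. -/
lemma fourierCoef_pderivs {f : E d → ℂ} (hf : IsSmoothPeriodic f) (α : Fin d → ℤ) (i : Fin d) :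
    fourierCoef (fun y => fderiv ℝ f y (basisVec d i)) α =
      2 * Real.pi * Complex.I * α i * fourierCoef f α := by
  have hf1 : ContDiff ℝ 1 f := hf.1.of_le (by norm_cast)
  have he1 : ContDiff ℝ 1 (expo (-α)) := (contDiff_expo (-α)).of_le (by norm_cast)
  have hper : IsPeriodic (fun y => f y * expo (-α) y) := fun j y => by
    simp only [hf.2 j y, isPeriodic_expo (-α) j y]
  have h0 := hper.integral_fderiv_eq_zero (hf1.mul he1) i
  have hd : ∀ y, fderiv ℝ (fun y => f y * expo (-α) y) y (basisVec d i) =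
      fderiv ℝ f y (basisVec d i) * expo (-α) y -
        (2 * Real.pi * Complex.I * α i) * (f y * expo (-α) y) := by
    intro y
    rw [fderiv_fun_mul (hf1.differentiable one_ne_zero y) (he1.differentiable one_ne_zero y)]
    simp only [add_apply, smul_apply, smul_eq_mul,
      fderiv_expo]
    push_cast [Pi.neg_apply]
    ring
  simp only [hd] at h0
  have hc1 : Continuous fun y => fderiv ℝ f y (basisVec d i) * expo (-α) y :=
    ((hf1.continuous_fderiv one_ne_zero).clm_apply continuous_const).mul (continuous_expo _)
  have hp1 : IsPeriodic fun y => fderiv ℝ f y (basisVec d i) * expo (-α) y := fun j y => by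
    simp only [hf.2.fderiv_apply j y, isPeriodic_expo (-α) j y]
  obtain ⟨C1, hC1⟩ := hp1.exists_norm_le hc1
  obtain ⟨C2, hC2⟩ := hper.exists_norm_le (hf1.mul he1).continuous
  rw [integral_sub, integral_const_mul, sub_eq_zero] at h0
  · rw [fourierCoef_eq_expo, fourierCoef_eq_expo, h0]
  · exact Integrable.of_bound hc1.aestronglyMeasurable C1 (Eventually.of_forall hC1)
  · exact (Integrable.of_bound (hf1.mul he1).continuous.aestronglyMeasurable C2
      (Eventually.of_forall hC2)).const_mul _

/-- The relation holds for smooth periodic functions and says that a continuous linear functional on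
the graph space vanishes. The kernel is closed, so it contains the closure `H1per`. -/
lemma coefL_grad {w : GraphSpace d} (hw : w ∈ H1per d) (α : Fin d → ℤ) (k : Fin 3) (i : Fin d) :
    coefL α k (w.snd i) = 2 * Real.pi * Complex.I * α i * coefL α k w.fst := by
  let L : GraphSpace d →L[ℂ] ℂ :=
    (coefL α k).comp ((PiLp.proj 2 (𝕜 := ℂ) (fun _ : Fin d => L2Y d) i).comp
      (WithLp.sndL 2 ℂ (L2Y d) (PiLp 2 (fun _ : Fin d => L2Y d)))) -
    (2 * Real.pi * Complex.I * α i) • (coefL α k).comp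
      (WithLp.fstL 2 ℂ (L2Y d) (PiLp 2 (fun _ : Fin d => L2Y d)))
  have hker : H1per d ≤ LinearMap.ker L.toLinearMap := by
    refine Submodule.topologicalClosure_minimal _ ?_ L.isClosed_ker
    rw [Submodule.span_le]
    rintro w ⟨f, hf, h1, h2⟩
    have hfk : IsSmoothPeriodic fun y => f y k := by
      refine ⟨?_, fun j y => by simp only [hf.2 j y]⟩
      exact (contDiff_piLp 2).1 hf.1 k
    have e1 : coefL α k w.fst = fourierCoef (fun y => f y k) α := by
      rw [coefL_apply]
      refine fourierCoef_congr ?_ α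
      filter_upwards [h1] with y hy
      rw [hy]
    have e2 : coefL α k (w.snd i) = fourierCoef (fun y => pderivs f y i k) α := by
      rw [coefL_apply]
      refine fourierCoef_congr ?_ α
      filter_upwards [h2 i] with y hy
      rw [hy]
    have e3 : ∀ y, pderivs f y i k = fderiv ℝ (fun y => f y k) y (basisVec d i) := by
      intro y
      have hd : DifferentiableAt ℝ f y := hf.1.differentiable (by simp) y
      have := ((EuclideanSpace.proj (𝕜 := ℂ) k : C3 →L[ℂ] ℂ).restrictScalars ℝ).hasFDerivAt.comp y
        hd.hasFDerivAt
      have h4 : fderiv ℝ (fun y => f y k) y = _ := this.fderiv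
      rw [h4]
      rfl
    have e4 := fourierCoef_pderivs hfk α i
    simp only [e3] at e2
    change coefL α k (w.snd i) - (2 * Real.pi * Complex.I * α i) • coefL α k w.fst = 0
    rw [e1, e2, e4, smul_eq_mul, sub_self]
  have := hker hw
  have h5 : coefL α k (w.snd i) - (2 * Real.pi * Complex.I * α i) • coefL α k w.fst = 0 := this
  rw [sub_eq_zero, smul_eq_mul] at h5
  exact h5

lemma expo_zero (y : E d) : expo (0 : Fin d → ℤ) y = 1 := by simp [expo]

/-- The constant function as an element of `L²(Y)`. -/
def constL2 (d : ℕ) (a : C3) : L2Y d := (memLp_const a).toLp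

lemma inner_const (a : C3) (c v : L2Y d) (hc : c =ᵐ[cellVol d] fun _ => a) :
    inner ℂ c v = ∑ k, (starRingEnd ℂ) (a k) * coefL 0 k v := by
  rw [L2.inner_def]
  have h1 : ∫ y in cell d, inner ℂ (c y) (v y) = ∫ y in cell d, ∑ k, (starRingEnd ℂ) (a k) * v y k := by
    refine integral_congr_ae ?_
    filter_upwards [hc] with y hy
    rw [hy]
    simp [PiLp.inner_apply, mul_comm]
  rw [h1, integral_finsetSum]
  · refine Finset.sum_congr rfl fun k _ => ?_
    rw [integral_const_mul, coefL_apply, fourierCoef_eq_expo]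
    simp [expo_zero]
  · intro k _
    exact (((Lp.memLp v).eval_piLp k).integrable (by norm_num)).const_mul _

/-- Orthogonality to the constants is the vanishing of the coefficient at frequency zero. -/
lemma mem_zeroMean_iff (w : GraphSpace d) : w ∈ zeroMean d ↔ ∀ k, coefL 0 k w.fst = 0 := by
  change w.fst ∈ (Submodule.span ℂ {v : L2Y d | ∃ a : C3, v =ᵐ[cellVol d] fun _ => a})ᗮ ↔ _
  constructor
  · intro h k
    have := h (constL2 d (EuclideanSpace.single k 1))
      (Submodule.subset_span ⟨_, MemLp.coeFn_toLp _⟩)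
    rw [inner_const (EuclideanSpace.single k 1) (constL2 d (EuclideanSpace.single k 1)) _
      (MemLp.coeFn_toLp _)] at this
    simpa [Pi.single_apply, apply_ite] using this
  · intro h
    rw [Submodule.mem_orthogonal]
    intro u hu
    induction hu using Submodule.span_induction with
    | mem v hv =>
      obtain ⟨a, ha⟩ := hv
      rw [inner_const a _ _ ha]
      simp [h]
    | zero => simp
    | add x y _ _ hx hy => rw [inner_add_left, hx, hy, add_zero]
    | smul c x _ hx => rw [inner_smul_left, hx, mul_zero]

lemma L2Y_eq_zero_of_coefL (v : L2Y d) (h : ∀ α k, coefL α k v = 0) : v = 0 := by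
  have hk : ∀ k : Fin 3, (fun y => v y k) =ᵐ[cellVol d] 0 := fun k =>
    ae_eq_zero_of_fourierCoef_eq_zero ((Lp.memLp v).eval_piLp k) fun α => by
      rw [← coefL_apply, h]
  rw [Lp.eq_zero_iff_ae_eq_zero]
  filter_upwards [ae_all_iff.2 hk] with y hy
  ext k
  exact hy k

end FourierSharp

/-! ### Curl, divergence and membership in `H¹_♯(Y)` read off Fourier coefficients. -/

section SharpConstruction

variable {d : ℕ}

/-- From the bilinear identity `(a·a) v = (a·v) a - a × (a × v)`. Over `ℂ` a nonzero vector may have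
`a·a = 0`, whence the last hypothesis; for a multi-index `a·a = |α|²`. -/
lemma eq_zero_of_cross_dot (a v : Fin 3 → ℂ) (h0 : a 1 * v 2 - a 2 * v 1 = 0)
    (h1 : a 2 * v 0 - a 0 * v 2 = 0) (h2 : a 0 * v 1 - a 1 * v 0 = 0)
    (h3 : a 0 * v 0 + a 1 * v 1 + a 2 * v 2 = 0) (ha : a 0 ^ 2 + a 1 ^ 2 + a 2 ^ 2 ≠ 0) :
    v = 0 := by
  funext k
  refine (mul_eq_zero.1 (?_ : (a 0 ^ 2 + a 1 ^ 2 + a 2 ^ 2) * v k = 0)).resolve_left ha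
  fin_cases k <;> simp only [Fin.zero_eta, Fin.mk_one, Fin.reduceFinMk]
  · linear_combination a 0 * h3 - a 1 * h2 + a 2 * h1
  · linear_combination a 1 * h3 + a 0 * h2 - a 2 * h0
  · linear_combination a 2 * h3 - a 0 * h1 + a 1 * h0

/-- A multi-index as a complex triple. -/
def idx3 (α : Fin d → ℤ) : Fin 3 → ℂ := ext3 fun i => (α i : ℂ)

lemma memLp_ext3_grad (w : H1sharp d) (j k : Fin 3) :
    MemLp (fun y => ext3 (fun i => H1sharp.grad w i y) j k) 2 (cellVol d) := by
  unfold ext3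
  split_ifs with h
  · exact (Lp.memLp (H1sharp.grad w ⟨j, h⟩)).eval_piLp k
  · simp

lemma fourierCoef_ext3_grad (w : H1sharp d) (α : Fin d → ℤ) (j k : Fin 3) :
    fourierCoef (fun y => ext3 (fun i => H1sharp.grad w i y) j k) α =
      2 * Real.pi * Complex.I * idx3 α j * coefL α k (H1sharp.val w) := by
  unfold idx3 ext3
  split_ifs with h
  · rw [← coefL_apply]
    exact coefL_grad w.2.1 α k _
  · simp [fourierCoef]

lemma fourierCoef_sub {f g : E d → ℂ} (hf : MemLp f 2 (cellVol d)) (hg : MemLp g 2 (cellVol d))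
    (α : Fin d → ℤ) :
    fourierCoef (fun y => f y - g y) α = fourierCoef f α - fourierCoef g α := by
  have hi : ∀ {h : E d → ℂ}, MemLp h 2 (cellVol d) →
      Integrable (fun y => h y * expo (-α) y) (cellVol d) := fun {h} hh =>
    (hh.integrable (by norm_num)).mul_bdd (c := 1) (continuous_expo _).aestronglyMeasurable
      (Eventually.of_forall fun y => (norm_expo _ y).le)
  simp only [fourierCoef_eq_expo, sub_mul]
  exact integral_sub (hi hf) (hi hg)

lemma fourierCoef_add {f g : E d → ℂ} (hf : MemLp f 2 (cellVol d)) (hg : MemLp g 2 (cellVol d))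
    (α : Fin d → ℤ) :
    fourierCoef (fun y => f y + g y) α = fourierCoef f α + fourierCoef g α := by
  have := fourierCoef_sub (hf.add hg) hg α
  simp only [Pi.add_apply, add_sub_cancel_right] at this
  rw [this]
  change _ = fourierCoef (fun y => f y + g y) α - _ + _
  ring

lemma ae_eq_of_fourierCoef_eq {f g : E d → ℂ} (hf : MemLp f 2 (cellVol d))
    (hg : MemLp g 2 (cellVol d)) (h : ∀ α, fourierCoef f α = fourierCoef g α) :
    f =ᵐ[cellVol d] g := by
  have := ae_eq_zero_of_fourierCoef_eq_zero (hf.sub hg) fun α => by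
    rw [show f - g = fun y => f y - g y from rfl, fourierCoef_sub hf hg, h, sub_self]
  filter_upwards [this] with y hy
  exact sub_eq_zero.1 hy

/-- On coefficients the curl acts as `2πi α ×`, and square integrable functions with equal
coefficients agree. -/
lemma curl_ae_eq (w : H1sharp d) {m : E d → C3} (hm : MemLp m 2 (cellVol d))
    (h : ∀ α, (2 * Real.pi * Complex.I : ℂ) •
      cross (WithLp.toLp 2 (idx3 α)) (vcoef (H1sharp.val w) α) = vcoef m α) :
    ∀ᵐ y ∂(cellVol d), H1sharp.curl w y = m y := by
  have hk : ∀ k : Fin 3, ∀ᵐ y ∂(cellVol d), H1sharp.curl w y k = m y k := by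
    intro k
    have hg := memLp_ext3_grad w
    have hc := fourierCoef_ext3_grad w
    refine ae_eq_of_fourierCoef_eq (f := fun y => H1sharp.curl w y k) ?_ (hm.eval_piLp k) ?_
    · fin_cases k
      exacts [(hg 1 2).sub (hg 2 1), (hg 2 0).sub (hg 0 2), (hg 0 1).sub (hg 1 0)]
    · intro α
      have h1 := congrArg (fun v : C3 => v k) (h α)
      refine Eq.trans ?_ h1
      fin_cases k
      · refine (fourierCoef_sub (hg 1 2) (hg 2 1) α).trans ?_
        simp only [hc, ← vcoef_apply]
        simp [cross]; ring
      · refine (fourierCoef_sub (hg 2 0) (hg 0 2) α).trans ?_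
        simp only [hc, ← vcoef_apply]
        simp [cross]; ring
      · refine (fourierCoef_sub (hg 0 1) (hg 1 0) α).trans ?_
        simp only [hc, ← vcoef_apply]
        simp [cross]; ring
  filter_upwards [ae_all_iff.2 hk] with y hy
  ext k
  exact hy k

lemma fourierCoef_div (w : H1sharp d) (α : Fin d → ℤ) :
    fourierCoef (H1sharp.div w) α = 2 * Real.pi * Complex.I *
      (idx3 α 0 * coefL α 0 (H1sharp.val w) + idx3 α 1 * coefL α 1 (H1sharp.val w) +
        idx3 α 2 * coefL α 2 (H1sharp.val w)) := by
  have hg := memLp_ext3_grad w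
  have hc := fourierCoef_ext3_grad w
  have e : H1sharp.div w = fun y => (ext3 (fun i => H1sharp.grad w i y) 0 0 +
    ext3 (fun i => H1sharp.grad w i y) 1 1) + ext3 (fun i => H1sharp.grad w i y) 2 2 := by
    funext y
    simp [H1sharp.div, divOf, Fin.sum_univ_three]
  rw [e]
  have h1 := fourierCoef_add ((hg 0 0).add (hg 1 1)) (hg 2 2) α
  simp only [Pi.add_apply] at h1
  refine h1.trans ?_
  have h2 := fourierCoef_add (hg 0 0) (hg 1 1) α
  change fourierCoef (fun y => ext3 (fun i => H1sharp.grad w i y) 0 0 +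
    ext3 (fun i => H1sharp.grad w i y) 1 1) α + _ = _
  rw [h2, hc, hc, hc]
  ring

lemma memLp_div (w : H1sharp d) : MemLp (H1sharp.div w) 2 (cellVol d) := by
  have e : H1sharp.div w = fun y => ∑ k, ext3 (fun i => H1sharp.grad w i y) k k := rfl
  rw [e]
  exact memLp_finsetSum _ fun k _ => memLp_ext3_grad w k k

lemma div_ae_eq_zero (w : H1sharp d)
    (h : ∀ α, idx3 α 0 * coefL α 0 (H1sharp.val w) + idx3 α 1 * coefL α 1 (H1sharp.val w) +
        idx3 α 2 * coefL α 2 (H1sharp.val w) = 0) :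
    ∀ᵐ y ∂(cellVol d), H1sharp.div w y = 0 :=
  ae_eq_zero_of_fourierCoef_eq_zero (memLp_div w) fun α => by rw [fourierCoef_div, h, mul_zero]

lemma sum_idx3_sq (hd : d ≤ 3) (α : Fin d → ℤ) :
    idx3 α 0 ^ 2 + idx3 α 1 ^ 2 + idx3 α 2 ^ 2 = ((∑ i, (α i : ℝ) ^ 2 : ℝ) : ℂ) := by
  interval_cases d <;> simp [idx3, ext3, Fin.sum_univ_succ]
  ring

lemma sum_sq_pos {α : Fin d → ℤ} (h : α ≠ 0) : 0 < ∑ i, (α i : ℝ) ^ 2 := by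
  obtain ⟨i, hi⟩ := Function.ne_iff.1 h
  refine Finset.sum_pos' (fun _ _ => sq_nonneg _) ⟨i, Finset.mem_univ i, ?_⟩
  have : (α i : ℝ) ≠ 0 := by exact_mod_cast hi
  positivity

/-- The gradient is stored separately in the graph space, but its coefficients are determined by
those of the function through `coefL_grad`. -/
lemma H1sharp_eq_zero_of_coefL {w : H1sharp d} (h : ∀ α k, coefL α k (H1sharp.val w) = 0) :
    w = 0 := by
  have h1 : w.1.fst = 0 := L2Y_eq_zero_of_coefL _ h
  have h2 : ∀ i, w.1.snd i = 0 := fun i => L2Y_eq_zero_of_coefL _ fun α k => by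
    rw [coefL_grad w.2.1]
    have := h α k
    rw [H1sharp.val] at this
    rw [this, mul_zero]
  apply Subtype.ext
  apply (WithLp.equiv 2 _).injective
  refine Prod.ext h1 ?_
  exact PiLp.ext h2

/-- A periodic field with zero mean, zero curl and zero divergence vanishes. -/
lemma H1sharp_eq_zero (hd : d ≤ 3) {w : H1sharp d}
    (hcurl : ∀ᵐ y ∂(cellVol d), H1sharp.curl w y = 0)
    (hdiv : ∀ᵐ y ∂(cellVol d), H1sharp.div w y = 0) : w = 0 := by
  refine H1sharp_eq_zero_of_coefL fun α k => ?_
  by_cases hα : α = 0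
  · rw [hα]
    exact (mem_zeroMean_iff w.1).1 w.2.2 k
  · have hpi : (2 * Real.pi * Complex.I : ℂ) ≠ 0 := by simp [Real.pi_ne_zero]
    have hg := memLp_ext3_grad w
    have hc := fourierCoef_ext3_grad w
    have hz : fourierCoef (0 : E d → ℂ) α = 0 := by simp [fourierCoef]
    have key : ∀ i j k l : Fin 3, (∀ᵐ y ∂(cellVol d), ext3 (fun i => H1sharp.grad w i y) i j -
        ext3 (fun i => H1sharp.grad w i y) k l = 0) →
        idx3 α i * coefL α j (H1sharp.val w) - idx3 α k * coefL α l (H1sharp.val w) = 0 := by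
      intro i j k l h
      have h1 := fourierCoef_sub (hg i j) (hg k l) α
      rw [fourierCoef_congr (g := 0) h, hz, hc, hc] at h1
      have h2 : (2 * Real.pi * Complex.I : ℂ) * (idx3 α i * coefL α j (H1sharp.val w) -
        idx3 α k * coefL α l (H1sharp.val w)) = 0 := by
        rw [h1]; ring
      exact (mul_eq_zero.1 h2).resolve_left hpi
    have hcomp : ∀ k, ∀ᵐ y ∂(cellVol d), H1sharp.curl w y k = 0 := fun k => by
      filter_upwards [hcurl] with y hy
      rw [hy]; rfl
    have hd1 := fourierCoef_congr (g := 0) hdiv α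
    rw [hz, fourierCoef_div] at hd1
    have := eq_zero_of_cross_dot (idx3 α) (fun k => coefL α k (H1sharp.val w))
      (key 1 2 2 1 (hcomp 0)) (key 2 0 0 2 (hcomp 1)) (key 0 1 1 0 (hcomp 2))
      ((mul_eq_zero.1 hd1).resolve_left hpi)
      (by rw [sum_idx3_sq hd]; exact_mod_cast (sum_sq_pos hα).ne')
    exact congrFun this k

lemma exists_coefL_eq (q : (Fin d → ℤ) → C3) (hq : ∀ k, Summable fun α => ‖q α k‖ ^ 2) :
    ∃ v : L2Y d, ∀ α k, coefL α k v = q α k := by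
  choose f hf hc using fun k => exists_fourierCoef_eq (fun α => q α k) (hq k)
  have hF : MemLp (fun y => (WithLp.toLp 2 fun k => f k y : C3)) 2 (cellVol d) :=
    MemLp.of_eval_piLp fun k => hf k
  refine ⟨hF.toLp, fun α k => ?_⟩
  rw [coefL_apply, ← hc]
  refine fourierCoef_congr ?_ α
  filter_upwards [hF.coeFn_toLp] with y hy
  rw [hy]

lemma IsSmoothPeriodic.memLp {f : E d → C3} (hf : IsSmoothPeriodic f) :
    MemLp f 2 (cellVol d) := by
  obtain ⟨C, hC⟩ := hf.2.exists_norm_le hf.1.continuous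
  exact MemLp.of_bound hf.1.continuous.aestronglyMeasurable C (Eventually.of_forall hC)

/-- Partial sums of Fourier series in `L²(Y)`. -/
def fpartLp (q : (Fin d → ℤ) → C3) (S : Finset (Fin d → ℤ)) : L2Y d :=
  (isSmoothPeriodic_fpart q S).memLp.toLp

lemma tendsto_fpartLp {q : (Fin d → ℤ) → C3} {v : L2Y d} (h : ∀ α k, coefL α k v = q α k) :
    Tendsto (fpartLp q) atTop (𝓝 v) := by
  have hq : q = vcoef v := by
    funext α; ext k; rw [vcoef_apply, h]
  rw [tendsto_iff_edist_tendsto_0]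
  refine (tendsto_fpart (Lp.memLp v)).congr fun S => ?_
  rw [edist_comm, Lp.edist_def, ← hq]
  refine eLpNorm_congr_ae ?_
  filter_upwards [(isSmoothPeriodic_fpart q S).memLp.coeFn_toLp] with y hy
  rw [Pi.sub_apply, fpartLp, hy]

/-- An element of `H¹_♯(Y)` with prescribed Fourier coefficients. -/
lemma exists_H1sharp (q : (Fin d → ℤ) → C3) (h0 : q 0 = 0)
    (hq : ∀ k, Summable fun α => ‖q α k‖ ^ 2)
    (hq1 : ∀ i k, Summable fun α => ‖(2 * Real.pi * Complex.I * α i) * q α k‖ ^ 2) :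
    ∃ w : H1sharp d, ∀ α k, coefL α k (H1sharp.val w) = q α k := by
  obtain ⟨v, hv⟩ := exists_coefL_eq q hq
  choose b hb using fun i => exists_coefL_eq
    (fun α => (2 * Real.pi * Complex.I * α i) • q α) (fun k => by simpa using hq1 i k)
  let w : GraphSpace d := WithLp.toLp 2 (v, WithLp.toLp 2 b)
  have hw1 : w ∈ H1per d := by
    -- The partial sums, paired with their gradients, converge in the graph norm, and each of them
    -- is a smooth periodic function.
    have ht : Tendsto (fun S => (WithLp.toLp 2 (fpartLp q S, WithLp.toLp 2 fun i =>
        fpartLp (fun α => (2 * Real.pi * Complex.I * α i) • q α) S) : GraphSpace d))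
        atTop (𝓝 w) := by
      refine ((WithLp.prod_continuous_toLp 2 _ _).tendsto _).comp ?_
      refine (tendsto_fpartLp hv).prodMk_nhds ?_
      refine ((PiLp.continuous_toLp 2 _).tendsto _).comp ?_
      exact tendsto_pi_nhds.2 fun i => tendsto_fpartLp (hb i)
    refine mem_closure_of_tendsto ht (Eventually.of_forall fun S => ?_)
    refine Submodule.subset_span ⟨fpart q S, isSmoothPeriodic_fpart q S,
      (isSmoothPeriodic_fpart q S).memLp.coeFn_toLp, fun i => ?_⟩
    simp only [pderivs_fpart]
    exact (isSmoothPeriodic_fpart _ S).memLp.coeFn_toLp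
  have hw0 : w ∈ zeroMean d := by
    rw [mem_zeroMean_iff]
    intro k
    refine (hv 0 k).trans ?_
    rw [h0]; rfl
  exact ⟨⟨w, hw1, hw0⟩, hv⟩

end SharpConstruction

/-! ### Norm bounds for the vector algebra -/

section VectorBounds

variable {d : ℕ}

lemma norm_le_sum_apply (v : C3) : ‖v‖ ≤ ∑ k, ‖v k‖ := by
  rw [EuclideanSpace.norm_eq v]
  exact Real.sqrt_le_iff.2 ⟨Finset.sum_nonneg fun _ _ => norm_nonneg _,
    Finset.sum_sq_le_sq_sum_of_nonneg fun _ _ => norm_nonneg _⟩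

/-- A crude constant: three components, two products in each. All later factors 6 come from here or
from `norm_curlOf_ext3_le`. -/
lemma norm_cross_le (a b : C3) : ‖cross a b‖ ≤ 6 * ‖a‖ * ‖b‖ := by
  refine (norm_le_sum_apply _).trans ?_
  have ha := PiLp.norm_apply_le a
  have hb := PiLp.norm_apply_le b
  have h : ∀ i j k l, ‖a i * b j - a k * b l‖ ≤ 2 * ‖a‖ * ‖b‖ := by
    intro i j k l
    refine (norm_sub_le _ _).trans ?_
    rw [norm_mul, norm_mul]
    have h1 := mul_le_mul (ha i) (hb j) (norm_nonneg _) (norm_nonneg _)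
    have h2 := mul_le_mul (ha k) (hb l) (norm_nonneg _) (norm_nonneg _)
    linarith
  have h0 := h 1 2 2 1
  have h1 := h 2 0 0 2
  have h2 := h 0 1 1 0
  rw [Fin.sum_univ_three]
  simp only [cross] at *
  simp only [Matrix.cons_val] at *
  linarith

lemma norm_curlOf_ext3_le (a : Fin d → C3) : ‖curlOf (ext3 a)‖ ≤ 6 * ∑ i, ‖a i‖ := by
  have h : ∀ j k, ‖ext3 a j k‖ ≤ ∑ i, ‖a i‖ := by
    intro j k
    unfold ext3
    split_ifs with hj
    · exact (PiLp.norm_apply_le _ k).trans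
        (Finset.single_le_sum (f := fun i => ‖a i‖) (fun _ _ => norm_nonneg _)
          (Finset.mem_univ (⟨j, hj⟩ : Fin d)))
    · simpa using Finset.sum_nonneg fun _ _ => norm_nonneg _
  refine (norm_le_sum_apply _).trans ?_
  rw [Fin.sum_univ_three]
  simp only [curlOf, Matrix.cons_val]
  have h' : ∀ i j k l, ‖ext3 a i j - ext3 a k l‖ ≤ 2 * ∑ i, ‖a i‖ := fun i j k l =>
    (norm_sub_le _ _).trans (by linarith [h i j, h k l])
  linarith [h' 1 2 2 1, h' 2 0 0 2, h' 0 1 1 0]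

lemma ext3_sub (a b : Fin d → C3) : ext3 (fun i => a i - b i) = fun j => ext3 a j - ext3 b j := by
  funext j
  unfold ext3
  split_ifs <;> simp

lemma curlOf_ext3_sub (a b : Fin d → C3) :
    curlOf (ext3 a) - curlOf (ext3 b) = curlOf (ext3 fun i => a i - b i) := by
  rw [ext3_sub]
  ext k
  fin_cases k <;> simp [curlOf] <;> ring

/-- Padding with zeros is isometric; `d ≤ 3` ensures that no component is truncated. -/
lemma norm_toC3 (hd : d ≤ 3) (a : Fin d → ℂ) :
    ‖toC3 a‖ = ‖(WithLp.toLp 2 a : EuclideanSpace ℂ (Fin d))‖ := by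
  rw [EuclideanSpace.norm_eq, EuclideanSpace.norm_eq]
  congr 1
  interval_cases d <;> simp [toC3, ext3, Fin.sum_univ_succ]

end VectorBounds

/-! ### Columns of an admissible matrix field -/

section Columns

variable {d : ℕ}

/-- The `j`-th column of a matrix field, as a field with values in `ℂ³`. -/
def column (M : E d → Matrix (Fin d) (Fin d) ℂ) (j : Fin d) (y : E d) : C3 :=
  toC3 fun i => M y i j

lemma norm_entry_le (A : Matrix (Fin d) (Fin d) ℂ) (i j : Fin d) :
    ‖A i j‖ ≤ ‖Matrix.toEuclideanCLM (n := Fin d) (𝕜 := ℂ) A‖ := by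
  have h : A i j = (Matrix.toEuclideanCLM (n := Fin d) (𝕜 := ℂ) A (EuclideanSpace.single j 1)) i := by
    simp [Matrix.ofLp_toEuclideanCLM]
  rw [h]
  refine (PiLp.norm_apply_le _ i).trans ((ContinuousLinearMap.le_opNorm _ _).trans ?_)
  simp

lemma IsAdmissible.ae_norm_le {M : E d → Matrix (Fin d) (Fin d) ℂ} (hM : IsAdmissible M) {K : ℝ≥0}
    (hK : matLinfNorm M ≤ K) : ∀ᵐ y : E d, ∀ i j, ‖M y i j‖ ≤ K := by
  refine IsPeriodic.ae_of_ae_cell (p := fun y => ∀ i j, ‖M y i j‖ ≤ K)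
    (fun i y => by simp only [hM.periodic i y]) ?_
  filter_upwards [ENNReal.ae_le_essSup
    (fun y => ‖Matrix.toEuclideanCLM (n := Fin d) (𝕜 := ℂ) (M y)‖ₑ) (μ := cellVol d)] with y hy i j
  have h1 : ‖Matrix.toEuclideanCLM (n := Fin d) (𝕜 := ℂ) (M y)‖ₑ ≤ K := hy.trans hK
  have h2 : ‖Matrix.toEuclideanCLM (n := Fin d) (𝕜 := ℂ) (M y)‖ ≤ K := by
    have := ENNReal.toReal_mono (by simp) h1
    simpa using this
  exact (norm_entry_le _ i j).trans h2

lemma IsAdmissible.memLp_entry {M : E d → Matrix (Fin d) (Fin d) ℂ} (hM : IsAdmissible M)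
    {K : ℝ≥0} (hK : matLinfNorm M ≤ K) (i j : Fin d) :
    MemLp (fun y => M y i j) 2 (cellVol d) := by
  refine MemLp.of_bound (hM.measurable i j).restrict K ?_
  filter_upwards [ae_restrict_of_ae (hM.ae_norm_le hK)] with y hy
  exact hy i j

lemma integrable_mul_expo {f : E d → ℂ} (hf : MemLp f 2 (cellVol d)) (α : Fin d → ℤ) :
    Integrable (fun y => f y * expo α y) (cellVol d) :=
  (hf.integrable (by norm_num)).mul_bdd (c := 1) (continuous_expo _).aestronglyMeasurable
    (Eventually.of_forall fun y => (norm_expo _ y).le)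

/-- Translating by `1/(2α_l)` in the last direction leaves `M` unchanged and turns the character
into its opposite, so the coefficient equals its own negative. -/
lemma IsAdmissible.fourierCoef_eq_zero (hd : 0 < d) {M : E d → Matrix (Fin d) (Fin d) ℂ}
    (hM : IsAdmissible M) (i j : Fin d) {α : Fin d → ℤ}
    (hα : α ⟨d - 1, by omega⟩ ≠ 0) : fourierCoef (fun y => M y i j) α = 0 := by
  set l : Fin d := ⟨d - 1, by omega⟩ with hl
  set t : ℝ := 1 / (2 * α l) with ht
  have hper : IsPeriodic fun y => M y i j * expo (-α) y := fun k y => by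
    simp only [hM.periodic k y, isPeriodic_expo (-α) k y]
  have h1 := hper.setIntegral_cell_add (t • basisVec d l)
  have h2 : expo (-α) (t • basisVec d l) = -1 := by
    rw [expo_smul_basisVec]
    have : (2 * Real.pi * Complex.I * (((-α) l : ℤ) * (t : ℝ)) : ℂ) = -(Real.pi * Complex.I) := by
      have h3 : (α l : ℂ) ≠ 0 := by exact_mod_cast hα
      rw [ht]; push_cast [Pi.neg_apply]
      field_simp
    rw [this, Complex.exp_neg, Complex.exp_pi_mul_I]; norm_num
  have h3 : ∫ y in cell d, M (y + t • basisVec d l) i j * expo (-α) (y + t • basisVec d l) =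
      -∫ y in cell d, M y i j * expo (-α) y := by
    rw [← integral_neg]
    refine integral_congr_ae ?_
    filter_upwards [ae_restrict_of_ae (hM.indep t)] with y hy
    have hy' : M (y + t • basisVec d l) = M y := hy
    rw [hy', expo_add, h2]; ring
  rw [fourierCoef_eq_expo]
  rw [h3] at h1
  exact self_eq_neg.1 h1.symm

/-- The divergence condition tested with a character: `α` is orthogonal to the coefficient of each
column. -/
lemma IsAdmissible.sum_mul_fourierCoef {M : E d → Matrix (Fin d) (Fin d) ℂ}
    (hM : IsAdmissible M) {K : ℝ≥0} (hK : matLinfNorm M ≤ K) (j : Fin d) (α : Fin d → ℤ) :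
    ∑ i, (α i : ℂ) * fourierCoef (fun y => M y i j) α = 0 := by
  have h := hM.div_free (Pi.single j 1) (expo (-α)) (isSmoothPeriodic_expo _)
  simp only [Matrix.mulVec_single_one, pderivs, fderiv_expo] at h
  rw [integral_finsetSum] at h
  · have h2 : ∀ i, ∫ y in cell d, M y i j * (2 * Real.pi * Complex.I * ((-α) i : ℤ) * expo (-α) y) =
        -(2 * Real.pi * Complex.I) * ((α i : ℂ) * fourierCoef (fun y => M y i j) α) := by
      intro i
      rw [fourierCoef_eq_expo, ← integral_const_mul, ← integral_const_mul]
      refine integral_congr_ae (Eventually.of_forall fun y => ?_)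
      push_cast [Pi.neg_apply]; ring
    simp only [Matrix.col_apply, h2, ← Finset.mul_sum] at h
    exact (mul_eq_zero.1 h).resolve_left (by simp [Real.pi_ne_zero])
  · intro i _
    have := (integrable_mul_expo (hM.memLp_entry hK i j) (-α)).const_mul
      (2 * Real.pi * Complex.I * ((-α) i : ℤ))
    refine this.congr (Eventually.of_forall fun y => ?_)
    simp only [Matrix.col_apply]; ring

lemma IsAdmissible.fourierCoef_zero {M : E d → Matrix (Fin d) (Fin d) ℂ}
    (hM : IsAdmissible M) (i j : Fin d) : fourierCoef (fun y => M y i j) 0 = 0 := by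
  rw [fourierCoef_eq_expo]
  simpa [expo_zero] using hM.zero_mean i j

/-- The Euclidean length of a multi-index. -/
def idxNorm (α : Fin d → ℤ) : ℝ := Real.sqrt (∑ j, (α j : ℝ) ^ 2)

/-- The semi-norm of top order always occurs in the norm: as the last term of the sum if `s` is an
integer, as the extra term otherwise. -/
lemma hsSemiSq_le {s : ℝ} {M : E d → Matrix (Fin d) (Fin d) ℂ} {K : ℝ≥0}
    (hK : matHsNorm s M ≤ K) (i j : Fin d) : hsSemiSq s (fun y => M y i j) ≤ K ^ 2 := by
  have h1 : ∑ i, ∑ j, hsNormSq s (fun y => M y i j) ≤ (K : ℝ≥0∞) ^ 2 := by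
    rw [matHsNorm, one_div] at hK
    have := ENNReal.rpow_le_rpow hK (zero_le_two (α := ℝ))
    rwa [← ENNReal.rpow_mul, inv_mul_cancel₀ two_ne_zero, ENNReal.rpow_one, ENNReal.rpow_two] at this
  have h2 : hsNormSq s (fun y => M y i j) ≤ ∑ i, ∑ j, hsNormSq s (fun y => M y i j) :=
    (Finset.single_le_sum (f := fun j => hsNormSq s (fun y => M y i j)) (fun _ _ => zero_le)
      (Finset.mem_univ j)).trans (Finset.single_le_sum
        (f := fun i => ∑ j, hsNormSq s (fun y => M y i j)) (fun _ _ => zero_le)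
        (Finset.mem_univ i))
  refine le_trans ?_ (h2.trans h1)
  rw [hsNormSq]
  split_ifs with h
  · rw [add_zero]
    refine le_trans (le_of_eq ?_) (Finset.single_le_sum
      (f := fun m : ℕ => hsSemiSq (m : ℝ) (fun y => M y i j)) (fun _ _ => zero_le)
      (Finset.self_mem_range_succ ⌊s⌋₊))
    simp only [h]
  · exact le_add_self

lemma summable_of_hsSemiSq_le {s : ℝ} {f : E d → ℂ} {K : ℝ≥0} (h : hsSemiSq s f ≤ K ^ 2) :
    Summable (fun α : Fin d → ℤ => (2 * Real.pi * idxNorm α) ^ (2 * s) * ‖fourierCoef f α‖ ^ 2) ∧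
    ∑' α : Fin d → ℤ, (2 * Real.pi * idxNorm α) ^ (2 * s) * ‖fourierCoef f α‖ ^ 2 ≤ (K : ℝ) ^ 2 := by
  have hnn : ∀ α : Fin d → ℤ, 0 ≤ (2 * Real.pi * idxNorm α) ^ (2 * s) * ‖fourierCoef f α‖ ^ 2 :=
    fun α => mul_nonneg (Real.rpow_nonneg (by unfold idxNorm; positivity) _) (sq_nonneg _)
  have h1 : ∑' α : Fin d → ℤ, ENNReal.ofReal
      ((2 * Real.pi * idxNorm α) ^ (2 * s) * ‖fourierCoef f α‖ ^ 2) ≤ ENNReal.ofReal (K ^ 2) := by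
    refine h.trans (le_of_eq ?_)
    rw [ENNReal.ofReal_pow (by simp)]; simp
  have hsum : Summable (fun α : Fin d → ℤ =>
      (2 * Real.pi * idxNorm α) ^ (2 * s) * ‖fourierCoef f α‖ ^ 2) := by
    have := ENNReal.summable_toReal (ne_top_of_le_ne_top ENNReal.ofReal_ne_top h1)
    refine this.congr fun α => ?_
    rw [ENNReal.toReal_ofReal (hnn α)]
  refine ⟨hsum, ?_⟩
  rw [← ENNReal.ofReal_tsum_of_nonneg hnn hsum] at h1
  exact (ENNReal.ofReal_le_ofReal_iff (by positivity)).1 h1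

end Columns

/-! ### Fourier coefficients of the column potentials and lattice sums. -/

section ColumnPotential

variable {d : ℕ}

/-- A vector potential `W` of a periodic field `m`, with its continuous representative `Q`, bounded
by `C` and independent of the last variable, and smooth periodic approximations `P n`. -/
structure IsColumnPotential (C : ℝ) (m : E d → C3) (W : H1sharp d) (Q : E d → C3)
    (P : ℕ → E d → C3) : Prop where
  contRep : IsContRep W Q
  indep : ∀ (y : E d) (t : ℝ), Q (y + t • basisVec d (d - 1)) = Q y
  bound : ∀ y, ‖Q y‖ ≤ C
  smooth : ∀ n, IsSmoothPeriodic (P n)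
  unif : TendstoUniformly P Q atTop
  curl_tendsto : Tendsto (fun n => eLpNorm (fun y => curl (P n) y - m y) 2 (cellVol d)) atTop (𝓝 0)
  curl_eq : ∀ᵐ y ∂(cellVol d), H1sharp.curl W y = m y
  div_eq : ∀ᵐ y ∂(cellVol d), H1sharp.div W y = 0

lemma idxNorm_nonneg (α : Fin d → ℤ) : 0 ≤ idxNorm α := Real.sqrt_nonneg _

lemma idxNorm_sq (α : Fin d → ℤ) : idxNorm α ^ 2 = ∑ j, (α j : ℝ) ^ 2 :=
  Real.sq_sqrt (Finset.sum_nonneg fun _ _ => sq_nonneg _)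

lemma abs_le_idxNorm (α : Fin d → ℤ) (i : Fin d) : |(α i : ℝ)| ≤ idxNorm α := by
  refine abs_le_of_sq_le_sq ?_ (idxNorm_nonneg α)
  rw [idxNorm_sq]
  exact Finset.single_le_sum (f := fun i => (α i : ℝ) ^ 2) (fun _ _ => sq_nonneg _)
    (Finset.mem_univ i)

lemma one_le_idxNorm {α : Fin d → ℤ} (h : α ≠ 0) : 1 ≤ idxNorm α := by
  obtain ⟨i, hi⟩ := Function.ne_iff.1 h
  refine le_trans ?_ (abs_le_idxNorm α i)
  exact_mod_cast Int.one_le_abs hi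

/-- If two coordinates determine the indices in `A`, the sum is dominated by the two-dimensional sum
of `‖(m, n)‖^{-k}` known from Eisenstein series. The sup norm of the pair is at most the Euclidean
length of the index. -/
lemma summable_idxNorm_of_injOn (i₀ i₁ : Fin d) (A : Set (Fin d → ℤ)) (h0 : 0 ∈ A)
    (hA : A.InjOn fun α => ![α i₀, α i₁]) {k : ℝ} (hk : 2 < k) :
    Summable (A.indicator fun α => idxNorm α ^ (-k)) := by
  rw [← summable_subtype_iff_indicator]
  have hs := (EisensteinSeries.summable_one_div_norm_rpow hk).comp_injective hA.injective
  refine Summable.of_nonneg_of_le (fun α => Real.rpow_nonneg (idxNorm_nonneg _) _) (fun α => ?_) hs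
  simp only [Function.comp, Set.domRestrict_apply]
  -- The term at zero is `0 ^ (-k)`, which is `0` by convention.
  by_cases hα : α.1 = 0
  · have h1 : idxNorm α.1 = 0 := by rw [hα]; simp [idxNorm]
    rw [h1, Real.zero_rpow (by linarith)]
    exact Real.rpow_nonneg (norm_nonneg _) _
  · have hne : ![α.1 i₀, α.1 i₁] ≠ 0 := by
      intro h
      refine hα (hA α.2 h0 ?_)
      simp only [h]
      ext i; fin_cases i <;> rfl
    refine Real.rpow_le_rpow_of_nonpos (norm_pos_iff.2 hne) ?_ (by linarith)
    refine (pi_norm_le_iff_of_nonneg (idxNorm_nonneg _)).2 fun i => ?_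
    rw [Int.norm_eq_abs]
    fin_cases i
    · exact abs_le_idxNorm α.1 i₀
    · exact abs_le_idxNorm α.1 i₁

/-- Once the last coordinate is fixed to zero, the first two coordinates determine the index: a
plane for `d = 3`, a line for `d = 2`. This is why the threshold is `2` in both dimensions. -/
lemma summable_idxNorm (hd : d = 2 ∨ d = 3) {k : ℝ} (hk : 2 < k) :
    Summable (Set.indicator {α : Fin d → ℤ | α ⟨d - 1, by omega⟩ = 0}
      fun α => idxNorm α ^ (-k)) := by
  have hd0 : 0 < d := by omega
  have hd1 : 1 < d := by omega
  refine summable_idxNorm_of_injOn (d := d) ⟨0, hd0⟩ ⟨1, hd1⟩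
    {α : Fin d → ℤ | α ⟨d - 1, by omega⟩ = 0} (by simp) ?_ hk
  intro α hα β hβ h
  have h0 : α ⟨0, _⟩ = β ⟨0, _⟩ := congrFun h 0
  have h1 : α ⟨1, _⟩ = β ⟨1, _⟩ := congrFun h 1
  have h2 : α ⟨d - 1, _⟩ = β ⟨d - 1, _⟩ := Eq.trans hα (Eq.symm hβ)
  funext i
  have hi : i = ⟨0, hd0⟩ ∨ i = ⟨1, hd1⟩ ∨ i = ⟨d - 1, by omega⟩ := by
    simp only [Fin.ext_iff]; omega
  rcases hi with rfl | rfl | rfl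
  exacts [h0, h1, h2]

/-- The Fourier coefficients of the vector potential of the `j`-th column. -/
def colCoef (M : E d → Matrix (Fin d) (Fin d) ℂ) (j : Fin d) (α : Fin d → ℤ) : C3 :=
  -- Solves `2πi α × q = m` and `α · q = 0` when `α · m = 0`, since then `α × (α × m) = -|α|² m`.
  -- The value at `α = 0` is zero, as the mean requires.
  (Complex.I / (2 * Real.pi * (idxNorm α : ℂ) ^ 2)) •
    cross (WithLp.toLp 2 (idx3 α)) (vcoef (column M j) α)

lemma vcoef_column (M : E d → Matrix (Fin d) (Fin d) ℂ) (j : Fin d) (α : Fin d → ℤ) :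
    vcoef (column M j) α = toC3 fun i => fourierCoef (fun y => M y i j) α := by
  ext k
  simp only [vcoef, column, toC3]
  unfold ext3
  split_ifs with h
  · rfl
  · simp [fourierCoef]

lemma norm_toC3_le (hd : d ≤ 3) (a : Fin d → ℂ) : ‖toC3 a‖ ≤ ∑ i, ‖a i‖ := by
  rw [norm_toC3 hd, EuclideanSpace.norm_eq]
  exact Real.sqrt_le_iff.2 ⟨Finset.sum_nonneg fun _ _ => norm_nonneg _,
    Finset.sum_sq_le_sq_sum_of_nonneg fun _ _ => norm_nonneg _⟩

lemma norm_idx3 (hd : d ≤ 3) (α : Fin d → ℤ) : ‖(WithLp.toLp 2 (idx3 α) : C3)‖ = idxNorm α := by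
  have : (WithLp.toLp 2 (idx3 α) : C3) = toC3 fun i => (α i : ℂ) := rfl
  rw [this, norm_toC3 hd, EuclideanSpace.norm_eq, idxNorm]
  simp

lemma dot_idx3_column (hd : d ≤ 3) {M : E d → Matrix (Fin d) (Fin d) ℂ}
    (hM : IsAdmissible M) {K : ℝ≥0} (hK : matLinfNorm M ≤ K) (j : Fin d) (α : Fin d → ℤ) :
    idx3 α 0 * vcoef (column M j) α 0 + idx3 α 1 * vcoef (column M j) α 1 +
      idx3 α 2 * vcoef (column M j) α 2 = 0 := by
  have h := hM.sum_mul_fourierCoef hK j α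
  rw [vcoef_column]
  interval_cases d <;> simp [idx3, toC3, ext3, Fin.sum_univ_succ] at h ⊢
  · exact h
  · exact h
  · linear_combination h

/-- Expands `α × (α × m) = (α·m) α - |α|² m`, whose first term vanishes by the divergence condition.
At `α = 0` the zero mean of `M` is used. -/
lemma curl_colCoef (hd : d ≤ 3) {M : E d → Matrix (Fin d) (Fin d) ℂ}
    (hM : IsAdmissible M) {K : ℝ≥0} (hK : matLinfNorm M ≤ K) (j : Fin d) (α : Fin d → ℤ) :
    (2 * Real.pi * Complex.I : ℂ) • cross (WithLp.toLp 2 (idx3 α)) (colCoef M j α) =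
      vcoef (column M j) α := by
  by_cases hα : α = 0
  · have h1 : vcoef (column M j) α = 0 := by
      rw [vcoef_column, hα]
      simp only [hM.fourierCoef_zero]
      ext k; simp [toC3, ext3]
    have h2 : (WithLp.toLp 2 (idx3 α) : C3) = 0 := by
      rw [hα]; ext k; simp [idx3, ext3]
    rw [h1, h2]
    ext k; fin_cases k <;> simp [cross]
  · have hdot := dot_idx3_column hd hM hK j α
    have hsq := sum_idx3_sq hd α
    rw [← idxNorm_sq] at hsq
    have hN : (idxNorm α : ℂ) ≠ 0 := by
      have := one_le_idxNorm hα
      exact_mod_cast (by linarith : idxNorm α ≠ 0)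
    have hpi : (Real.pi : ℂ) ≠ 0 := by exact_mod_cast Real.pi_ne_zero
    push_cast at hsq
    set m := vcoef (column M j) α with hm
    set a := idx3 α with ha
    have hI : Complex.I * Complex.I = -1 := Complex.I_mul_I
    have key : ∀ z w : ℂ, z = -(idxNorm α : ℂ) ^ 2 * w →
        2 * Real.pi * Complex.I * (Complex.I / (2 * Real.pi * (idxNorm α : ℂ) ^ 2) * z) = w := by
      intro z w h
      rw [h]
      field_simp
      linear_combination (-w) * hI
    ext k
    fin_cases k
    · refine Eq.trans ?_ (key (a 1 * (a 0 * m 1 - a 1 * m 0) - a 2 * (a 2 * m 0 - a 0 * m 2)) (m 0) ?_)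
      · simp [cross, colCoef]; ring
      · rw [← hsq]; linear_combination a 0 * hdot
    · refine Eq.trans ?_ (key (a 2 * (a 1 * m 2 - a 2 * m 1) - a 0 * (a 0 * m 1 - a 1 * m 0)) (m 1) ?_)
      · simp [cross, colCoef]; ring
      · rw [← hsq]; linear_combination a 1 * hdot
    · refine Eq.trans ?_ (key (a 0 * (a 2 * m 0 - a 0 * m 2) - a 1 * (a 1 * m 2 - a 2 * m 1)) (m 2) ?_)
      · simp [cross, colCoef]; ring
      · rw [← hsq]; linear_combination a 2 * hdot

lemma div_colCoef (M : E d → Matrix (Fin d) (Fin d) ℂ) (j : Fin d) (α : Fin d → ℤ) :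
    idx3 α 0 * colCoef M j α 0 + idx3 α 1 * colCoef M j α 1 + idx3 α 2 * colCoef M j α 2 = 0 := by
  simp [colCoef, cross]; ring

/-- Inverting the curl gains one power of the frequency. At `α = 0` both sides vanish, with `0⁻¹ =
0`. -/
lemma norm_colCoef_le (hd : d ≤ 3) (M : E d → Matrix (Fin d) (Fin d) ℂ) (j : Fin d)
    (α : Fin d → ℤ) :
    ‖colCoef M j α‖ ≤ (idxNorm α)⁻¹ * ∑ i, ‖fourierCoef (fun y => M y i j) α‖ := by
  by_cases hα : α = 0
  · have h2 : (WithLp.toLp 2 (idx3 α) : C3) = 0 := by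
      rw [hα]; ext k; simp [idx3, ext3]
    have : colCoef M j α = 0 := by
      rw [colCoef, h2]
      ext k; fin_cases k <;> simp [cross]
    rw [this, norm_zero]
    exact mul_nonneg (inv_nonneg.2 (idxNorm_nonneg _)) (Finset.sum_nonneg fun _ _ => norm_nonneg _)
  · have hN : 0 < idxNorm α := lt_of_lt_of_le one_pos (one_le_idxNorm hα)
    have h1 := norm_cross_le (WithLp.toLp 2 (idx3 α)) (vcoef (column M j) α)
    rw [norm_idx3 hd] at h1
    have h2 : ‖vcoef (column M j) α‖ ≤ ∑ i, ‖fourierCoef (fun y => M y i j) α‖ := by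
      rw [vcoef_column]; exact norm_toC3_le hd _
    rw [colCoef, norm_smul]
    have h3 : ‖Complex.I / (2 * Real.pi * (idxNorm α : ℂ) ^ 2)‖ = 1 / (2 * Real.pi * idxNorm α ^ 2) := by
      rw [norm_div, Complex.norm_I, norm_mul, norm_mul, norm_pow, Complex.norm_real,
        Complex.norm_real, Real.norm_of_nonneg Real.pi_pos.le, Real.norm_of_nonneg hN.le]
      simp
    rw [h3]
    set T := ∑ i, ‖fourierCoef (fun y => M y i j) α‖
    have hT : 0 ≤ T := (norm_nonneg _).trans h2
    calc 1 / (2 * Real.pi * idxNorm α ^ 2) * ‖cross (WithLp.toLp 2 (idx3 α)) (vcoef (column M j) α)‖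
        ≤ 1 / (2 * Real.pi * idxNorm α ^ 2) * (6 * idxNorm α * T) := by
          refine mul_le_mul_of_nonneg_left (h1.trans ?_) (by positivity)
          exact mul_le_mul_of_nonneg_left h2 (by positivity)
      -- The factor 6 of `norm_cross_le` is absorbed by `2π`.
      _ = (3 / Real.pi) * ((idxNorm α)⁻¹ * T) := by field_simp; ring
      _ ≤ 1 * ((idxNorm α)⁻¹ * T) := by
          refine mul_le_mul_of_nonneg_right ?_ (by positivity)
          rw [div_le_one Real.pi_pos]; exact Real.pi_gt_three.le
      _ = _ := one_mul _

end ColumnPotential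

/-! ### Absolute convergence of the Fourier series and existence of the column potentials. -/

section ColumnPotentialExistence

variable {d : ℕ}

lemma eLpNorm_curlOf_le {X : Type*} [MeasurableSpace X] {μ : Measure X} {a : Fin d → X → C3}
    (ha : ∀ i, AEStronglyMeasurable (a i) μ) :
    eLpNorm (fun x => curlOf (ext3 fun i => a i x)) 2 μ ≤ 6 * ∑ i, eLpNorm (a i) 2 μ := by
  calc eLpNorm (fun x => curlOf (ext3 fun i => a i x)) 2 μ
      ≤ eLpNorm ((6 : ℝ) • ∑ i, fun x => ‖a i x‖) 2 μ := by
        refine eLpNorm_mono_real fun x => ?_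
        simpa using norm_curlOf_ext3_le fun i => a i x
    _ ≤ 6 * ∑ i, eLpNorm (fun x => ‖a i x‖) 2 μ := by
        rw [eLpNorm_const_smul]
        refine mul_le_mul' (by simp [Real.enorm_eq_ofReal]) ?_
        exact eLpNorm_sum_le (fun i _ => (ha i).norm) (by norm_num)
    _ = _ := by simp only [eLpNorm_norm]

/-- The arithmetic-geometric inequality for `n⁻¹x = (n^s x) · n^{-(1+s)}`. The first square is
bounded by a term of the `H^s` semi-norm. The second is summable on a two-dimensional lattice
because `2 + 2s > 2`; this is where `s > 0` enters. -/
lemma inv_mul_le_weight {n x s : ℝ} (hn : 0 < n) (hs : 0 < s) :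
    n⁻¹ * x ≤ 1 / 2 * ((2 * Real.pi * n) ^ (2 * s) * x ^ 2 + n ^ (-(2 + 2 * s))) := by
  have h1 : n⁻¹ = n ^ s * n ^ (-(1 + s)) := by
    rw [← Real.rpow_add hn]
    rw [show s + -(1 + s) = -1 by ring, Real.rpow_neg_one]
  have h2 : n ^ (2 * s) = (n ^ s) ^ 2 := by
    rw [← Real.rpow_natCast, ← Real.rpow_mul hn.le]; congr 1; push_cast; ring
  have h3 : n ^ (-(2 + 2 * s)) = (n ^ (-(1 + s))) ^ 2 := by
    rw [← Real.rpow_natCast, ← Real.rpow_mul hn.le]; congr 1; push_cast; ring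
  have h4 : n ^ (2 * s) ≤ (2 * Real.pi * n) ^ (2 * s) := by
    refine Real.rpow_le_rpow hn.le ?_ (by linarith)
    nlinarith [Real.pi_gt_three]
  have h5 := mul_le_mul_of_nonneg_right h4 (sq_nonneg x)
  rw [h2] at h5
  rw [h1, h3]
  nlinarith [sq_nonneg (n ^ s * x - n ^ (-(1 + s)))]

/-- The lattice sum that controls the potentials. -/
def latticeSum (d : ℕ) (s : ℝ) : ℝ :=
  if h : 0 < d then ∑' α : Fin d → ℤ, Set.indicator {α : Fin d → ℤ | α ⟨d - 1, by omega⟩ = 0}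
    (fun α => idxNorm α ^ (-(2 + 2 * s))) α else 0

/-- Absolute summability gives at once the continuous representative and a sup bound in terms of
`d`, `s` and `K₁` only. -/
lemma summable_colCoef (hd : d = 2 ∨ d = 3) {s : ℝ} (hs : 0 < s)
    {M : E d → Matrix (Fin d) (Fin d) ℂ} (hM : IsAdmissible M) {K₁ : ℝ≥0}
    (hK₁ : matHsNorm s M ≤ K₁) (j : Fin d) :
    Summable (fun α => ‖colCoef M j α‖) ∧
      ∑' α, ‖colCoef M j α‖ ≤ d * (1 / 2 * ((K₁ : ℝ) ^ 2 + latticeSum d s)) := by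
  have hd0 : 0 < d := by omega
  have hd3 : d ≤ 3 := by omega
  set ind : (Fin d → ℤ) → ℝ := Set.indicator {α : Fin d → ℤ | α ⟨d - 1, by omega⟩ = 0}
    (fun α => idxNorm α ^ (-(2 + 2 * s))) with hind
  have hindnn : ∀ α, 0 ≤ ind α := fun α =>
    Set.indicator_nonneg (fun α _ => Real.rpow_nonneg (idxNorm_nonneg _) _) α
  have hsi : Summable ind := summable_idxNorm hd (by linarith)
  have hsM := fun i => summable_of_hsSemiSq_le (hsSemiSq_le hK₁ i j)
  have hB : ∀ i, HasSum (fun α : Fin d → ℤ => 1 / 2 * ((2 * Real.pi * idxNorm α) ^ (2 * s) *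
      ‖fourierCoef (fun y => M y i j) α‖ ^ 2 + ind α)) _ := fun i =>
    (((hsM i).1.hasSum.add hsi.hasSum).mul_left (1 / 2))
  have hBs := hasSum_sum (s := Finset.univ) fun i (_ : i ∈ Finset.univ) => hB i
  have hle : ∀ α, ‖colCoef M j α‖ ≤ ∑ i, 1 / 2 * ((2 * Real.pi * idxNorm α) ^ (2 * s) *
      ‖fourierCoef (fun y => M y i j) α‖ ^ 2 + ind α) := by
    intro α
    refine (norm_colCoef_le hd3 M j α).trans ?_
    rw [Finset.mul_sum]
    refine Finset.sum_le_sum fun i _ => ?_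
    have hnn : 0 ≤ 1 / 2 * ((2 * Real.pi * idxNorm α) ^ (2 * s) *
      ‖fourierCoef (fun y => M y i j) α‖ ^ 2 + ind α) := by
      have := hindnn α
      have := idxNorm_nonneg α
      positivity
    -- Off the hyperplane `α_{d-1} = 0` the coefficients of `M` vanish, so the weight is needed only
    -- on the hyperplane. At the origin `(idxNorm 0)⁻¹ = 0`.
    by_cases hα : α ⟨d - 1, by omega⟩ = 0
    · by_cases h0 : α = 0
      · have : (idxNorm α)⁻¹ = 0 := by rw [h0]; simp [idxNorm]
        rw [this, zero_mul]; exact hnn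
      · have h1 := inv_mul_le_weight (x := ‖fourierCoef (fun y => M y i j) α‖)
          (lt_of_lt_of_le one_pos (one_le_idxNorm h0)) hs
        have h2 : ind α = idxNorm α ^ (-(2 + 2 * s)) := by
          rw [hind, Set.indicator_of_mem (by exact hα)]
        rw [h2]; exact h1
    · rw [hM.fourierCoef_eq_zero hd0 i j hα, norm_zero, mul_zero]
      simpa using hindnn α
  have hsum := Summable.of_nonneg_of_le (fun α => norm_nonneg _) hle hBs.summable
  refine ⟨hsum, (hsum.tsum_le_tsum hle hBs.summable).trans ?_⟩
  rw [hBs.tsum_eq]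
  calc _ ≤ ∑ i : Fin d, 1 / 2 * ((K₁ : ℝ) ^ 2 + latticeSum d s) := by
        refine Finset.sum_le_sum fun i _ => ?_
        have : latticeSum d s = ∑' α, ind α := by rw [latticeSum, dif_pos hd0]
        rw [this]
        have := (hsM i).2
        linarith
    _ = _ := by simp

/-- The weight `(2π|α|)^{2s}` is at least one for `α ≠ 0`, and the coefficient at zero vanishes. -/
lemma summable_sq_fourierCoef {s : ℝ} (hs : 0 < s)
    {M : E d → Matrix (Fin d) (Fin d) ℂ} (hM : IsAdmissible M) {K₁ : ℝ≥0}
    (hK₁ : matHsNorm s M ≤ K₁) (i j : Fin d) :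
    Summable fun α => ‖fourierCoef (fun y => M y i j) α‖ ^ 2 := by
  refine Summable.of_nonneg_of_le (fun _ => sq_nonneg _) (fun α => ?_)
    (summable_of_hsSemiSq_le (hsSemiSq_le hK₁ i j)).1
  by_cases h : α = 0
  · rw [h, hM.fourierCoef_zero]; simp
  · refine le_mul_of_one_le_left (sq_nonneg _) (Real.one_le_rpow ?_ (by linarith))
    nlinarith [one_le_idxNorm h, Real.pi_gt_three]

lemma summable_sq_of_le_sum {s : ℝ} (hs : 0 < s)
    {M : E d → Matrix (Fin d) (Fin d) ℂ} (hM : IsAdmissible M) {K₁ : ℝ≥0}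
    (hK₁ : matHsNorm s M ≤ K₁) (j : Fin d) {f : (Fin d → ℤ) → ℂ} {c : ℝ}
    (hf : ∀ α, ‖f α‖ ≤ c * ∑ i, ‖fourierCoef (fun y => M y i j) α‖) :
    Summable fun α => ‖f α‖ ^ 2 := by
  have h1 : Summable fun α => c ^ 2 * (d * ∑ i, ‖fourierCoef (fun y => M y i j) α‖ ^ 2) :=
    ((summable_sum fun i _ => summable_sq_fourierCoef hs hM hK₁ i j).mul_left _).mul_left _
  refine Summable.of_nonneg_of_le (fun _ => sq_nonneg _) (fun α => ?_) h1
  calc ‖f α‖ ^ 2 ≤ (c * ∑ i, ‖fourierCoef (fun y => M y i j) α‖) ^ 2 :=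
        pow_le_pow_left₀ (norm_nonneg _) (hf α) 2
    _ = c ^ 2 * (∑ i, ‖fourierCoef (fun y => M y i j) α‖) ^ 2 := mul_pow _ _ _
    _ ≤ _ := by
        refine mul_le_mul_of_nonneg_left ?_ (sq_nonneg _)
        simpa using sq_sum_le_card_mul_sum_sq (s := (Finset.univ : Finset (Fin d)))
          (f := fun i => ‖fourierCoef (fun y => M y i j) α‖)

lemma memLp_column {M : E d → Matrix (Fin d) (Fin d) ℂ} (hM : IsAdmissible M)
    {K₂ : ℝ≥0} (hK₂ : matLinfNorm M ≤ K₂) (j : Fin d) :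
    MemLp (column M j) 2 (cellVol d) := by
  refine MemLp.of_eval_piLp fun k => ?_
  simp only [column, toC3]
  unfold ext3
  split_ifs with h
  · exact hM.memLp_entry hK₂ _ j
  · simp

/-- Every column of an admissible matrix field has a vector potential. -/
lemma exists_columnPotential (hd : d = 2 ∨ d = 3) {s : ℝ} (hs : 0 < s)
    {M : E d → Matrix (Fin d) (Fin d) ℂ} (hM : IsAdmissible M) {K₁ K₂ : ℝ≥0}
    (hK₁ : matHsNorm s M ≤ K₁) (hK₂ : matLinfNorm M ≤ K₂) (j : Fin d) :
    ∃ (W : H1sharp d) (Q : E d → C3) (P : ℕ → E d → C3),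
      IsColumnPotential (d * (1 / 2 * ((K₁ : ℝ) ^ 2 + latticeSum d s))) (column M j) W Q P := by
  have hd0 : 0 < d := by omega
  have hd3 : d ≤ 3 := by omega
  obtain ⟨hsum, hbd⟩ := summable_colCoef hd hs hM hK₁ j
  set q := colCoef M j with hq
  have hq0 : q 0 = 0 := by
    have := norm_colCoef_le hd3 M j 0
    simpa [hM.fourierCoef_zero] using this
  have hqk : ∀ α, ‖q α‖ ≤ 1 * ∑ i, ‖fourierCoef (fun y => M y i j) α‖ := by
    intro α
    by_cases h : α = 0
    · rw [h, hq0, norm_zero]; positivity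
    · refine (norm_colCoef_le hd3 M j α).trans ?_
      refine mul_le_mul_of_nonneg_right ?_ (by positivity)
      exact inv_le_one_of_one_le₀ (one_le_idxNorm h)
  -- A derivative costs one factor `|α|`, exactly what inverting the curl gained, so the gradient
  -- coefficients are square summable like those of `M`.
  have hqi : ∀ α (i : Fin d), ‖(2 * Real.pi * Complex.I * α i : ℂ)‖ * ‖q α‖ ≤
      (2 * Real.pi) * ∑ i, ‖fourierCoef (fun y => M y i j) α‖ := by
    intro α i
    have h1 : ‖(2 * Real.pi * Complex.I * α i : ℂ)‖ = 2 * Real.pi * |(α i : ℝ)| := by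
      simp [Real.pi_pos.le]
    rw [h1]
    by_cases h : α = 0
    · rw [h, hq0, norm_zero, mul_zero]; positivity
    · have hn := one_le_idxNorm h
      calc 2 * Real.pi * |(α i : ℝ)| * ‖q α‖
          ≤ 2 * Real.pi * idxNorm α * ((idxNorm α)⁻¹ *
            ∑ i, ‖fourierCoef (fun y => M y i j) α‖) := by
            refine mul_le_mul ?_ (norm_colCoef_le hd3 M j α) (norm_nonneg _) (by positivity)
            exact mul_le_mul_of_nonneg_left (abs_le_idxNorm α i) (by positivity)
        _ = _ := by field_simp
  obtain ⟨W, hW⟩ := exists_H1sharp q hq0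
    (fun k => summable_sq_of_le_sum hs hM hK₁ j fun α =>
      (PiLp.norm_apply_le (q α) k).trans (hqk α))
    (fun i k => summable_sq_of_le_sum hs hM hK₁ j fun α => by
      rw [norm_mul]
      exact (mul_le_mul_of_nonneg_left (PiLp.norm_apply_le (q α) k) (norm_nonneg _)).trans (hqi α i))
  have hvW : vcoef (H1sharp.val W) = q := by
    funext α; ext k; rw [vcoef_apply, hW]
  have hterm : ∀ α y, ‖expo α y • q α‖ ≤ ‖q α‖ := fun α y => by
    rw [norm_smul, norm_expo, one_mul]
  let Q : E d → C3 := fun y => ∑' α, expo α y • q α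
  have hunif : TendstoUniformly (fun S => fpart q S) Q atTop := tendstoUniformly_tsum hsum hterm
  have hQc : Continuous Q := hunif.continuous (Frequently.of_forall fun S =>
    (isSmoothPeriodic_fpart q S).1.continuous)
  -- The Fourier series converges along the net of finite sets. A cofinal sequence is extracted
  -- because the approximations `P n` are indexed by `ℕ` and almost everywhere convergence needs
  -- sequences.
  obtain ⟨Sn, hSn⟩ := exists_seq_tendsto (atTop : Filter (Finset (Fin d → ℤ)))
  -- The partial sums converge to `W` in `L²` and to `Q` uniformly. A subsequence converging almost
  -- everywhere identifies the two limits.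
  have hval : H1sharp.val W =ᵐ[cellVol d] Q := by
    have h1 := tendsto_fpart (Lp.memLp (H1sharp.val W))
    rw [hvW] at h1
    have hm : ∀ S, AEStronglyMeasurable (fpart q S) (cellVol d) := fun S =>
      (isSmoothPeriodic_fpart q S).1.continuous.aestronglyMeasurable
    have h2 : TendstoInMeasure (cellVol d) (fun S => fpart q S) atTop (H1sharp.val W) := by
      refine tendstoInMeasure_of_tendsto_eLpNorm (p := 2) (by norm_num) hm (Lp.aestronglyMeasurable _) ?_
      refine h1.congr fun S => ?_
      rw [← eLpNorm_neg]
      congr 1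
      funext y
      simp
    obtain ⟨ns, hns, hae⟩ := (h2.comp hSn).exists_seq_tendsto_ae
    filter_upwards [hae] with y hy
    have h3 : Tendsto (fun n => fpart q (Sn (ns n)) y) atTop (𝓝 (Q y)) :=
      ((hunif.tendsto_at y).comp hSn).comp hns.tendsto_atTop
    exact tendsto_nhds_unique hy h3
  have hcurl : ∀ᵐ y ∂(cellVol d), H1sharp.curl W y = column M j y := by
    refine curl_ae_eq W (memLp_column hM hK₂ j) fun α => ?_
    rw [hvW]
    exact curl_colCoef hd3 hM hK₂ j α
  refine ⟨W, Q, fun n => fpart q (Sn n), ⟨⟨hQc, fun i y => ?_, hval⟩, fun y t => ?_, fun y => ?_,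
    fun n => isSmoothPeriodic_fpart q _, ?_, ?_, hcurl, ?_⟩⟩
  · simp only [Q, isPeriodic_expo _ i y]
  · refine tsum_congr fun α => ?_
    by_cases hα : α ⟨d - 1, by omega⟩ = 0
    · have := expo_smul_basisVec α ⟨d - 1, by omega⟩ t
      simp only [hα, Int.cast_zero, zero_mul, mul_zero, Complex.exp_zero] at this
      rw [expo_add, this, mul_one]
    · have : q α = 0 := by
        have := norm_colCoef_le hd3 M j α
        simpa [hM.fourierCoef_eq_zero hd0 _ j hα] using this
      rw [this, smul_zero, smul_zero]
  · refine le_trans ?_ hbd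
    refine (norm_tsum_le_tsum_norm ?_).trans ?_
    · exact Summable.of_nonneg_of_le (fun _ => norm_nonneg _) (fun α => hterm α y) hsum
    · refine Summable.tsum_le_tsum (fun α => hterm α y) ?_ hsum
      exact Summable.of_nonneg_of_le (fun _ => norm_nonneg _) (fun α => hterm α y) hsum
  · intro u hu
    exact hSn.eventually (hunif u hu)
  · have hvg : ∀ i, vcoef (H1sharp.grad W i) =
        fun α => (2 * Real.pi * Complex.I * α i) • q α := by
      intro i
      funext α; ext k
      rw [vcoef_apply, H1sharp.grad, coefL_grad W.2.1]
      have := hW α k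
      rw [H1sharp.val] at this
      rw [this]; simp
    have hg : ∀ i, Tendsto (fun n => eLpNorm (fun y => pderivs (fpart q (Sn n)) y i -
        H1sharp.grad W i y) 2 (cellVol d)) atTop (𝓝 0) := by
      intro i
      have h1 := (tendsto_fpart (Lp.memLp (H1sharp.grad W i))).comp hSn
      rw [hvg i] at h1
      refine h1.congr fun n => ?_
      rw [Function.comp, ← eLpNorm_neg]
      congr 1
      funext y
      simp [pderivs_fpart]
    have hs6 : Tendsto (fun n => 6 * ∑ i, eLpNorm (fun y => pderivs (fpart q (Sn n)) y i -
        H1sharp.grad W i y) 2 (cellVol d)) atTop (𝓝 0) := by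
      have := ENNReal.Tendsto.const_mul (a := 6) (tendsto_finsetSum Finset.univ fun i _ => hg i)
        (Or.inr (by norm_num))
      simpa using this
    refine tendsto_of_tendsto_of_tendsto_of_le_of_le tendsto_const_nhds hs6 (fun _ => zero_le)
      fun n => ?_
    -- The column is the curl of `W`, so the error is the curl formed from gradient errors, which
    -- tend to zero by Fourier convergence of each partial derivative.
    have he : eLpNorm (fun y => curl (fpart q (Sn n)) y - column M j y) 2 (cellVol d) =
        eLpNorm (fun y => curlOf (ext3 fun i => pderivs (fpart q (Sn n)) y i -
          H1sharp.grad W i y)) 2 (cellVol d) := by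
      refine eLpNorm_congr_ae ?_
      filter_upwards [hcurl] with y hy
      rw [← hy, ← curlOf_ext3_sub]
      rfl
    rw [he]
    refine eLpNorm_curlOf_le (fun i => ?_)
    refine AEStronglyMeasurable.sub ?_ (Lp.aestronglyMeasurable _)
    simp only [pderivs_fpart]
    exact (isSmoothPeriodic_fpart _ _).1.continuous.aestronglyMeasurable
  · refine div_ae_eq_zero W fun α => ?_
    rw [hW, hW, hW]
    exact div_colCoef M j α

end ColumnPotentialExistence

/-! ### Mollification in `L²` -/

section Mollification

lemma sq_eLpNorm_two {X V : Type*} [MeasurableSpace X] {μ : Measure X} [NormedAddCommGroup V]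
    (f : X → V) : eLpNorm f 2 μ ^ 2 = ∫⁻ x, ‖f x‖ₑ ^ 2 ∂μ := by
  have := eLpNorm_nnreal_pow_eq_lintegral (f := f) (μ := μ) (p := 2) two_ne_zero
  simpa using this

variable {d : ℕ}

/-- Translations act continuously on `L²`, being measure preserving and continuous in the parameter.
-/
lemma tendsto_eLpNorm_translate {f : E d → ℂ} (hf : MemLp f 2 volume) :
    Tendsto (fun t : E d => eLpNorm (fun x => f (x - t) - f x) 2 volume) (𝓝 0) (𝓝 0) := by
  let g : E d → C(E d, E d) := fun t => ⟨fun x => x - t, by fun_prop⟩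
  have hg : Continuous g := ContinuousMap.continuous_of_continuous_uncurry _ (by
    change Continuous fun p : E d × E d => p.2 - p.1
    fun_prop)
  have hmp : ∀ t, MeasurePreserving (g t) volume volume := fun t => by
    simpa [g] using! measurePreserving_sub_right (volume : Measure (E d)) t
  have h1 := (continuous_const (y := hf.toLp)).compMeasurePreservingLp hg hmp (by norm_num)
  have h2 := h1.tendsto 0
  rw [tendsto_iff_edist_tendsto_0] at h2
  refine h2.congr fun t => ?_
  rw [Lp.edist_def]
  refine eLpNorm_congr_ae ?_
  have e : ∀ t, Lp.compMeasurePreserving (g t) (hmp t) hf.toLp =ᵐ[volume] fun x => f (x - t) := by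
    intro t
    refine (Lp.coeFn_compMeasurePreserving _ (hmp t)).trans ?_
    exact (hmp t).quasiMeasurePreserving.ae_eq_comp hf.coeFn_toLp
  filter_upwards [e t, e 0] with x h1 h2
  rw [Pi.sub_apply, h1, h2, sub_zero]

/-- The mollification of a function by a normalized bump function. -/
def mollify (φ : ContDiffBump (0 : E d)) (f : E d → ℂ) : E d → ℂ :=
  convolution (φ.normed volume) f (ContinuousLinearMap.lsmul ℝ ℝ) volume

lemma mollify_apply (φ : ContDiffBump (0 : E d)) (f : E d → ℂ) (x : E d) :
    mollify φ f x = ∫ t, φ.normed volume t • f (x - t) := rfl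

lemma mollify_apply' (φ : ContDiffBump (0 : E d)) (f : E d → ℂ) (x : E d) :
    mollify φ f x = ∫ t, φ.normed volume (x - t) • f t :=
  convolution_lsmul_swap

/-- Jensen's inequality for the probability measure with density `φ.normed`, in the form of
Cauchy–Schwarz against the constant one. -/
lemma sq_enorm_mollify_sub_le (φ : ContDiffBump (0 : E d)) {f : E d → ℂ} (hf : MemLp f 2 volume)
    (hfm : StronglyMeasurable f) (x : E d) :
    ‖mollify φ f x - f x‖ₑ ^ 2 ≤
      ∫⁻ t, ENNReal.ofReal (φ.normed volume t) * ‖f (x - t) - f x‖ₑ ^ 2 := by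
  set ρ := φ.normed volume with hρ
  have hρc : Continuous ρ := φ.continuous_normed
  have hint : Integrable (fun t => ρ t • f (x - t)) volume :=
    (φ.hasCompactSupport_normed.convolutionExists_left (ContinuousLinearMap.lsmul ℝ ℝ)
      φ.continuous_normed (hf.locallyIntegrable (by norm_num)) x)
  have hint2 : Integrable (fun t => ρ t • f x) volume := φ.integrable_normed.smul_const _
  have e1 : mollify φ f x - f x = ∫ t, ρ t • (f (x - t) - f x) := by
    simp only [smul_sub]
    rw [integral_sub hint hint2, mollify_apply, ContDiffBump.integral_normed_smul]
  have hρm : Measurable fun t => ENNReal.ofReal (ρ t) := hρc.measurable.ennreal_ofReal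
  set ν : Measure (E d) := volume.withDensity fun t => ENNReal.ofReal (ρ t) with hν
  have hν1 : ν Set.univ = 1 := by
    rw [hν, withDensity_apply _ MeasurableSet.univ, Measure.restrict_univ,
      ← ofReal_integral_eq_lintegral_ofReal φ.integrable_normed
        (Eventually.of_forall fun t => φ.nonneg_normed t), φ.integral_normed, ENNReal.ofReal_one]
  have hGm : Measurable fun t => ‖f (x - t) - f x‖ₑ :=
    ((hfm.measurable.comp (measurable_const.sub measurable_id)).sub measurable_const).enorm
  have e2 : ‖mollify φ f x - f x‖ₑ ≤ ∫⁻ t, ‖f (x - t) - f x‖ₑ ∂ν := by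
    rw [e1, hν, lintegral_withDensity_eq_lintegral_mul _ hρm hGm]
    refine (enorm_integral_le_lintegral_enorm _).trans (le_of_eq ?_)
    refine lintegral_congr fun t => ?_
    rw [Pi.mul_apply, enorm_smul, Real.enorm_of_nonneg (φ.nonneg_normed t)]
  have e3 := ENNReal.lintegral_mul_le_Lp_mul_Lq ν Real.HolderConjugate.two_two
    hGm.aemeasurable (measurable_const (a := (1 : ℝ≥0∞))).aemeasurable
  simp only [Pi.mul_apply, mul_one, ENNReal.rpow_two, one_pow, lintegral_const, hν1,
    ENNReal.one_rpow] at e3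
  calc ‖mollify φ f x - f x‖ₑ ^ 2 ≤ (∫⁻ t, ‖f (x - t) - f x‖ₑ ∂ν) ^ 2 := pow_le_pow_left' e2 2
    _ ≤ ((∫⁻ t, ‖f (x - t) - f x‖ₑ ^ 2 ∂ν) ^ (1 / 2 : ℝ)) ^ 2 := pow_le_pow_left' e3 2
    _ = ∫⁻ t, ‖f (x - t) - f x‖ₑ ^ 2 ∂ν := by
        rw [← ENNReal.rpow_two, ← ENNReal.rpow_mul]; norm_num
    _ = _ := by
        rw [hν, lintegral_withDensity_eq_lintegral_mul _ hρm (hGm.pow_const 2)]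
        rfl

/-- Integrating the pointwise Jensen bound and exchanging the integrals leaves an average of
translation errors, over translations in the support of the kernel only. -/
lemma eLpNorm_mollify_sub_le (φ : ContDiffBump (0 : E d)) {f : E d → ℂ} (hf : MemLp f 2 volume)
    {η : ℝ≥0∞} (h : ∀ t : E d, ‖t‖ < φ.rOut → eLpNorm (fun x => f (x - t) - f x) 2 volume ≤ η) :
    eLpNorm (fun x => mollify φ f x - f x) 2 volume ≤ η := by
  -- Tonelli requires joint measurability of `(x, t) ↦ f (x - t)`, which is immediate for a strongly
  -- measurable representative.
  wlog hfm : StronglyMeasurable f generalizing f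
  · have hae := hf.1.ae_eq_mk
    have h1 := this (hf.ae_eq hae) (fun t ht => ?_) hf.1.stronglyMeasurable_mk
    · have h2 : mollify φ f = mollify φ (hf.1.mk f) :=
        convolution_congr _ (ae_eq_refl _) hae
      refine le_trans (le_of_eq (eLpNorm_congr_ae ?_)) h1
      filter_upwards [hae] with x hx
      rw [h2, hx]
    · refine le_trans (le_of_eq (eLpNorm_congr_ae ?_)) (h t ht)
      filter_upwards [hae, (measurePreserving_sub_right (volume : Measure (E d))
        t).quasiMeasurePreserving.ae_eq_comp hae] with x h1 h2
      simp only [Function.comp] at h2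
      rw [h1, h2]
  have hρm : Measurable fun t => ENNReal.ofReal (φ.normed volume t) :=
    φ.continuous_normed.measurable.ennreal_ofReal
  have key : eLpNorm (fun x => mollify φ f x - f x) 2 volume ^ 2 ≤ η ^ 2 := by
    rw [sq_eLpNorm_two]
    calc ∫⁻ x, ‖mollify φ f x - f x‖ₑ ^ 2
        ≤ ∫⁻ x, ∫⁻ t, ENNReal.ofReal (φ.normed volume t) * ‖f (x - t) - f x‖ₑ ^ 2 :=
          lintegral_mono fun x => sq_enorm_mollify_sub_le φ hf hfm x
      _ = ∫⁻ t, ∫⁻ x, ENNReal.ofReal (φ.normed volume t) * ‖f (x - t) - f x‖ₑ ^ 2 := by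
          refine lintegral_lintegral_swap (Measurable.aemeasurable ?_)
          have h1 : Measurable fun p : E d × E d => f (p.1 - p.2) - f p.1 :=
            (hfm.measurable.comp (measurable_fst.sub measurable_snd)).sub
              (hfm.measurable.comp measurable_fst)
          exact (hρm.comp measurable_snd).mul (h1.enorm.pow_const 2)
      _ ≤ ∫⁻ t, ENNReal.ofReal (φ.normed volume t) * η ^ 2 := by
          refine lintegral_mono fun t => ?_
          have hm : Measurable fun x => ‖f (x - t) - f x‖ₑ ^ 2 :=
            (((hfm.measurable.comp (measurable_id.sub measurable_const)).sub
              hfm.measurable).enorm).pow_const 2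
          simp only
          rw [lintegral_const_mul _ hm]
          by_cases ht : ‖t‖ < φ.rOut
          · refine mul_le_mul' le_rfl ?_
            rw [← sq_eLpNorm_two]
            exact pow_le_pow_left' (h t ht) 2
          · have : φ.normed volume t = 0 := by
              rw [← Function.notMem_support, φ.support_normed_eq]
              simpa using ht
            simp [this]
      _ = η ^ 2 := by
          rw [lintegral_mul_const _ hρm,
            ← ofReal_integral_eq_lintegral_ofReal φ.integrable_normed
              (Eventually.of_forall fun t => φ.nonneg_normed t), φ.integral_normed,
            ENNReal.ofReal_one, one_mul]
  exact (ENNReal.pow_le_pow_left_iff two_ne_zero).1 key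

lemma tendsto_mollify {f : E d → ℂ} (hf : MemLp f 2 volume) {φ : ℕ → ContDiffBump (0 : E d)}
    (hφ : Tendsto (fun n => (φ n).rOut) atTop (𝓝 0)) :
    Tendsto (fun n => eLpNorm (fun x => mollify (φ n) f x - f x) 2 volume) atTop (𝓝 0) := by
  rw [ENNReal.tendsto_nhds_zero]
  intro η hη
  have h1 := (ENNReal.tendsto_nhds_zero.1 (tendsto_eLpNorm_translate hf)) η hη
  obtain ⟨δ, hδ, h2⟩ := Metric.eventually_nhds_iff.1 h1
  filter_upwards [hφ.eventually (gt_mem_nhds hδ)] with n hn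
  refine eLpNorm_mollify_sub_le (φ n) hf fun t ht => h2 ?_
  rw [dist_zero_right]
  exact ht.trans hn

lemma contDiff_mollify (φ : ContDiffBump (0 : E d)) {f : E d → ℂ} (hf : MemLp f 2 volume) :
    ContDiff ℝ (⊤ : ℕ∞) (mollify φ f) :=
  φ.hasCompactSupport_normed.contDiff_convolution_left _ φ.contDiff_normed
    (hf.locallyIntegrable (by norm_num))

lemma fderiv_mollify (φ : ContDiffBump (0 : E d)) {f : E d → ℂ} (hf : MemLp f 2 volume)
    (x v : E d) : fderiv ℝ (mollify φ f) x v =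
      ∫ t, (fderiv ℝ (φ.normed volume) (x - t) v) • f t := by
  have h1 : ContDiff ℝ 1 (φ.normed (volume : Measure (E d))) := φ.contDiff_normed
  have hl : LocallyIntegrable f volume := hf.locallyIntegrable (by norm_num)
  have h := φ.hasCompactSupport_normed.hasFDerivAt_convolution_left
    (ContinuousLinearMap.lsmul ℝ ℝ) h1 hl x
  have h2 : fderiv ℝ (mollify φ f) x = _ := h.fderiv
  rw [h2, convolution_eq_swap, ContinuousLinearMap.integral_apply]
  · simp
  · have hex := (φ.hasCompactSupport_normed.fderiv ℝ).convolutionExists_left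
      (L := (ContinuousLinearMap.lsmul ℝ ℝ).precompL (E d)) (h1.continuous_fderiv one_ne_zero) hl x
    have := (convolutionExistsAt_flip (L := (ContinuousLinearMap.lsmul ℝ ℝ : ℝ →L[ℝ] ℂ →L[ℝ] ℂ).precompL (E d))).2 hex
    exact this

end Mollification

/-! ### Friedrichs' lemma -/

section Friedrichs

variable {d : ℕ} {D : Set (E d)}

lemma tsupport_bump_translate_subset (φ : ContDiffBump (0 : E d)) (x : E d) :
    tsupport (fun y => φ.normed volume (x - y)) ⊆ Metric.closedBall x φ.rOut := by
  refine closure_minimal (fun y hy => ?_) Metric.isClosed_closedBall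
  rw [Function.mem_support] at hy
  have : x - y ∈ Function.support (φ.normed (volume : Measure (E d))) := hy
  rw [φ.support_normed_eq, mem_ball_zero_iff] at this
  rw [mem_closedBall_iff_norm']
  exact this.le

/-- When the ball of radius `rOut` about `x` lies in `D`, the kernel `y ↦ ρ (x - y)` is an
admissible test function. The sign of the weak derivative cancels the sign from differentiating in
`-y`. -/
lemma IsH1.fderiv_mollify {g : E d → ℂ} {dg : Fin d → E d → ℂ} (hD : MeasurableSet D)
    (hg : IsH1 D g dg) (φ : ContDiffBump (0 : E d)) {x : E d}
    (hx : Metric.closedBall x φ.rOut ⊆ D) (i : Fin d) :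
    fderiv ℝ (mollify φ (D.indicator g)) x (basisVec d i) = mollify φ (D.indicator (dg i)) x := by
  rw [PeriodicPotential.fderiv_mollify φ ((memLp_indicator_iff_restrict hD).2 hg.memLp),
    mollify_apply']
  set ρ := φ.normed (volume : Measure (E d))
  have hρ : ContDiff ℝ (⊤ : ℕ∞) ρ := φ.contDiff_normed
  have h1 : ∀ a : E d → ℝ, ∀ g : E d → ℂ, ∫ t, a t • D.indicator g t = ∫ t in D, a t • g t := by
    intro a g
    rw [← integral_indicator hD]
    congr 1
    funext t
    by_cases ht : t ∈ D <;> simp [ht]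
  rw [h1, h1]
  have hw := hg.weak_deriv i (fun y => ρ (x - y)) (hρ.comp (by fun_prop))
    ((isCompact_closedBall x φ.rOut).of_isClosed_subset (isClosed_tsupport _)
      (tsupport_bump_translate_subset φ x))
    ((tsupport_bump_translate_subset φ x).trans hx)
  have hd : ∀ y, fderiv ℝ (fun y => ρ (x - y)) y (basisVec d i) =
      -fderiv ℝ ρ (x - y) (basisVec d i) := by
    intro y
    have h2 : HasFDerivAt (fun y => x - y) (-ContinuousLinearMap.id ℝ (E d)) y :=
      (hasFDerivAt_id y).const_sub x
    have h3 := (hρ.differentiable (by simp) (x - y)).hasFDerivAt.comp y h2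
    have h4 : fderiv ℝ (fun y => ρ (x - y)) y = _ := h3.fderiv
    rw [h4]
    simp
  simp only [hd, neg_smul, integral_neg, neg_inj] at hw
  exact hw

/-- Friedrichs: an `H¹` function is approximated in `H¹` of a compact subset by smooth functions. -/
lemma IsH1.exists_smooth_approx {g : E d → ℂ} {dg : Fin d → E d → ℂ} (hD : IsOpen D)
    (hg : IsH1 D g dg) {K : Set (E d)} (hK : IsCompact K) (hKD : K ⊆ D) :
    ∃ G : ℕ → E d → ℂ, (∀ n, ContDiff ℝ (⊤ : ℕ∞) (G n)) ∧
      Tendsto (fun n => eLpNorm (fun x => G n x - g x) 2 (volume.restrict K)) atTop (𝓝 0) ∧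
      ∀ i, Tendsto (fun n => eLpNorm (fun x => pderivs (G n) x i - dg i x) 2 (volume.restrict K))
        atTop (𝓝 0) := by
  -- All mollification radii stay below `δ`, so the kernels centred in `K` never reach the boundary
  -- of `D`.
  obtain ⟨δ, hδ, hsub⟩ := hK.exists_cthickening_subset_open hD hKD
  have hmem : ∀ {f : E d → ℂ}, MemLp f 2 (vol D) → MemLp (D.indicator f) 2 volume := fun hf =>
    (memLp_indicator_iff_restrict hD.measurableSet).2 hf
  have hpos : ∀ n : ℕ, 0 < δ / (n + 1) := fun n => by positivity
  let φ : ℕ → ContDiffBump (0 : E d) := fun n =>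
    ⟨δ / (n + 1) / 2, δ / (n + 1), half_pos (hpos n), half_lt_self (hpos n)⟩
  have hr : ∀ n, (φ n).rOut ≤ δ := fun n => div_le_self hδ.le (by linarith [n.cast_nonneg (α := ℝ)])
  have hφ : Tendsto (fun n => (φ n).rOut) atTop (𝓝 0) := by
    have := (tendsto_one_div_add_atTop_nhds_zero_nat (𝕜 := ℝ)).const_mul δ
    simpa [φ, div_eq_mul_inv] using this
  have hball : ∀ n, ∀ x ∈ K, Metric.closedBall x (φ n).rOut ⊆ D := fun n x hx =>
    (Metric.closedBall_subset_closedBall (hr n)).trans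
      ((Metric.closedBall_subset_cthickening hx δ).trans hsub)
  refine ⟨fun n => mollify (φ n) (D.indicator g), fun n => contDiff_mollify _ (hmem hg.memLp),
    ?_, fun i => ?_⟩
  · refine tendsto_of_tendsto_of_tendsto_of_le_of_le tendsto_const_nhds
      (tendsto_mollify (hmem hg.memLp) hφ) (fun _ => zero_le) fun n => ?_
    refine le_trans (le_of_eq (eLpNorm_congr_ae ?_)) (eLpNorm_restrict_le _ _ _ K)
    filter_upwards [ae_restrict_mem hK.measurableSet] with x hx
    rw [Set.indicator_of_mem (hKD hx)]
  · refine tendsto_of_tendsto_of_tendsto_of_le_of_le tendsto_const_nhds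
      (tendsto_mollify (hmem (hg.memLp_deriv i)) hφ) (fun _ => zero_le) fun n => ?_
    refine le_trans (le_of_eq (eLpNorm_congr_ae ?_)) (eLpNorm_restrict_le _ _ _ K)
    filter_upwards [ae_restrict_mem hK.measurableSet] with x hx
    rw [pderivs, hg.fderiv_mollify hD.measurableSet (φ n) (hball n x hx) i,
      Set.indicator_of_mem (hKD hx)]

end Friedrichs

/-! ### Vector calculus -/

section VectorCalculus

variable {d : ℕ}

/-- As `basisVec d k` is zero for `k ≥ d`, the missing derivative is a directional derivative along
zero. The vector calculus that follows therefore treats both dimensions at once. -/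
lemma ext3_pderivs {X : Type*} [NormedAddCommGroup X] [NormedSpace ℝ X] (f : E d → X) (x : E d) :
    ext3 (pderivs f x) = fun k : Fin 3 => fderiv ℝ f x (basisVec d k) := by
  funext k
  unfold ext3 pderivs
  split_ifs with h
  · rfl
  · simp [basisVec, h]

lemma curl_eq (f : E d → C3) (x : E d) :
    curl f x = curlOf fun k : Fin 3 => fderiv ℝ f x (basisVec d k) := by
  rw [curl, ext3_pderivs]

lemma fderiv_coord {f : E d → C3} {x : E d} (hf : DifferentiableAt ℝ f x) (k : Fin 3) (v : E d) :
    fderiv ℝ (fun y => f y k) x v = fderiv ℝ f x v k := by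
  have := ((EuclideanSpace.proj (𝕜 := ℂ) k : C3 →L[ℂ] ℂ).restrictScalars ℝ).hasFDerivAt.comp x
    hf.hasFDerivAt
  have h4 : fderiv ℝ (fun y => f y k) x = _ := this.fderiv
  rw [h4]
  rfl

lemma contDiff_coord {n : WithTop ℕ∞} {f : E d → C3} (hf : ContDiff ℝ n f) (k : Fin 3) :
    ContDiff ℝ n fun y => f y k := (contDiff_piLp 2).1 hf k

lemma continuous_fderiv_coord {f : E d → C3} (hf : ContDiff ℝ 1 f) (k : Fin 3) (v : E d) :
    Continuous fun x => fderiv ℝ f x v k :=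
  (EuclideanSpace.proj (𝕜 := ℂ) k).continuous.comp
    ((hf.continuous_fderiv one_ne_zero).clm_apply continuous_const)

lemma continuous_curl {f : E d → C3} (hf : ContDiff ℝ 1 f) : Continuous (curl f) := by
  have h : curl f = fun x => WithLp.toLp 2 fun k => curl f x k := rfl
  rw [h]
  refine (PiLp.continuous_toLp 2 _).comp (continuous_pi fun k => ?_)
  simp only [curl_eq, curlOf]
  have h := fun j k => continuous_fderiv_coord hf j (basisVec d k)
  fin_cases k
  exacts [(h 2 1).sub (h 1 2), (h 0 2).sub (h 2 0), (h 1 0).sub (h 0 1)]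

lemma curl_smul {G : E d → ℂ} {R : E d → C3} {x : E d} (hG : DifferentiableAt ℝ G x)
    (hR : DifferentiableAt ℝ R x) :
    curl (fun y => G y • R y) x = cross (toC3 (pderivs G x)) (R x) + G x • curl R x := by
  have h : fderiv ℝ (fun y => G y • R y) x = G x • fderiv ℝ R x + (fderiv ℝ G x).smulRight (R x) :=
    fderiv_fun_smul hG hR
  rw [curl_eq, curl_eq, h, toC3, ext3_pderivs]
  ext k
  fin_cases k <;> simp [curlOf, cross] <;> ring

lemma norm_dot_le (a b : C3) : ‖dot a b‖ ≤ 3 * ‖a‖ * ‖b‖ := by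
  rw [dot]
  refine (norm_sum_le _ _).trans ?_
  calc ∑ k, ‖a k * b k‖ ≤ ∑ k : Fin 3, ‖a‖ * ‖b‖ := by
        refine Finset.sum_le_sum fun k _ => ?_
        rw [norm_mul]
        exact mul_le_mul (PiLp.norm_apply_le a k) (PiLp.norm_apply_le b k) (norm_nonneg _)
          (norm_nonneg _)
    _ = _ := by simp; ring

lemma sub_dot (a b c : C3) : dot (a - b) c = dot a c - dot b c := by
  simp [dot, sub_mul, Finset.sum_sub_distrib]

lemma dot_sub (a b c : C3) : dot a (b - c) = dot a b - dot a c := by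
  simp [dot, mul_sub, Finset.sum_sub_distrib]

lemma integrable_mul_of_contDiff {f h : E d → ℂ} (hf : Continuous f) (hh : Continuous h)
    (hs : HasCompactSupport h) : Integrable (fun x => f x * h x) volume :=
  (hf.mul hh).integrable_of_hasCompactSupport hs.mul_left

/-- Integration by parts against a compactly supported function. -/
lemma integral_mul_fderiv {f h : E d → ℂ} (hf : ContDiff ℝ 1 f) (hh : ContDiff ℝ 1 h)
    (hs : HasCompactSupport h) (v : E d) :
    ∫ x, f x * fderiv ℝ h x v = -∫ x, fderiv ℝ f x v * h x := by
  refine integral_mul_fderiv_eq_neg_fderiv_mul_of_integrable ?_ ?_ ?_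
    (fun x _ => hf.differentiable one_ne_zero x) (fun x _ => hh.differentiable one_ne_zero x)
  · exact integrable_mul_of_contDiff ((hf.continuous_fderiv one_ne_zero).clm_apply continuous_const)
      hh.continuous hs
  · exact integrable_mul_of_contDiff hf.continuous
      ((hh.continuous_fderiv one_ne_zero).clm_apply continuous_const) (hs.fderiv_apply ℝ v)
  · exact integrable_mul_of_contDiff hf.continuous hh.continuous hs

lemma integral_sub_add_sub {f₁ f₂ f₃ f₄ f₅ f₆ : E d → ℂ} (h₁ : Integrable f₁) (h₂ : Integrable f₂)
    (h₃ : Integrable f₃) (h₄ : Integrable f₄) (h₅ : Integrable f₅) (h₆ : Integrable f₆) :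
    ∫ x, (f₁ x - f₂ x) + (f₃ x - f₄ x) + (f₅ x - f₆ x) =
      ((∫ x, f₁ x) - ∫ x, f₂ x) + ((∫ x, f₃ x) - ∫ x, f₄ x) + ((∫ x, f₅ x) - ∫ x, f₆ x) := by
  have h12 : Integrable fun x => f₁ x - f₂ x := h₁.sub h₂
  have h34 : Integrable fun x => f₃ x - f₄ x := h₃.sub h₄
  have h56 : Integrable fun x => f₅ x - f₆ x := h₅.sub h₆
  have h1234 : Integrable fun x => (f₁ x - f₂ x) + (f₃ x - f₄ x) := h12.add h34
  rw [integral_add h1234 h56, integral_add h12 h34, integral_sub h₁ h₂, integral_sub h₃ h₄,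
    integral_sub h₅ h₆]

/-- The curl is formally self-adjoint. -/
lemma integral_dot_curl {Φ ψ : E d → C3} (hΦ : ContDiff ℝ 1 Φ) (hψ : ContDiff ℝ 1 ψ)
    (hs : HasCompactSupport ψ) : ∫ x, dot (Φ x) (curl ψ x) = ∫ x, dot (curl Φ x) (ψ x) := by
  have hk : ∀ k : Fin 3, HasCompactSupport fun x => ψ x k := fun k =>
    hs.comp_left (g := fun v : C3 => v k) rfl
  have hfd : ∀ k (v : E d), HasCompactSupport fun x => fderiv ℝ ψ x v k := fun k v =>
    (hs.fderiv_apply ℝ v).comp_left (g := fun v : C3 => v k) rfl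
  have hΦc : ∀ k : Fin 3, Continuous fun x => Φ x k := fun k => (contDiff_coord hΦ k).continuous
  have hψc : ∀ k : Fin 3, Continuous fun x => ψ x k := fun k => (contDiff_coord hψ k).continuous
  have hi1 : ∀ (j k : Fin 3) (v : E d), Integrable (fun x => Φ x j * fderiv ℝ ψ x v k) volume :=
    fun j k v => integrable_mul_of_contDiff (hΦc j) (continuous_fderiv_coord hψ k v) (hfd k v)
  have hi2 : ∀ (j k : Fin 3) (v : E d), Integrable (fun x => fderiv ℝ Φ x v j * ψ x k) volume :=
    fun j k v => integrable_mul_of_contDiff (continuous_fderiv_coord hΦ j v) (hψc k) (hk k)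
  have ibp : ∀ (j k : Fin 3) (v : E d), ∫ x, Φ x j * fderiv ℝ ψ x v k =
      -∫ x, fderiv ℝ Φ x v j * ψ x k := by
    intro j k v
    have := integral_mul_fderiv (contDiff_coord hΦ j) (contDiff_coord hψ k) (hk k) v
    simpa only [fderiv_coord (hΦ.differentiable one_ne_zero _),
      fderiv_coord (hψ.differentiable one_ne_zero _)] using this
  have e1 : ∀ x, dot (Φ x) (curl ψ x) =
      (Φ x 0 * fderiv ℝ ψ x (basisVec d (1 : Fin 3)) 2 - Φ x 0 * fderiv ℝ ψ x (basisVec d (2 : Fin 3)) 1) +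
      (Φ x 1 * fderiv ℝ ψ x (basisVec d (2 : Fin 3)) 0 - Φ x 1 * fderiv ℝ ψ x (basisVec d (0 : Fin 3)) 2) +
      (Φ x 2 * fderiv ℝ ψ x (basisVec d (0 : Fin 3)) 1 - Φ x 2 * fderiv ℝ ψ x (basisVec d (1 : Fin 3)) 0) := by
    intro x
    rw [dot, curl_eq, Fin.sum_univ_three]
    simp [curlOf, mul_sub]
  have e2 : ∀ x, dot (curl Φ x) (ψ x) =
      (fderiv ℝ Φ x (basisVec d (1 : Fin 3)) 2 * ψ x 0 - fderiv ℝ Φ x (basisVec d (2 : Fin 3)) 1 * ψ x 0) +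
      (fderiv ℝ Φ x (basisVec d (2 : Fin 3)) 0 * ψ x 1 - fderiv ℝ Φ x (basisVec d (0 : Fin 3)) 2 * ψ x 1) +
      (fderiv ℝ Φ x (basisVec d (0 : Fin 3)) 1 * ψ x 2 - fderiv ℝ Φ x (basisVec d (1 : Fin 3)) 0 * ψ x 2) := by
    intro x
    rw [dot, curl_eq, Fin.sum_univ_three]
    simp [curlOf, sub_mul]
  simp only [e1, e2]
  rw [integral_sub_add_sub (hi1 _ _ _) (hi1 _ _ _) (hi1 _ _ _) (hi1 _ _ _) (hi1 _ _ _) (hi1 _ _ _),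
    integral_sub_add_sub (hi2 _ _ _) (hi2 _ _ _) (hi2 _ _ _) (hi2 _ _ _) (hi2 _ _ _) (hi2 _ _ _)]
  simp only [ibp]
  ring

lemma contDiff_toC3_pderivs {w : E d → ℂ} {n : ℕ∞} (hw : ContDiff ℝ (n + 1 : ℕ∞) w) :
    ContDiff ℝ n fun x => toC3 (pderivs w x) := by
  refine (contDiff_piLp 2).2 fun k => ?_
  simp only [toC3, ext3_pderivs]
  exact (hw.fderiv_right (m := n) (by norm_cast)).clm_apply contDiff_const

/-- The curl of a gradient vanishes. -/
lemma curl_toC3_pderivs {w : E d → ℂ} (hw : ContDiff ℝ (⊤ : ℕ∞) w) (x : E d) :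
    curl (fun x => toC3 (pderivs w x)) x = 0 := by
  have hC : ContDiff ℝ (⊤ : ℕ∞) fun x => toC3 (pderivs w x) := contDiff_toC3_pderivs (by simpa using hw)
  have hdiff : DifferentiableAt ℝ (fderiv ℝ w) x :=
    ((hw.fderiv_right (m := 1) (by norm_cast)).differentiable one_ne_zero) x
  have hsymm : IsSymmSndFDerivAt ℝ w x := by
    refine ContDiffAt.isSymmSndFDerivAt (hw.contDiffAt) ?_
    simp only [minSmoothness_of_isRCLikeNormedField]
    norm_cast
  have hc : ∀ (k : Fin 3) (v : E d), fderiv ℝ (fun x => toC3 (pderivs w x)) x v k =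
      fderiv ℝ (fderiv ℝ w) x v (basisVec d k) := by
    intro k v
    rw [← fderiv_coord (hC.differentiable (by simp) x)]
    simp only [toC3, ext3_pderivs]
    rw [fderiv_clm_apply hdiff (differentiableAt_const _)]
    simp
  rw [curl_eq]
  ext k
  fin_cases k <;> simp [curlOf, hc, hsymm.eq (basisVec d 0), hsymm.eq (basisVec d 1) (basisVec d 2)]

end VectorCalculus

/-! ### Limits of integrals of products -/

section Products

variable {X : Type*} [MeasurableSpace X] {μ : Measure X}

lemma eLpNorm_two_eq {V : Type*} [NormedAddCommGroup V] (f : X → V) :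
    eLpNorm f 2 μ = (∫⁻ x, ‖f x‖ₑ ^ (2 : ℝ) ∂μ) ^ (1 / 2 : ℝ) := by
  simpa using eLpNorm_eq_lintegral_rpow_enorm_toReal (μ := μ) (f := f) (p := 2) (by norm_num)
    (by norm_num)

lemma lintegral_enorm_mul_le {V W : Type*} [NormedAddCommGroup V] [NormedAddCommGroup W]
    {f : X → V} {g : X → W} (hf : AEStronglyMeasurable f μ) (hg : AEStronglyMeasurable g μ) :
    ∫⁻ x, ‖f x‖ₑ * ‖g x‖ₑ ∂μ ≤ eLpNorm f 2 μ * eLpNorm g 2 μ := by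
  rw [eLpNorm_two_eq f, eLpNorm_two_eq g]
  exact ENNReal.lintegral_mul_le_Lp_mul_Lq μ Real.HolderConjugate.two_two hf.enorm hg.enorm

lemma integrable_dot {a b : X → C3} (ha : MemLp a 2 μ) (hb : MemLp b 2 μ) :
    Integrable (fun x => dot (a x) (b x)) μ := by
  unfold dot
  refine integrable_finsetSum _ fun k _ => ?_
  exact (ha.eval_piLp k).integrable_mul (hb.eval_piLp k)

lemma enorm_integral_dot_le {a b : X → C3} (ha : AEStronglyMeasurable a μ)
    (hb : AEStronglyMeasurable b μ) :
    ‖∫ x, dot (a x) (b x) ∂μ‖ₑ ≤ 3 * (eLpNorm a 2 μ * eLpNorm b 2 μ) := by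
  refine (enorm_integral_le_lintegral_enorm _).trans ?_
  refine le_trans ?_ (mul_le_mul' (le_refl (3 : ℝ≥0∞)) (lintegral_enorm_mul_le ha hb))
  rw [← lintegral_const_mul' _ _ (by norm_num)]
  refine lintegral_mono fun x => ?_
  have h := norm_dot_le (a x) (b x)
  simp only [← ofReal_norm]
  rw [← mul_assoc]
  rw [show (3 : ℝ≥0∞) = ENNReal.ofReal 3 by norm_num, ← ENNReal.ofReal_mul (by norm_num),
    ← ENNReal.ofReal_mul (by positivity)]
  exact ENNReal.ofReal_le_ofReal h

/-- Continuity of the pairing of `L²` fields. -/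
lemma tendsto_integral_dot {a b : ℕ → X → C3} {a₀ b₀ : X → C3} (ha : ∀ n, MemLp (a n) 2 μ)
    (hb : ∀ n, MemLp (b n) 2 μ) (ha₀ : MemLp a₀ 2 μ) (hb₀ : MemLp b₀ 2 μ)
    (hta : Tendsto (fun n => eLpNorm (fun x => a n x - a₀ x) 2 μ) atTop (𝓝 0))
    (htb : Tendsto (fun n => eLpNorm (fun x => b n x - b₀ x) 2 μ) atTop (𝓝 0)) :
    Tendsto (fun n => ∫ x, dot (a n x) (b n x) ∂μ) atTop (𝓝 (∫ x, dot (a₀ x) (b₀ x) ∂μ)) := by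
  rw [tendsto_iff_edist_tendsto_0]
  have hlim : Tendsto (fun n => 3 * (eLpNorm (fun x => a n x - a₀ x) 2 μ *
      eLpNorm (fun x => b n x - b₀ x) 2 μ) + 3 * (eLpNorm (fun x => a n x - a₀ x) 2 μ *
      eLpNorm b₀ 2 μ) + 3 * (eLpNorm a₀ 2 μ * eLpNorm (fun x => b n x - b₀ x) 2 μ)) atTop (𝓝 0) := by
    have h1 := ENNReal.Tendsto.mul hta (Or.inr (by simp)) htb (Or.inr (by simp))
    have h2 := ENNReal.Tendsto.mul_const (b := eLpNorm b₀ 2 μ) hta (Or.inr hb₀.eLpNorm_ne_top)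
    have h3 := ENNReal.Tendsto.const_mul (a := eLpNorm a₀ 2 μ) htb (Or.inr ha₀.eLpNorm_ne_top)
    have h1' := ENNReal.Tendsto.const_mul (a := 3) h1 (Or.inr (by norm_num))
    have h2' := ENNReal.Tendsto.const_mul (a := 3) h2 (Or.inr (by norm_num))
    have h3' := ENNReal.Tendsto.const_mul (a := 3) h3 (Or.inr (by norm_num))
    simpa using (h1'.add h2').add h3'
  refine tendsto_of_tendsto_of_tendsto_of_le_of_le tendsto_const_nhds hlim (fun _ => zero_le)
    fun n => ?_
  have hda : MemLp (fun x => a n x - a₀ x) 2 μ := (ha n).sub ha₀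
  have hdb : MemLp (fun x => b n x - b₀ x) 2 μ := (hb n).sub hb₀
  have e : ∫ x, dot (a n x) (b n x) ∂μ - ∫ x, dot (a₀ x) (b₀ x) ∂μ =
      ∫ x, dot (a n x - a₀ x) (b n x - b₀ x) ∂μ + ∫ x, dot (a n x - a₀ x) (b₀ x) ∂μ +
        ∫ x, dot (a₀ x) (b n x - b₀ x) ∂μ := by
    have hsum : Integrable (fun x => dot (a n x - a₀ x) (b n x - b₀ x) +
        dot (a n x - a₀ x) (b₀ x)) μ := (integrable_dot hda hdb).add (integrable_dot hda hb₀)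
    rw [← integral_sub (integrable_dot (ha n) (hb n)) (integrable_dot ha₀ hb₀),
      ← integral_add (integrable_dot hda hdb) (integrable_dot hda hb₀),
      ← integral_add hsum (integrable_dot ha₀ hdb)]
    congr 1
    funext x
    simp only [dot_sub, sub_dot]
    ring
  rw [edist_eq_enorm_sub, e]
  refine (enorm_add_le _ _).trans (add_le_add ((enorm_add_le _ _).trans (add_le_add ?_ ?_)) ?_)
  · exact enorm_integral_dot_le hda.1 hdb.1
  · exact enorm_integral_dot_le hda.1 hb₀.1
  · exact enorm_integral_dot_le ha₀.1 hdb.1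

end Products

/-! ### Bounded fields with bounded curl, and their products with Sobolev functions -/

section RoughCurl

variable {d : ℕ}

/-- Reduces the `L²` estimates of products to a pointwise bound by finitely many square integrable
functions with constant coefficients. -/
lemma eLpNorm_le_sum_of_norm_le {X V W : Type*} [MeasurableSpace X] {μ : Measure X}
    [NormedAddCommGroup V] [NormedAddCommGroup W] {ι : Type*} (s : Finset ι) {f : X → V}
    {u : ι → X → W} {a : ι → ℝ} (ha : ∀ i ∈ s, 0 ≤ a i)
    (hu : ∀ i ∈ s, AEStronglyMeasurable (u i) μ)
    (h : ∀ᵐ x ∂μ, ‖f x‖ ≤ ∑ i ∈ s, a i * ‖u i x‖) :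
    eLpNorm f 2 μ ≤ ∑ i ∈ s, ENNReal.ofReal (a i) * eLpNorm (u i) 2 μ := by
  refine (eLpNorm_mono_ae_real h).trans ?_
  have e : (fun x => ∑ i ∈ s, a i * ‖u i x‖) = ∑ i ∈ s, (a i) • fun x => ‖u i x‖ := by
    funext x; simp
  rw [e]
  refine (eLpNorm_sum_le (fun i hi => ((hu i hi).norm.const_smul (a i))) (by norm_num)).trans ?_
  refine Finset.sum_le_sum fun i hi => ?_
  rw [eLpNorm_const_smul, eLpNorm_norm, Real.enorm_eq_ofReal (ha i hi)]

lemma tendsto_of_le_sum_four {f a₁ a₂ a₃ a₄ : ℕ → ℝ≥0∞} (h₁ : Tendsto a₁ atTop (𝓝 0))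
    (h₂ : Tendsto a₂ atTop (𝓝 0)) (h₃ : Tendsto a₃ atTop (𝓝 0)) (h₄ : Tendsto a₄ atTop (𝓝 0))
    (h : ∀ n, f n ≤ a₁ n + a₂ n + a₃ n + a₄ n) : Tendsto f atTop (𝓝 0) := by
  refine tendsto_of_tendsto_of_tendsto_of_le_of_le tendsto_const_nhds ?_ (fun _ => zero_le) h
  simpa using ((h₁.add h₂).add h₃).add h₄

/-- A field `R` bounded by `C` whose curl `m` is bounded by `C'`, approximated by smooth fields
`P n`, uniformly, with curls converging in `L²(S)`. -/
structure IsRoughField (S : Set (E d)) (C C' : ℝ) (R m : E d → C3) (P : ℕ → E d → C3) :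
    Prop where
  cont : Continuous R
  bound : ∀ x, ‖R x‖ ≤ C
  smooth : ∀ n, ContDiff ℝ (⊤ : ℕ∞) (P n)
  unif : TendstoUniformly P R atTop
  meas : AEStronglyMeasurable m (vol S)
  bound_curl : ∀ᵐ x ∂(vol S), ‖m x‖ ≤ C'
  curl_tendsto : Tendsto (fun n => eLpNorm (fun x => curl (P n) x - m x) 2 (vol S)) atTop (𝓝 0)

/-- The curl of `g R`, for a function `g` with gradient `dg` and a field `R` with curl `m`. -/
def curlProd (g : E d → ℂ) (dg : Fin d → E d → ℂ) (R m : E d → C3) (x : E d) : C3 :=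
  cross (toC3 fun i => dg i x) (R x) + g x • m x

lemma IsRoughField.mono {S T : Set (E d)} {C C' : ℝ} {R m : E d → C3} {P : ℕ → E d → C3}
    (h : IsRoughField T C C' R m P) (hST : S ⊆ T) : IsRoughField S C C' R m P where
  cont := h.cont
  bound := h.bound
  smooth := h.smooth
  unif := h.unif
  meas := h.meas.mono_measure (Measure.restrict_mono hST le_rfl)
  bound_curl := ae_restrict_of_ae_restrict_of_subset hST h.bound_curl
  curl_tendsto := tendsto_of_tendsto_of_tendsto_of_le_of_le tendsto_const_nhds h.curl_tendsto
    (fun _ => zero_le) fun _ => eLpNorm_mono_measure _ (Measure.restrict_mono hST le_rfl)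

lemma cross_sub_left (a b c : C3) : cross (a - b) c = cross a c - cross b c := by
  ext k; fin_cases k <;> simp [cross] <;> ring

lemma cross_sub_right (a b c : C3) : cross a (b - c) = cross a b - cross a c := by
  ext k; fin_cases k <;> simp [cross] <;> ring

lemma cross_smul_left (z : ℂ) (a b : C3) : cross (z • a) b = z • cross a b := by
  ext k; fin_cases k <;> simp [cross] <;> ring

lemma continuous_cross : Continuous fun p : C3 × C3 => cross p.1 p.2 := by
  refine (PiLp.continuous_toLp 2 _).comp (continuous_pi fun k => ?_)
  fin_cases k <;> simp <;> fun_prop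

lemma aestronglyMeasurable_cross {X : Type*} [MeasurableSpace X] {μ : Measure X} {a b : X → C3}
    (ha : AEStronglyMeasurable a μ) (hb : AEStronglyMeasurable b μ) :
    AEStronglyMeasurable (fun x => cross (a x) (b x)) μ := by
  have h1 : AEStronglyMeasurable (fun x => (a x, b x)) μ := ha.prodMk hb
  have h2 := continuous_cross.comp_aestronglyMeasurable h1
  exact h2

lemma toC3_sub (a b : Fin d → ℂ) : toC3 (fun i => a i - b i) = toC3 a - toC3 b := by
  ext k; simp only [toC3, ext3, PiLp.sub_apply]; split_ifs <;> simp

lemma continuous_toC3 : Continuous (toC3 : (Fin d → ℂ) → C3) := by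
  refine (PiLp.continuous_toLp 2 _).comp (continuous_pi fun k => ?_)
  unfold ext3
  split_ifs <;> fun_prop

lemma memLp_toC3 (hd : d ≤ 3) {X : Type*} [MeasurableSpace X] {μ : Measure X} {a : Fin d → X → ℂ}
    (ha : ∀ i, MemLp (a i) 2 μ) : MemLp (fun x => toC3 fun i => a i x) 2 μ := by
  have hm : AEStronglyMeasurable (fun x => toC3 fun i => a i x) μ :=
    continuous_toC3.comp_aestronglyMeasurable 
      (aemeasurable_pi_lambda _ fun i => (ha i).1.aemeasurable).aestronglyMeasurable
  refine (memLp_finsetSum (Finset.univ) fun i _ => (ha i).norm).mono' hm ?_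
  exact Eventually.of_forall fun x => norm_toC3_le hd _

lemma eLpNorm_toC3_le (hd : d ≤ 3) {X : Type*} [MeasurableSpace X] {μ : Measure X}
    {a : Fin d → X → ℂ} (ha : ∀ i, AEStronglyMeasurable (a i) μ) :
    eLpNorm (fun x => toC3 fun i => a i x) 2 μ ≤ ∑ i, eLpNorm (a i) 2 μ := by
  have := eLpNorm_le_sum_of_norm_le (μ := μ) Finset.univ (f := fun x => toC3 fun i => a i x)
    (u := a) (a := fun _ => 1) (fun _ _ => zero_le_one) (fun i _ => ha i)
    (Eventually.of_forall fun x => by simpa using norm_toC3_le hd _)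
  simpa using this

lemma IsRoughField.memLp_smul {S : Set (E d)} {C C' : ℝ} {R m : E d → C3} {P : ℕ → E d → C3}
    (h : IsRoughField S C C' R m P) {g : E d → ℂ} (hg : MemLp g 2 (vol S)) :
    MemLp (fun x => g x • R x) 2 (vol S) := by
  refine (hg.norm.const_mul C).mono' (hg.1.smul h.cont.aestronglyMeasurable) ?_
  refine Eventually.of_forall fun x => ?_
  rw [norm_smul, mul_comm]
  exact mul_le_mul_of_nonneg_right (h.bound x) (norm_nonneg _)

lemma IsRoughField.memLp_curlProd (hd : d ≤ 3) {S : Set (E d)} {C C' : ℝ} {R m : E d → C3}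
    {P : ℕ → E d → C3} (h : IsRoughField S C C' R m P) {g : E d → ℂ} {dg : Fin d → E d → ℂ}
    (hg : MemLp g 2 (vol S)) (hdg : ∀ i, MemLp (dg i) 2 (vol S)) :
    MemLp (curlProd g dg R m) 2 (vol S) := by
  have h1 : MemLp (fun x => cross (toC3 fun i => dg i x) (R x)) 2 (vol S) := by
    have ht := memLp_toC3 hd hdg
    have hm : AEStronglyMeasurable (fun x => cross (toC3 fun i => dg i x) (R x)) (vol S) :=
      aestronglyMeasurable_cross ht.1 h.cont.aestronglyMeasurable
    refine (ht.norm.const_mul (6 * C)).mono' hm ?_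
    refine Eventually.of_forall fun x => (norm_cross_le _ _).trans ?_
    have := mul_le_mul_of_nonneg_left (h.bound x) (norm_nonneg (toC3 fun i => dg i x))
    linarith
  have h2 : MemLp (fun x => g x • m x) 2 (vol S) := by
    refine (hg.norm.const_mul C').mono' (hg.1.smul h.meas) ?_
    filter_upwards [h.bound_curl] with x hx
    rw [norm_smul, mul_comm]
    exact mul_le_mul_of_nonneg_right hx (norm_nonneg _)
  exact h1.add h2

/-- Smooth approximation of a product, by a diagonal choice of the approximation of the rough
factor. -/
lemma IsRoughField.exists_diagonal (hd : d ≤ 3) {S : Set (E d)} (hS : Bornology.IsBounded S)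
    {C C' : ℝ} {R m : E d → C3} {P : ℕ → E d → C3}
    (h : IsRoughField S C C' R m P) {g : E d → ℂ} {dg : Fin d → E d → ℂ} {G : ℕ → E d → ℂ}
    (hSm : MeasurableSet S)
    (hg : MemLp g 2 (vol S)) (hdg : ∀ i, MemLp (dg i) 2 (vol S))
    (hG : ∀ n, ContDiff ℝ (⊤ : ℕ∞) (G n))
    (hGg : Tendsto (fun n => eLpNorm (fun x => G n x - g x) 2 (vol S)) atTop (𝓝 0))
    (hGdg : ∀ i, Tendsto (fun n => eLpNorm (fun x => pderivs (G n) x i - dg i x) 2 (vol S)) atTop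
      (𝓝 0)) :
    ∃ N : ℕ → ℕ, (∀ n x, ‖P (N n) x - R x‖ ≤ 1 / ((n : ℝ) + 1)) ∧
      Tendsto (fun n => eLpNorm (fun x => G n x • P (N n) x - g x • R x) 2 (vol S)) atTop (𝓝 0) ∧
      Tendsto (fun n => eLpNorm (fun x => curl (fun y => G n y • P (N n) y) x -
        curlProd g dg R m x) 2 (vol S)) atTop (𝓝 0) := by
  -- The sup of `|G n|` on `S` need not stay bounded in `n`. The index `N n` is therefore chosen
  -- after it, so that `B n` times the curl error is at most `1/(n+1)`.
  have hB : ∀ n, ∃ B : ℝ, 0 < B ∧ ∀ x ∈ S, ‖G n x‖ ≤ B := by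
    intro n
    obtain ⟨B, hB⟩ := hS.isCompact_closure.exists_bound_of_continuousOn
      (hG n).continuous.continuousOn
    exact ⟨max B 1, by positivity, fun x hx => (hB x (subset_closure hx)).trans (le_max_left _ _)⟩
  choose B hB0 hB using hB
  have hN : ∀ n : ℕ, ∃ N : ℕ, (∀ x, ‖P N x - R x‖ ≤ 1 / ((n : ℝ) + 1)) ∧
      ENNReal.ofReal (B n) * eLpNorm (fun x => curl (P N) x - m x) 2 (vol S) ≤
        ENNReal.ofReal (1 / ((n : ℝ) + 1)) := by
    intro n
    have hpos : (0 : ℝ) < 1 / ((n : ℝ) + 1) := by positivity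
    have h1 := Metric.tendstoUniformly_iff.1 h.unif _ hpos
    have h2 : Tendsto (fun N => ENNReal.ofReal (B n) *
        eLpNorm (fun x => curl (P N) x - m x) 2 (vol S)) atTop (𝓝 0) := by
      simpa using ENNReal.Tendsto.const_mul h.curl_tendsto (Or.inr ENNReal.ofReal_ne_top)
    have h3 := h2.eventually (gt_mem_nhds (ENNReal.ofReal_pos.2 hpos))
    obtain ⟨N, hN1, hN2⟩ := (h1.and h3).exists
    refine ⟨N, fun x => ?_, hN2.le⟩
    rw [← dist_eq_norm, dist_comm]
    exact (hN1 x).le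
  choose N hN1 hN2 using hN
  have hC : 0 ≤ C := (norm_nonneg _).trans (h.bound 0)
  -- `C'` has no sign in general, since its bound is vacuous on a null set; `|C'|` is used as the
  -- coefficient.
  have hC' : 0 ≤ |C'| := abs_nonneg _
  have hn1 : ∀ n : ℕ, 1 / ((n : ℝ) + 1) ≤ 1 := fun n => by
    rw [div_le_one (by positivity)]; linarith [Nat.cast_nonneg (α := ℝ) n]
  have hlim : Tendsto (fun n : ℕ => ENNReal.ofReal (1 / ((n : ℝ) + 1))) atTop (𝓝 0) := by
    simpa using ENNReal.tendsto_ofReal tendsto_one_div_add_atTop_nhds_zero_nat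
  have hPN : ∀ n x, ‖P (N n) x‖ ≤ C + 1 := fun n x => by
    have h1 := hN1 n x
    have h2 := norm_add_le (P (N n) x - R x) (R x)
    rw [sub_add_cancel] at h2
    linarith [h.bound x, hn1 n]
  have hGm : ∀ n, AEStronglyMeasurable (fun x => G n x - g x) (vol S) := fun n =>
    (hG n).continuous.aestronglyMeasurable.sub hg.1
  have hdGm : ∀ n i, AEStronglyMeasurable (fun x => pderivs (G n) x i - dg i x) (vol S) := fun n i =>
    (((hG n).continuous_fderiv (by simp)).clm_apply
      continuous_const).aestronglyMeasurable.sub (hdg i).1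
  refine ⟨N, hN1, ?_, ?_⟩
  · refine tendsto_of_le_sum_four (a₁ := fun n => ENNReal.ofReal (C + 1) *
      eLpNorm (fun x => G n x - g x) 2 (vol S)) (a₂ := fun n => ENNReal.ofReal (1 / ((n : ℝ) + 1)) *
        eLpNorm g 2 (vol S)) (a₃ := 0) (a₄ := 0) ?_ ?_ tendsto_const_nhds tendsto_const_nhds
        fun n => ?_
    · simpa using ENNReal.Tendsto.const_mul hGg (Or.inr ENNReal.ofReal_ne_top)
    · simpa using ENNReal.Tendsto.mul_const hlim (Or.inr hg.eLpNorm_ne_top)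
    · have := eLpNorm_le_sum_of_norm_le (μ := vol S) (Finset.univ : Finset (Fin 2))
        (f := fun x => G n x • P (N n) x - g x • R x) (u := ![fun x => G n x - g x, g])
        (a := ![C + 1, 1 / ((n : ℝ) + 1)])
        (by intro i _; fin_cases i <;> simp <;> positivity)
        (by intro i _; fin_cases i; exacts [hGm n, hg.1]) (Eventually.of_forall fun x => by
          have e : G n x • P (N n) x - g x • R x =
              (G n x - g x) • P (N n) x + g x • (P (N n) x - R x) := by
            rw [sub_smul, smul_sub]; abel
          rw [e]
          refine (norm_add_le _ _).trans ?_
          simp only [Fin.sum_univ_two, norm_smul, Matrix.cons_val_zero, Matrix.cons_val_one]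
          rw [mul_comm (C + 1), mul_comm (1 / ((n : ℝ) + 1))]
          exact add_le_add (mul_le_mul_of_nonneg_left (hPN n x) (norm_nonneg _))
            (mul_le_mul_of_nonneg_left (hN1 n x) (norm_nonneg _)))
      simpa using this
  · have ht := memLp_toC3 hd hdg
    refine tendsto_of_le_sum_four (a₁ := fun n => ENNReal.ofReal (6 * (C + 1)) *
      ∑ i, eLpNorm (fun x => pderivs (G n) x i - dg i x) 2 (vol S))
      (a₂ := fun n => ENNReal.ofReal (6 * (1 / ((n : ℝ) + 1))) *
        eLpNorm (fun x => toC3 fun i => dg i x) 2 (vol S))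
      (a₃ := fun n => ENNReal.ofReal (1 / ((n : ℝ) + 1)))
      (a₄ := fun n => ENNReal.ofReal |C'| * eLpNorm (fun x => G n x - g x) 2 (vol S)) ?_ ?_ hlim ?_
        fun n => ?_
    · have := tendsto_finsetSum Finset.univ fun i _ => hGdg i
      simpa only [Finset.sum_const_zero, mul_zero] using
        ENNReal.Tendsto.const_mul (a := ENNReal.ofReal (6 * (C + 1))) this
          (Or.inr ENNReal.ofReal_ne_top)
    · have h6 : Tendsto (fun n : ℕ => ENNReal.ofReal (6 * (1 / ((n : ℝ) + 1)))) atTop (𝓝 0) := by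
        have := tendsto_one_div_add_atTop_nhds_zero_nat (𝕜 := ℝ).const_mul 6
        simpa using ENNReal.tendsto_ofReal this
      simpa using ENNReal.Tendsto.mul_const h6 (Or.inr ht.eLpNorm_ne_top)
    · simpa using ENNReal.Tendsto.const_mul hGg (Or.inr ENNReal.ofReal_ne_top)
    · have hcm : AEStronglyMeasurable (fun x => curl (P (N n)) x - m x) (vol S) :=
        (continuous_curl ((h.smooth (N n)).of_le (by simp))).aestronglyMeasurable.sub h.meas
      have htm : AEStronglyMeasurable (fun x => toC3 fun i => pderivs (G n) x i - dg i x) (vol S) :=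
        continuous_toC3.comp_aestronglyMeasurable 
          (aemeasurable_pi_lambda _ fun i => (hdGm n i).aemeasurable).aestronglyMeasurable
      have := eLpNorm_le_sum_of_norm_le (μ := vol S) (Finset.univ : Finset (Fin 4))
        (f := fun x => curl (fun y => G n y • P (N n) y) x - curlProd g dg R m x)
        (u := ![fun x => ‖toC3 fun i => pderivs (G n) x i - dg i x‖,
          fun x => ‖toC3 fun i => dg i x‖, fun x => ‖curl (P (N n)) x - m x‖,
          fun x => ‖G n x - g x‖])
        (a := ![6 * (C + 1), 6 * (1 / ((n : ℝ) + 1)), B n, |C'|])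
        (by
          intro i _
          fin_cases i
          · exact (by positivity : (0 : ℝ) ≤ 6 * (C + 1))
          · exact (by positivity : (0 : ℝ) ≤ 6 * (1 / ((n : ℝ) + 1)))
          · exact (hB0 n).le
          · exact hC')
        (by
          intro i _
          fin_cases i
          exacts [htm.norm, ht.1.norm, hcm.norm, (hGm n).norm])
        (by
          filter_upwards [h.bound_curl, ae_restrict_mem hSm] with x hx hxS
          have hGd : DifferentiableAt ℝ (G n) x := (hG n).differentiable (by simp) x
          have hPd : DifferentiableAt ℝ (P (N n)) x := (h.smooth (N n)).differentiable (by simp) x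
          -- Four errors, matched in order with the four functions of `u`: gradient of `G`, uniform
          -- error of `P`, curl of `P`, and `G` itself. Only the third contains `G n` as a factor,
          -- hence the choice of `N`.
          have e : curl (fun y => G n y • P (N n) y) x - curlProd g dg R m x =
              cross (toC3 fun i => pderivs (G n) x i - dg i x) (P (N n) x) +
              cross (toC3 fun i => dg i x) (P (N n) x - R x) + G n x • (curl (P (N n)) x - m x) +
              (G n x - g x) • m x := by
            rw [curl_smul hGd hPd, curlProd, toC3_sub, cross_sub_left, cross_sub_right, smul_sub,
              sub_smul]
            abel
          rw [e]
          refine (norm_add_le _ _).trans (add_le_add ((norm_add_le _ _).trans (add_le_add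
            ((norm_add_le _ _).trans (add_le_add ?_ ?_)) ?_)) ?_) |>.trans_eq
            (Fin.sum_univ_four _).symm
          · simp only [Matrix.cons_val_zero, norm_norm]
            refine (norm_cross_le _ _).trans ?_
            have := hPN n x
            have h0 := norm_nonneg (toC3 fun i => pderivs (G n) x i - dg i x)
            nlinarith
          · simp only [Matrix.cons_val_one, Matrix.cons_val_zero, norm_norm]
            refine (norm_cross_le _ _).trans ?_
            have := hN1 n x
            calc _ = (6 * ‖toC3 fun i => dg i x‖) * ‖P (N n) x - R x‖ := by ring
              _ ≤ (6 * ‖toC3 fun i => dg i x‖) * (1 / ((n : ℝ) + 1)) := by gcongr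
              _ = _ := by ring
          · simp only [Matrix.cons_val, norm_norm]
            rw [norm_smul]
            exact mul_le_mul_of_nonneg_right (hB n x hxS) (norm_nonneg _)
          · simp only [Matrix.cons_val, norm_norm]
            rw [norm_smul, mul_comm]
            exact mul_le_mul_of_nonneg_right (hx.trans (le_abs_self _)) (norm_nonneg _))
      refine this.trans ?_
      rw [Fin.sum_univ_four]
      simp only [Matrix.cons_val_zero, Matrix.cons_val_one, Matrix.cons_val, eLpNorm_norm]
      gcongr
      · exact eLpNorm_toC3_le hd (hdGm n)
      · exact hN2 n

end RoughCurl

/-! ### Rescaled periodic fields -/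

section Scaling

open scoped Pointwise

variable {d : ℕ}

lemma quasiMeasurePreserving_smul {c : ℝ} (hc : c ≠ 0) :
    Measure.QuasiMeasurePreserving (fun x : E d => c • x) volume volume := by
  refine ⟨measurable_const_smul c, ?_⟩
  rw [Measure.map_addHaar_smul _ hc]
  exact Measure.smul_absolutelyContinuous

/-- A periodic function, rescaled, on a bounded set. -/
lemma exists_eLpNorm_comp_smul_le {S : Set (E d)} (hS : Bornology.IsBounded S) {c : ℝ}
    (hc : c ≠ 0) : ∃ N : ℝ≥0, ∀ f : E d → C3, IsPeriodic f →
      eLpNorm (fun x => f (c • x)) 2 (vol S) ≤ N * eLpNorm f 2 (cellVol d) := by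
  set e : E d ≃ᵐ E d := MeasurableEquiv.smul₀ c hc with he
  have hT : Bornology.IsBounded (c • S) := hS.smul₀ c
  obtain ⟨N, hN⟩ := IsPeriodic.exists_setLIntegral_le hT
  set A : ℝ≥0∞ := ENNReal.ofReal |(c ^ Module.finrank ℝ (E d))⁻¹| * N with hA
  have hAt : A ≠ ⊤ := ENNReal.mul_ne_top ENNReal.ofReal_ne_top ENNReal.coe_ne_top
  have hAt' : A ^ (1 / 2 : ℝ) ≠ ⊤ := ENNReal.rpow_ne_top_of_nonneg (by norm_num) hAt
  refine ⟨(A ^ (1 / 2 : ℝ)).toNNReal, fun f hf => ?_⟩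
  rw [ENNReal.coe_toNNReal hAt', eLpNorm_two_eq, eLpNorm_two_eq,
    ← ENNReal.mul_rpow_of_nonneg _ _ (by norm_num)]
  refine ENNReal.rpow_le_rpow ?_ (by norm_num)
  have hF : IsPeriodic fun y => ‖f y‖ₑ ^ (2 : ℝ) := fun i y => by simp only [hf i y]
  have hpre : e ⁻¹' (c • S) = S := by
    ext x
    simp [he, Set.smul_mem_smul_set_iff₀ hc]
  have h1 : (volume.restrict S).map e = (volume.map e).restrict (c • S) := by
    rw [e.restrict_map, hpre]
  have h2 : volume.map e = ENNReal.ofReal |(c ^ Module.finrank ℝ (E d))⁻¹| • volume :=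
    Measure.map_addHaar_smul volume hc
  calc ∫⁻ x in S, ‖f (c • x)‖ₑ ^ (2 : ℝ) = ∫⁻ y, ‖f y‖ₑ ^ (2 : ℝ) ∂((volume.restrict S).map e) := by
        rw [lintegral_map_equiv]; rfl
    _ = ENNReal.ofReal |(c ^ Module.finrank ℝ (E d))⁻¹| * ∫⁻ y in c • S, ‖f y‖ₑ ^ (2 : ℝ) := by
        rw [h1, h2, Measure.restrict_smul, lintegral_smul_measure, smul_eq_mul]
    _ ≤ ENNReal.ofReal |(c ^ Module.finrank ℝ (E d))⁻¹| *
        (N * ∫⁻ y in cell d, ‖f y‖ₑ ^ (2 : ℝ)) := by gcongr; exact hN _ hF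
    _ = _ := by rw [hA, mul_assoc]

lemma curl_comp_smul (f : E d → C3) (c : ℝ) (x : E d) :
    curl (fun x => f (c • x)) x = c • curl f (c • x) := by
  rw [curl_eq, curl_eq, fderiv_comp_smul]
  ext k
  fin_cases k <;> simp [curlOf, mul_sub]

lemma IsPeriodic.curl {f : E d → C3} (hf : IsPeriodic f) : IsPeriodic (curl f) := by
  intro i y
  have h : pderivs f (y + basisVec d i) = pderivs f y := by
    unfold pderivs
    rw [IsPeriodic.fderiv_apply hf i y]
  rw [PeriodicPotential.curl, h, PeriodicPotential.curl]

/-- The sup bound is invariant under rescaling, while the chain rule multiplies the curl by `ε⁻¹`.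
This factor is one of the two sources of the loss in the normal trace estimate. -/
lemma IsColumnPotential.isRoughField {C C' : ℝ} {m : E d → C3} {W : H1sharp d} {Q : E d → C3}
    {P : ℕ → E d → C3} (hW : IsColumnPotential C m W Q P) (hm : AEStronglyMeasurable m volume)
    (hmp : IsPeriodic m) (hmb : ∀ᵐ y, ‖m y‖ ≤ C') {ε : ℝ} (hε : 0 < ε) {S : Set (E d)}
    (hS : Bornology.IsBounded S) :
    IsRoughField S C (ε⁻¹ * C') (fun x => Q (ε⁻¹ • x)) (fun x => ε⁻¹ • m (ε⁻¹ • x))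
      (fun n x => P n (ε⁻¹ • x)) := by
  have hε' : ε⁻¹ ≠ 0 := (inv_pos.2 hε).ne'
  have hq := quasiMeasurePreserving_smul (d := d) hε'
  refine ⟨hW.contRep.1.comp (continuous_const_smul _), fun x => hW.bound _,
    fun n => (hW.smooth n).1.comp (contDiff_const_smul _), hW.unif.comp _, ?_, ?_, ?_⟩
  · exact ((hm.comp_quasiMeasurePreserving hq).const_smul ε⁻¹).restrict
  · refine ae_restrict_of_ae ?_
    filter_upwards [hq.ae hmb] with x hx
    rw [norm_smul, Real.norm_of_nonneg (inv_pos.2 hε).le]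
    exact mul_le_mul_of_nonneg_left hx (inv_pos.2 hε).le
  -- `N` depends on `ε`, which is harmless: only a limit in `n` at fixed `ε` is taken.
  · obtain ⟨N, hN⟩ := exists_eLpNorm_comp_smul_le hS hε'
    have h0 : Tendsto (fun n => ENNReal.ofReal ε⁻¹ *
        (N * eLpNorm (fun y => PeriodicPotential.curl (P n) y - m y) 2 (cellVol d))) atTop (𝓝 0) := by
      have := ENNReal.Tendsto.const_mul (a := (N : ℝ≥0∞)) hW.curl_tendsto
        (Or.inr ENNReal.coe_ne_top)
      rw [mul_zero] at this
      simpa only [mul_zero] using ENNReal.Tendsto.const_mul (a := ENNReal.ofReal ε⁻¹) this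
        (Or.inr ENNReal.ofReal_ne_top)
    refine tendsto_of_tendsto_of_tendsto_of_le_of_le tendsto_const_nhds h0 (fun _ => zero_le)
      fun n => ?_
    have e : (fun x => PeriodicPotential.curl (fun x => P n (ε⁻¹ • x)) x - ε⁻¹ • m (ε⁻¹ • x)) =
        ε⁻¹ • fun x => (fun y => PeriodicPotential.curl (P n) y - m y) (ε⁻¹ • x) := by
      funext x
      simp only [curl_comp_smul, Pi.smul_apply, smul_sub]
    rw [e, eLpNorm_const_smul, Real.enorm_eq_ofReal (inv_pos.2 hε).le]
    have hp : IsPeriodic fun y => PeriodicPotential.curl (P n) y - m y := fun i y => by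
      simp only [IsPeriodic.curl (hW.smooth n).2 i y, hmp i y]
    have h3 := hN _ hp
    exact mul_le_mul' le_rfl h3

end Scaling

/-! ### Fields that are limits of smooth fields together with their curls -/

section CurlLimit

variable {d : ℕ}

/-- `U`, with curl `c`, is the limit in `L²(S)`, together with its curl, of smooth fields. -/
def IsCurlLimit (S : Set (E d)) (U c : E d → C3) : Prop :=
  ∃ Φ : ℕ → E d → C3, (∀ n, ContDiff ℝ (⊤ : ℕ∞) (Φ n)) ∧
    Tendsto (fun n => eLpNorm (fun x => Φ n x - U x) 2 (vol S)) atTop (𝓝 0) ∧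
    Tendsto (fun n => eLpNorm (fun x => curl (Φ n) x - c x) 2 (vol S)) atTop (𝓝 0)

lemma curl_sum {ι : Type*} (s : Finset ι) {f : ι → E d → C3} {x : E d}
    (hf : ∀ j ∈ s, DifferentiableAt ℝ (f j) x) :
    curl (fun y => ∑ j ∈ s, f j y) x = ∑ j ∈ s, curl (f j) x := by
  simp only [curl_eq]
  rw [fderiv_fun_sum hf]
  ext k
  fin_cases k <;> simp [curlOf]

lemma tendsto_eLpNorm_sum_sub {X V : Type*} [MeasurableSpace X] {μ : Measure X}
    [NormedAddCommGroup V] {ι : Type*} (s : Finset ι) {a : ι → ℕ → X → V} {b : ι → X → V}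
    (ha : ∀ j ∈ s, ∀ n, AEStronglyMeasurable (a j n) μ)
    (hb : ∀ j ∈ s, AEStronglyMeasurable (b j) μ)
    (h : ∀ j ∈ s, Tendsto (fun n => eLpNorm (fun x => a j n x - b j x) 2 μ) atTop (𝓝 0)) :
    Tendsto (fun n => eLpNorm (fun x => ∑ j ∈ s, a j n x - ∑ j ∈ s, b j x) 2 μ) atTop (𝓝 0) := by
  have h1 := tendsto_finsetSum s h
  rw [Finset.sum_const_zero] at h1
  refine tendsto_of_tendsto_of_tendsto_of_le_of_le tendsto_const_nhds h1 (fun _ => zero_le)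
    fun n => ?_
  have e : (fun x => ∑ j ∈ s, a j n x - ∑ j ∈ s, b j x) =
      ∑ j ∈ s, fun x => a j n x - b j x := by
    funext x; simp
  simp only [e]
  exact eLpNorm_sum_le (fun j hj => (ha j hj n).sub (hb j hj)) (by norm_num)

lemma memLp_of_continuous_of_isCompact {V : Type*} [NormedAddCommGroup V] {K : Set (E d)}
    [SecondCountableTopology V]
    (hK : IsCompact K) {f : E d → V} (hf : Continuous f) : MemLp f 2 (vol K) := by
  obtain ⟨B, hB⟩ := hK.exists_bound_of_continuousOn hf.continuousOn
  have : IsFiniteMeasure (vol K) := ⟨by simpa using hK.measure_lt_top⟩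
  exact MemLp.of_bound hf.aestronglyMeasurable B ((ae_restrict_iff' hK.measurableSet).2
    (Eventually.of_forall hB))

lemma setIntegral_eq_of_support {V : Type*} [NormedAddCommGroup V] [NormedSpace ℝ V]
    {K D : Set (E d)} (hKD : K ⊆ D) {f : E d → V} (h : ∀ x ∉ K, f x = 0) :
    ∫ x in D, f x = ∫ x in K, f x := by
  rw [setIntegral_eq_integral_of_forall_compl_eq_zero fun x hx => h x fun hK => hx (hKD hK),
    setIntegral_eq_integral_of_forall_compl_eq_zero h]

lemma curl_eq_zero_of_notMem {ψ : E d → C3} {x : E d} (hx : x ∉ tsupport ψ) : curl ψ x = 0 := by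
  have h : fderiv ℝ ψ x = 0 := by
    by_contra h
    exact hx (tsupport_fderiv_subset ℝ (subset_tsupport _ h))
  rw [curl_eq, h]
  ext k
  fin_cases k <;> simp [curlOf]

/-- A field that is locally a limit of smooth fields and of their curls is in `H(curl)`. -/
lemma IsHcurl.of_isCurlLimit {D : Set (E d)} {U c : E d → C3} (hU : MemLp U 2 (vol D))
    (hc : MemLp c 2 (vol D)) (h : ∀ K, IsCompact K → K ⊆ D → IsCurlLimit K U c) :
    IsHcurl D U c := by
  refine ⟨hU, hc, fun ψ hψ hψs hψD => ?_⟩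
  set K := tsupport ψ with hK
  have hKc : IsCompact K := hψs
  obtain ⟨Φ, hΦ, hΦ1, hΦ2⟩ := h K hKc hψD
  have hle : vol K ≤ vol D := Measure.restrict_mono hψD le_rfl
  have hψ1 : ContDiff ℝ 1 ψ := hψ.of_le (by simp)
  have hΦ' : ∀ n, ContDiff ℝ 1 (Φ n) := fun n => (hΦ n).of_le (by simp)
  have hψc : MemLp (curl ψ) 2 (vol K) := memLp_of_continuous_of_isCompact hKc (continuous_curl hψ1)
  have hψm : MemLp ψ 2 (vol K) := memLp_of_continuous_of_isCompact hKc hψ.continuous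
  have z1 : ∀ x ∉ K, curl ψ x = 0 := fun x hx => curl_eq_zero_of_notMem hx
  have z2 : ∀ x ∉ K, ψ x = 0 := fun x hx => image_eq_zero_of_notMem_tsupport hx
  rw [setIntegral_eq_of_support hψD (fun x hx => by simp [z1 x hx, dot]),
    setIntegral_eq_of_support hψD (fun x hx => by simp [z2 x hx, dot])]
  -- The two sides are limits of the same sequence, by the identity for smooth fields. All integrals
  -- live on the support of `ψ`, where the approximation is available.
  have t1 := tendsto_integral_dot (a := Φ) (b := fun _ => curl ψ)
    (fun n => memLp_of_continuous_of_isCompact hKc (hΦ n).continuous) (fun _ => hψc)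
    (hU.mono_measure hle) hψc hΦ1 (by simp)
  have t2 := tendsto_integral_dot (a := fun n => curl (Φ n)) (b := fun _ => ψ)
    (fun n => memLp_of_continuous_of_isCompact hKc (continuous_curl (hΦ' n))) (fun _ => hψm)
    (hc.mono_measure hle) hψm hΦ2 (by simp)
  refine tendsto_nhds_unique t1 (t2.congr fun n => ?_)
  rw [setIntegral_eq_integral_of_forall_compl_eq_zero (fun x hx => by simp [z2 x hx, dot]),
    setIntegral_eq_integral_of_forall_compl_eq_zero (fun x hx => by simp [z1 x hx, dot]),
    integral_dot_curl (hΦ' n) hψ1 hψs]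

lemma zero_dot (a : C3) : dot 0 a = 0 := by simp [dot]

lemma dot_comm (a b : C3) : dot a b = dot b a := by simp only [dot, mul_comm]

lemma cross_zero_left (a : C3) : cross 0 a = 0 := by
  ext k; fin_cases k <;> simp [cross]

/-- A curl is orthogonal to gradients, locally. -/
lemma integral_dot_curl_mul_eq_zero (hd : d ≤ 3) {D : Set (E d)} (hD : IsOpen D) {U c : E d → C3}
    (hU : MemLp U 2 (vol D)) (hc : MemLp c 2 (vol D))
    (h : ∀ K, IsCompact K → K ⊆ D → IsCurlLimit K U c) {w : E d → ℂ} {dw : Fin d → E d → ℂ}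
    (hw : IsH1 D w dw) {β : E d → ℂ} (hβ : ContDiff ℝ 1 β) (hβs : HasCompactSupport β)
    (hβD : tsupport β ⊆ D) :
    ∫ x in D, dot (cross (toC3 (pderivs β x)) (U x) + β x • c x) (toC3 fun i => dw i x) = 0 := by
  set K := tsupport β with hK
  have hKc : IsCompact K := hβs
  have hle : vol K ≤ vol D := Measure.restrict_mono hβD le_rfl
  obtain ⟨Φ, hΦ, hΦ1, hΦ2⟩ := h K hKc hβD
  obtain ⟨G, hG, -, hG2⟩ := hw.exists_smooth_approx hD hKc hβD
  have hΦ' : ∀ n, ContDiff ℝ 1 (Φ n) := fun n => (hΦ n).of_le (by simp)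
  have z1 : ∀ x ∉ K, β x = 0 := fun x hx => image_eq_zero_of_notMem_tsupport hx
  have z2 : ∀ x ∉ K, toC3 (pderivs β x) = 0 := by
    intro x hx
    have h : fderiv ℝ β x = 0 := by
      by_contra h
      exact hx (tsupport_fderiv_subset ℝ (subset_tsupport _ h))
    ext k
    simp [toC3, ext3_pderivs, h]
  have cβ : Continuous fun x => toC3 (pderivs β x) :=
    continuous_toC3.comp (continuous_pi fun i =>
      (hβ.continuous_fderiv one_ne_zero).clm_apply continuous_const)
  obtain ⟨B₁, hB₁⟩ := hKc.exists_bound_of_continuousOn hβ.continuous.continuousOn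
  obtain ⟨B₂, hB₂⟩ := hKc.exists_bound_of_continuousOn cβ.continuousOn
  have hUK := hU.mono_measure hle
  have hcK := hc.mono_measure hle
  -- Stated for arbitrary `V` and `X` because it serves twice: for integrability of the fields, and
  -- for the differences `Φₙ - U`, `curl Φₙ - c`.
  have hlim : ∀ {V X : E d → C3}, MemLp V 2 (vol K) → MemLp X 2 (vol K) →
      (AEStronglyMeasurable (fun x => cross (toC3 (pderivs β x)) (V x) + β x • X x) (vol K)) ∧
      eLpNorm (fun x => cross (toC3 (pderivs β x)) (V x) + β x • X x) 2 (vol K) ≤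
        ENNReal.ofReal (6 * |B₂|) * eLpNorm V 2 (vol K) +
          ENNReal.ofReal |B₁| * eLpNorm X 2 (vol K) := by
    intro V X hV hX
    refine ⟨(aestronglyMeasurable_cross cβ.aestronglyMeasurable hV.1).add
      (hβ.continuous.aestronglyMeasurable.smul hX.1), ?_⟩
    have := eLpNorm_le_sum_of_norm_le (μ := vol K) (Finset.univ : Finset (Fin 2))
      (f := fun x => cross (toC3 (pderivs β x)) (V x) + β x • X x) (u := ![V, X])
      (a := ![6 * |B₂|, |B₁|])
      (by intro i _; fin_cases i <;> simp) (by intro i _; fin_cases i; exacts [hV.1, hX.1])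
      (by
        filter_upwards [ae_restrict_mem hKc.measurableSet] with x hx
        rw [Fin.sum_univ_two]
        refine (norm_add_le _ _).trans (add_le_add ?_ ?_)
        · refine (norm_cross_le _ _).trans ?_
          simp only [Matrix.cons_val_zero]
          have := (hB₂ x hx).trans (le_abs_self _)
          gcongr
        · simp only [Matrix.cons_val_one, Matrix.cons_val_zero, norm_smul]
          have := (hB₁ x hx).trans (le_abs_self _)
          gcongr)
    simpa [Fin.sum_univ_two] using this
  have hΦm : ∀ n, MemLp (Φ n) 2 (vol K) := fun n =>
    memLp_of_continuous_of_isCompact hKc (hΦ n).continuous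
  have hΦcm : ∀ n, MemLp (curl (Φ n)) 2 (vol K) := fun n =>
    memLp_of_continuous_of_isCompact hKc (continuous_curl (hΦ' n))
  have hfin : ∀ {V X : E d → C3}, MemLp V 2 (vol K) → MemLp X 2 (vol K) →
      MemLp (fun x => cross (toC3 (pderivs β x)) (V x) + β x • X x) 2 (vol K) := fun hV hX =>
    ⟨(hlim hV hX).1, (hlim hV hX).2.trans_lt (ENNReal.add_lt_top.2
      ⟨ENNReal.mul_lt_top ENNReal.ofReal_lt_top hV.2, ENNReal.mul_lt_top ENNReal.ofReal_lt_top hX.2⟩)⟩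
  have hGm : ∀ n i, Continuous fun x => pderivs (G n) x i := fun n i =>
    ((hG n).continuous_fderiv (by simp)).clm_apply continuous_const
  have hdw : ∀ i, MemLp (dw i) 2 (vol K) := fun i => (hw.memLp_deriv i).mono_measure hle
  have t := tendsto_integral_dot (μ := vol K)
    (a := fun n x => cross (toC3 (pderivs β x)) (Φ n x) + β x • curl (Φ n) x)
    (b := fun n x => toC3 (pderivs (G n) x))
    (a₀ := fun x => cross (toC3 (pderivs β x)) (U x) + β x • c x)
    (b₀ := fun x => toC3 fun i => dw i x)
    (fun n => hfin (hΦm n) (hΦcm n))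
    (fun n => memLp_of_continuous_of_isCompact hKc (continuous_toC3.comp (continuous_pi (hGm n))))
    (hfin hUK hcK) (memLp_toC3 hd hdw) ?_ ?_
  · rw [setIntegral_eq_of_support hβD (fun x hx => by rw [z1 x hx, z2 x hx, cross_zero_left, zero_smul, add_zero, zero_dot])]
    refine tendsto_nhds_unique t (tendsto_const_nhds.congr fun n => Eq.symm ?_)
    rw [setIntegral_eq_integral_of_forall_compl_eq_zero
      (fun x hx => by rw [z1 x hx, z2 x hx, cross_zero_left, zero_smul, add_zero, zero_dot])]
    -- The integrand is the curl of the compactly supported field `βΦₙ` paired with a smooth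
    -- gradient. Moving the curl onto the gradient gives zero.
    have e : ∀ x, cross (toC3 (pderivs β x)) (Φ n x) + β x • curl (Φ n) x =
        curl (fun y => β y • Φ n y) x := fun x =>
      (curl_smul (hβ.differentiable one_ne_zero x) ((hΦ' n).differentiable one_ne_zero x)).symm
    have hcs : HasCompactSupport fun y => β y • Φ n y := hβs.smul_right
    have hG' : ContDiff ℝ 1 fun x => toC3 (pderivs (G n) x) :=
      contDiff_toC3_pderivs (n := 1) ((hG n).of_le (by norm_cast))
    have := integral_dot_curl hG' (hβ.smul (hΦ' n)) hcs
    simp only [curl_toC3_pderivs (hG n)] at this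
    simp only [e]
    calc _ = ∫ x, dot (toC3 (pderivs (G n) x)) (curl (β • Φ n) x) :=
          integral_congr_ae (Eventually.of_forall fun x => dot_comm _ _)
      _ = 0 := by simp only [this, zero_dot, integral_zero]
  · have := (ENNReal.Tendsto.const_mul (a := ENNReal.ofReal (6 * |B₂|)) hΦ1
      (Or.inr ENNReal.ofReal_ne_top)).add (ENNReal.Tendsto.const_mul (a := ENNReal.ofReal |B₁|) hΦ2
      (Or.inr ENNReal.ofReal_ne_top))
    simp only [mul_zero, add_zero] at this
    refine tendsto_of_tendsto_of_tendsto_of_le_of_le tendsto_const_nhds this (fun _ => zero_le)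
      fun n => ?_
    refine le_trans (le_of_eq ?_) (hlim ((hΦm n).sub hUK) ((hΦcm n).sub hcK)).2
    congr 1
    funext x
    simp only [Pi.sub_apply, cross_sub_right, smul_sub]
    abel
  · have := tendsto_finsetSum Finset.univ fun i _ => hG2 i
    simp only [Finset.sum_const_zero] at this
    refine tendsto_of_tendsto_of_tendsto_of_le_of_le tendsto_const_nhds this (fun _ => zero_le)
      fun n => ?_
    refine le_trans (le_of_eq ?_) (eLpNorm_toC3_le hd fun i =>
      (hGm n i).aestronglyMeasurable.sub (hdw i).1)
    congr 1
    funext x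
    exact (toC3_sub _ _).symm

end CurlLimit

/-! ### Sums `∑ⱼ gⱼ Rⱼ` of rough fields with Sobolev coefficients: curl and tangential trace. -/

section SumField

variable {d : ℕ}

/-- The field `∑ⱼ gⱼ Rⱼ`. -/
def sumField (g : Fin d → E d → ℂ) (R : Fin d → E d → C3) (x : E d) : C3 := ∑ j, g j x • R j x

/-- The curl of `∑ⱼ gⱼ Rⱼ`. -/
def sumCurl (g : Fin d → E d → ℂ) (h : Fin d → Fin d → E d → ℂ) (R m : Fin d → E d → C3)
    (x : E d) : C3 := ∑ j, curlProd (g j) (h j) (R j) (m j) x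

variable {D : Set (E d)} {g : Fin d → E d → ℂ} {h : Fin d → Fin d → E d → ℂ}
  {R m : Fin d → E d → C3} {P : Fin d → ℕ → E d → C3} {C C' : ℝ}

lemma memLp_sumField (hR : ∀ j, IsRoughField D C C' (R j) (m j) (P j))
    (hg : ∀ j, IsH1 D (g j) (h j)) : MemLp (sumField g R) 2 (vol D) :=
  memLp_finsetSum Finset.univ fun j _ => (hR j).memLp_smul (hg j).memLp

lemma memLp_sumCurl (hd : d ≤ 3) (hR : ∀ j, IsRoughField D C C' (R j) (m j) (P j))
    (hg : ∀ j, IsH1 D (g j) (h j)) : MemLp (sumCurl g h R m) 2 (vol D) :=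
  memLp_finsetSum Finset.univ fun j _ =>
    (hR j).memLp_curlProd hd (hg j).memLp (hg j).memLp_deriv

/-- Diagonal approximations of `∑ⱼ gⱼ Rⱼ`. -/
lemma exists_diagonal_sum (hd : d ≤ 3) {S : Set (E d)} (hS : Bornology.IsBounded S)
    (hSm : MeasurableSet S) (hR : ∀ j, IsRoughField S C C' (R j) (m j) (P j))
    (hg : ∀ j, MemLp (g j) 2 (vol S)) (hh : ∀ j i, MemLp (h j i) 2 (vol S))
    {G : Fin d → ℕ → E d → ℂ} (hG : ∀ j n, ContDiff ℝ (⊤ : ℕ∞) (G j n))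
    (hGg : ∀ j, Tendsto (fun n => eLpNorm (fun x => G j n x - g j x) 2 (vol S)) atTop (𝓝 0))
    (hGh : ∀ j i, Tendsto (fun n => eLpNorm (fun x => pderivs (G j n) x i - h j i x) 2 (vol S))
      atTop (𝓝 0)) :
    ∃ N : Fin d → ℕ → ℕ, (∀ j n x, ‖P j (N j n) x - R j x‖ ≤ 1 / ((n : ℝ) + 1)) ∧
      (∀ n, ContDiff ℝ (⊤ : ℕ∞) fun x => ∑ j, G j n x • P j (N j n) x) ∧
      Tendsto (fun n => eLpNorm (fun x => ∑ j, G j n x • P j (N j n) x - sumField g R x) 2 (vol S))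
        atTop (𝓝 0) ∧
      Tendsto (fun n => eLpNorm (fun x => curl (fun y => ∑ j, G j n y • P j (N j n) y) x -
        sumCurl g h R m x) 2 (vol S)) atTop (𝓝 0) := by
  choose N hN1 hN2 hN3 using fun j =>
    (hR j).exists_diagonal hd hS hSm (hg j) (hh j) (hG j) (hGg j) (hGh j)
  have hsm : ∀ j n, ContDiff ℝ (⊤ : ℕ∞) fun x => G j n x • P j (N j n) x := fun j n =>
    (hG j n).smul ((hR j).smooth _)
  refine ⟨N, hN1, fun n => ContDiff.sum fun j _ => hsm j n, ?_, ?_⟩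
  · exact tendsto_eLpNorm_sum_sub Finset.univ
      (fun j _ n => (hsm j n).continuous.aestronglyMeasurable)
      (fun j _ => ((hR j).memLp_smul (hg j)).1) fun j _ => hN2 j
  · have := tendsto_eLpNorm_sum_sub Finset.univ
      (a := fun j n => curl fun x => G j n x • P j (N j n) x)
      (fun j _ n => (continuous_curl ((hsm j n).of_le (by simp))).aestronglyMeasurable)
      (fun j _ => ((hR j).memLp_curlProd hd (hg j) (hh j)).1) fun j _ => hN3 j
    refine this.congr fun n => ?_
    congr 1
    funext x
    rw [curl_sum _ fun j _ => (hsm j n).differentiable (by simp) x, sumCurl]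

/-- Restricted to compact subsets of `D`, since Friedrichs mollification of `gⱼ` is controlled only
there. This suffices to identify the weak curl. -/
lemma isCurlLimit_sumField (hd : d ≤ 3) (hD : IsOpen D)
    (hR : ∀ j, IsRoughField D C C' (R j) (m j) (P j)) (hg : ∀ j, IsH1 D (g j) (h j)) (K : Set (E d))
    (hK : IsCompact K) (hKD : K ⊆ D) : IsCurlLimit K (sumField g R) (sumCurl g h R m) := by
  choose G hG hG1 hG2 using fun j => (hg j).exists_smooth_approx hD hK hKD
  have hle : vol K ≤ vol D := Measure.restrict_mono hKD le_rfl
  obtain ⟨N, -, h1, h2, h3⟩ := exists_diagonal_sum hd hK.isBounded hK.measurableSet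
    (fun j => (hR j).mono hKD) (fun j => (hg j).memLp.mono_measure hle)
    (fun j i => ((hg j).memLp_deriv i).mono_measure hle) hG hG1 hG2
  exact ⟨_, h1, h2, h3⟩

lemma isHcurl_sumField (hd : d ≤ 3) (hD : IsOpen D)
    (hR : ∀ j, IsRoughField D C C' (R j) (m j) (P j)) (hg : ∀ j, IsH1 D (g j) (h j)) :
    IsHcurl D (sumField g R) (sumCurl g h R m) :=
  IsHcurl.of_isCurlLimit (memLp_sumField hR hg) (memLp_sumCurl hd hR hg)
    (isCurlLimit_sumField hd hD hR hg)

lemma h1Norm_eq (D : Set (E d)) (u : E d → ℂ) (g : Fin d → E d → ℂ) :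
    h1Norm D u g ^ 2 = eLpNorm u 2 (vol D) ^ 2 + ∑ i, eLpNorm (g i) 2 (vol D) ^ 2 := by
  rw [h1Norm, ← ENNReal.rpow_natCast, ← ENNReal.rpow_mul]
  norm_num

lemma eLpNorm_le_h1Norm (D : Set (E d)) (u : E d → ℂ) (g : Fin d → E d → ℂ) :
    eLpNorm u 2 (vol D) ≤ h1Norm D u g := by
  rw [← ENNReal.pow_le_pow_left_iff two_ne_zero, h1Norm_eq]
  exact le_self_add

lemma eLpNorm_deriv_le_h1Norm (D : Set (E d)) (u : E d → ℂ) (g : Fin d → E d → ℂ) (i : Fin d) :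
    eLpNorm (g i) 2 (vol D) ≤ h1Norm D u g := by
  rw [← ENNReal.pow_le_pow_left_iff two_ne_zero, h1Norm_eq]
  exact (Finset.single_le_sum (f := fun i => eLpNorm (g i) 2 (vol D) ^ 2) (fun _ _ => zero_le)
    (Finset.mem_univ i)).trans le_add_self

lemma cross_add_left (a b c : C3) : cross (a + b) c = cross a c + cross b c := by
  ext k; fin_cases k <;> simp [cross] <;> ring

lemma cross_sum_left {ι : Type*} (s : Finset ι) (a : ι → C3) (b : C3) :
    cross (∑ j ∈ s, a j) b = ∑ j ∈ s, cross (a j) b := by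
  classical
  induction s using Finset.induction_on with
  | empty => simp [cross_zero_left]
  | insert j s hj ih => rw [Finset.sum_insert hj, Finset.sum_insert hj, cross_add_left, ih]

/-- The trace is `∑ⱼ γⱼ Rⱼ × ν`. The smooth functions witnessing `γⱼ` converge both in `H¹(D)` and
in `L²(Γ)`, and `P j n` converges to `Rⱼ` uniformly on the whole space, so a single diagonal
sequence converges in `H(curl)` and on the boundary. -/
lemma exists_isTangentialTrace (hd : d ≤ 3) (hD : IsOpen D) (hDb : Bornology.IsBounded D)
    (hR : ∀ j, IsRoughField D C C' (R j) (m j) (P j)) (hC : 0 ≤ C)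
    (hg : ∀ j, IsH1 D (g j) (h j))
    (hν : AEStronglyMeasurable (nu D) (surf D)) (hν1 : ∀ x, ‖nu D x‖ ≤ 1) {γ : Fin d → E d → ℂ}
    (hγ : ∀ j, IsTrace D (g j) (h j) (γ j)) :
    ∃ τ, IsTangentialTrace D (sumField g R) (sumCurl g h R m) τ ∧
      eLpNorm τ 2 (surf D) ≤ ENNReal.ofReal (6 * C) * ∑ j, eLpNorm (γ j) 2 (surf D) := by
  have hRν : ∀ j x, ‖cross (R j x) (nu D x)‖ ≤ 6 * C := fun j x => by
    refine (norm_cross_le _ _).trans ?_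
    have h1 := (hR j).bound x
    have h2 := hν1 x
    calc 6 * ‖R j x‖ * ‖nu D x‖ ≤ 6 * C * 1 := by gcongr
      _ = 6 * C := mul_one _
  have hRm : ∀ j, AEStronglyMeasurable (fun x => cross (R j x) (nu D x)) (surf D) := fun j =>
    aestronglyMeasurable_cross (hR j).cont.aestronglyMeasurable hν
  choose hH1 hγm φ hφ hφ1 hφ2 using hγ
  have hbm : ∀ j, AEStronglyMeasurable (fun x => γ j x • cross (R j x) (nu D x)) (surf D) :=
    fun j => (hγm j).1.smul (hRm j)
  have hbound : eLpNorm (fun x => ∑ j, γ j x • cross (R j x) (nu D x)) 2 (surf D) ≤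
      ENNReal.ofReal (6 * C) * ∑ j, eLpNorm (γ j) 2 (surf D) := by
    rw [Finset.mul_sum]
    refine eLpNorm_le_sum_of_norm_le _ (fun _ _ => by positivity) (fun j _ => (hγm j).1)
      (Eventually.of_forall fun x => (norm_sum_le _ _).trans (Finset.sum_le_sum fun j _ => ?_))
    rw [norm_smul, mul_comm]
    exact mul_le_mul_of_nonneg_right (hRν j x) (norm_nonneg _)
  -- Here the diagonal argument runs on all of `D`: the approximations provided by the trace
  -- converge up to the boundary, unlike the mollified ones.
  obtain ⟨N, hN, h1, h2, h3⟩ := exists_diagonal_sum hd hDb hD.measurableSet hR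
    (fun j => (hg j).memLp) (fun j => (hg j).memLp_deriv) hφ
    (fun j => tendsto_of_tendsto_of_tendsto_of_le_of_le tendsto_const_nhds (hφ1 j)
      (fun _ => zero_le) fun n => eLpNorm_le_h1Norm D (φ j n - g j) _)
    (fun j i => tendsto_of_tendsto_of_tendsto_of_le_of_le tendsto_const_nhds (hφ1 j)
      (fun _ => zero_le) fun n => eLpNorm_deriv_le_h1Norm D (φ j n - g j)
        (fun i x => pderivs (φ j n) x i - h j i x) i)
  refine ⟨fun x => ∑ j, γ j x • cross (R j x) (nu D x),
    ⟨isHcurl_sumField hd hD hR hg, ⟨Finset.aestronglyMeasurable_fun_sum _ fun j _ => hbm j, ?_⟩,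
      _, h1, h2, h3, ?_⟩, hbound⟩
  · exact hbound.trans_lt (ENNReal.mul_lt_top ENNReal.ofReal_lt_top
      (ENNReal.sum_lt_top.2 fun j _ => (hγm j).2))
  have hlim : Tendsto (fun n : ℕ => ENNReal.ofReal (6 * (1 / ((n : ℝ) + 1)))) atTop (𝓝 0) := by
    have := tendsto_one_div_add_atTop_nhds_zero_nat (𝕜 := ℝ).const_mul 6
    simpa using ENNReal.tendsto_ofReal this
  have key : ∀ j, Tendsto (fun n => eLpNorm (fun x =>
      cross (φ j n x • P j (N j n) x) (nu D x) - γ j x • cross (R j x) (nu D x)) 2 (surf D))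
      atTop (𝓝 0) := by
    intro j
    refine tendsto_of_le_sum_four (a₁ := fun n => ENNReal.ofReal (6 * (C + 1)) *
      eLpNorm (φ j n - γ j) 2 (surf D)) (a₂ := fun n => ENNReal.ofReal (6 * (1 / ((n : ℝ) + 1))) *
        eLpNorm (γ j) 2 (surf D)) (a₃ := 0) (a₄ := 0) ?_ ?_ tendsto_const_nhds tendsto_const_nhds
        fun n => ?_
    · simpa only [mul_zero] using ENNReal.Tendsto.const_mul (a := ENNReal.ofReal (6 * (C + 1)))
        (hφ2 j) (Or.inr ENNReal.ofReal_ne_top)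
    · simpa only [zero_mul] using ENNReal.Tendsto.mul_const hlim (Or.inr (hγm j).eLpNorm_ne_top)
    · have hn1 : 1 / ((n : ℝ) + 1) ≤ 1 := by
        rw [div_le_one (by positivity)]; linarith [Nat.cast_nonneg (α := ℝ) n]
      have := eLpNorm_le_sum_of_norm_le (μ := surf D) (Finset.univ : Finset (Fin 2))
        (f := fun x => cross (φ j n x • P j (N j n) x) (nu D x) - γ j x • cross (R j x) (nu D x))
        (u := ![φ j n - γ j, γ j]) (a := ![6 * (C + 1), 6 * (1 / ((n : ℝ) + 1))])
        (by
          intro i _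
          fin_cases i
          exacts [(by positivity : (0 : ℝ) ≤ 6 * (C + 1)),
            (by positivity : (0 : ℝ) ≤ 6 * (1 / ((n : ℝ) + 1)))])
        (by
          intro i _
          fin_cases i
          exacts [(hφ j n).continuous.aestronglyMeasurable.sub (hγm j).1, (hγm j).1])
        (Eventually.of_forall fun x => by
          have e : cross (φ j n x • P j (N j n) x) (nu D x) - γ j x • cross (R j x) (nu D x) =
              (φ j n x - γ j x) • cross (P j (N j n) x) (nu D x) +
                γ j x • cross (P j (N j n) x - R j x) (nu D x) := by
            rw [cross_smul_left, cross_sub_left, sub_smul, smul_sub]; abel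
          have hP : ‖P j (N j n) x‖ ≤ C + 1 := by
            have h2 := norm_add_le (P j (N j n) x - R j x) (R j x)
            rw [sub_add_cancel] at h2
            linarith [(hR j).bound x, hN j n x]
          have b1 : ‖cross (P j (N j n) x) (nu D x)‖ ≤ 6 * (C + 1) := by
            refine (norm_cross_le _ _).trans ?_
            have h2 := hν1 x
            calc _ ≤ 6 * (C + 1) * 1 := by gcongr
              _ = _ := mul_one _
          have b2 : ‖cross (P j (N j n) x - R j x) (nu D x)‖ ≤ 6 * (1 / ((n : ℝ) + 1)) := by
            refine (norm_cross_le _ _).trans ?_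
            have h2 := hν1 x
            have h3 := hN j n x
            calc _ ≤ 6 * (1 / ((n : ℝ) + 1)) * 1 := by gcongr
              _ = _ := mul_one _
          rw [e, Fin.sum_univ_two]
          refine (norm_add_le _ _).trans (add_le_add ?_ ?_)
          · rw [norm_smul, mul_comm]
            exact mul_le_mul_of_nonneg_right b1 (norm_nonneg _)
          · rw [norm_smul, mul_comm]
            exact mul_le_mul_of_nonneg_right b2 (norm_nonneg _))
      rw [Fin.sum_univ_two] at this
      simpa only [Matrix.cons_val_zero, Matrix.cons_val_one, Pi.zero_apply, add_zero] using this
  have := tendsto_eLpNorm_sum_sub Finset.univ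
    (fun j _ n => aestronglyMeasurable_cross
      ((hφ j n).continuous.smul ((hR j).smooth (N j n)).continuous).aestronglyMeasurable hν)
    (fun j _ => hbm j) fun j _ => key j
  refine this.congr fun n => ?_
  congr 1
  funext x
  rw [cross_sum_left]
  rfl

end SumField

/-! ### Local charts and the outward normal -/

section Normal

variable {d : ℕ} {D : Set (E d)}

/-- A local chart of `D` around `x`: `D` is locally `{F > 0}`, with `F` decreasing at unit speed in
the direction `e`. -/
structure IsChart (D : Set (E d)) (x : E d) (r : ℝ) (e : E d) (F : E d → ℝ) : Prop where
  pos : 0 < r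
  contDiff : ContDiff ℝ 1 F
  translate : ∀ y t, F (y + t • e) = F y - t
  mem_iff : ∀ y ∈ Metric.ball x r, (y ∈ D ↔ 0 < F y)

/-- Takes `F y = γ y - ⟨e, y⟩`, the height below the graph. Only the `C¹` part of the regularity is
retained. -/
lemma IsC11Domain.exists_chart (hD : IsC11Domain D) {x : E d} (hx : x ∈ frontier D) :
    ∃ r e F, IsChart D x r e F := by
  obtain ⟨e, γ, he, hγ, -, hinv, U, hU, hUD⟩ := hD.2.2 x hx
  obtain ⟨r, hr, hrU⟩ := Metric.mem_nhds_iff.1 hU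
  refine ⟨r, e, fun y => γ y - inner ℝ e y, hr, hγ.sub (contDiff_const.inner ℝ contDiff_id),
    fun y t => ?_, fun y hy => ?_⟩
  · simp only [hinv, inner_add_right, inner_smul_right, real_inner_self_eq_norm_sq, he]
    ring
  · rw [hUD y (hrU hy), sub_pos]

lemma IsChart.fderiv_apply {x e : E d} {r : ℝ} {F : E d → ℝ} (h : IsChart D x r e F) (y : E d) :
    fderiv ℝ F y e = -1 := by
  have h1 : HasDerivAt (fun t : ℝ => F (y + t • e)) (fderiv ℝ F y e) 0 := by
    have h2 : HasDerivAt (fun t : ℝ => y + t • e) e 0 := by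
      simpa using ((hasDerivAt_id (0 : ℝ)).smul_const e).const_add y
    have h3 : HasFDerivAt F (fderiv ℝ F y) (y + (0 : ℝ) • e) := by
      rw [zero_smul, add_zero]
      exact (h.contDiff.differentiable one_ne_zero y).hasFDerivAt
    exact h3.comp_hasDerivAt (0 : ℝ) h2
  have h4 : HasDerivAt (fun t : ℝ => F (y + t • e)) (-1) 0 := by
    simp only [h.translate]
    simpa using (hasDerivAt_id (0 : ℝ)).const_sub (F y)
  exact h1.unique h4

/-- A positive value would put the boundary point inside the open set `D`; a negative one would keep
a whole neighbourhood outside. -/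
lemma IsChart.eq_zero (hD : IsOpen D) {x e : E d} {r : ℝ} {F : E d → ℝ} (h : IsChart D x r e F)
    {z : E d} (hz : z ∈ frontier D) (hzr : z ∈ Metric.ball x r) : F z = 0 := by
  rw [hD.frontier_eq] at hz
  have h1 : F z ≤ 0 := not_lt.1 fun h0 => hz.2 ((h.mem_iff z hzr).2 h0)
  refine h1.antisymm (not_lt.1 fun h0 => ?_)
  have h2 : ∀ᶠ y in 𝓝 z, F y < 0 := h.contDiff.continuous.continuousAt.eventually_lt_const h0
  have h3 := h2.and (Metric.isOpen_ball.mem_nhds hzr)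
  obtain ⟨y, hyD, hy1, hy2⟩ := ((mem_closure_iff_frequently.1 hz.1).and_eventually h3).exists
  exact absurd ((h.mem_iff y hy2).1 hyD) (not_lt.2 hy1.le)

/-- If `n ≠ n'`, the direction `n' - n` has inner product `-a` with `n` and `a` with `n'`, where `a
= 1 - ⟨n, n'⟩ > 0`. A short step from `x` in that direction would be inside `D` for one normal and
outside for the other. -/
lemma IsOutwardNormal.unique {x n n' : E d} (h : IsOutwardNormal D x n)
    (h' : IsOutwardNormal D x n') : n = n' := by
  by_contra hne
  set v := n' - n with hv
  have hv0 : 0 < ‖v‖ := norm_pos_iff.2 (sub_ne_zero.2 (Ne.symm hne))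
  set a : ℝ := 1 - inner ℝ n n' with ha
  have ha0 : 0 < a := by
    have h1 : ‖v‖ ^ 2 = 2 * a := by
      rw [hv, norm_sub_sq_real, h.1, h'.1, real_inner_comm, ha]; ring
    nlinarith
  have e1 : inner ℝ v n = -a := by
    rw [hv, inner_sub_left, real_inner_self_eq_norm_sq, h.1, real_inner_comm, ha]; ring
  have e2 : inner ℝ v n' = a := by
    rw [hv, inner_sub_left, real_inner_self_eq_norm_sq, h'.1, ha]; ring
  set η := a / (2 * ‖v‖) with hη
  have hη0 : 0 < η := by positivity
  obtain ⟨δ, hδ, H⟩ := h.2 η hη0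
  obtain ⟨δ', hδ', H'⟩ := h'.2 η hη0
  set t := min δ δ' / (2 * ‖v‖) with ht
  have ht0 : 0 < t := by positivity
  have hn : ‖x + t • v - x‖ = min δ δ' / 2 := by
    rw [add_sub_cancel_left, norm_smul, Real.norm_of_nonneg ht0.le, ht]; field_simp
  have hm : 0 < min δ δ' := lt_min hδ hδ'
  have hηt : η * ‖x + t • v - x‖ = t * a / 2 := by rw [hn, hη, ht]; field_simp
  have hta : 0 < t * a := mul_pos ht0 ha0
  have i1 := (H (x + t • v) (by rw [hn]; linarith [min_le_left δ δ'])).1 (by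
    rw [neg_mul, hηt, add_sub_cancel_left, inner_smul_left, e1]
    simp only [conj_trivial]
    linarith)
  exact (H' (x + t • v) (by rw [hn]; linarith [min_le_right δ δ'])).2 (by
    rw [hηt, add_sub_cancel_left, inner_smul_left, e2]
    simp only [conj_trivial]
    linarith) i1

/-- The opposite of the gradient of `F`. -/
def negGrad (F : E d → ℝ) (x : E d) : E d := -gradient F x

lemma inner_negGrad (F : E d → ℝ) (x v : E d) : inner ℝ (negGrad F x) v = -fderiv ℝ F x v := by
  rw [negGrad, inner_neg_left, gradient, InnerProductSpace.toDual_symm_apply]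

/-- First-order expansion: the remainder is at most `η‖∇F‖‖y - x‖` near `x`, so it cannot change the
sign of `F` in a cone of opening parameter `η`. -/
lemma isOutwardNormal_of_fun {F : E d → ℝ} {x : E d} (hF : DifferentiableAt ℝ F x) (hx : F x = 0)
    (hv : negGrad F x ≠ 0) (hD : ∀ᶠ y in 𝓝 x, (y ∈ D ↔ 0 < F y)) :
    IsOutwardNormal D x (‖negGrad F x‖⁻¹ • negGrad F x) := by
  set v := negGrad F x with hvdef
  have hv0 : 0 < ‖v‖ := norm_pos_iff.2 hv
  refine ⟨by rw [norm_smul, norm_inv, norm_norm, inv_mul_cancel₀ hv0.ne'], fun η hη => ?_⟩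
  have h1 := (hF.hasFDerivAt.isLittleO).bound (mul_pos hη hv0)
  obtain ⟨δ, hδ, H⟩ := Metric.eventually_nhds_iff.1 (h1.and hD)
  refine ⟨δ, hδ, fun y hy => ?_⟩
  obtain ⟨H1, H2⟩ := H (by rwa [dist_eq_norm])
  have e : fderiv ℝ F x (y - x) = -(‖v‖ * inner ℝ (y - x) (‖v‖⁻¹ • v)) := by
    rw [inner_smul_right, ← mul_assoc, mul_inv_cancel₀ hv0.ne', one_mul, real_inner_comm,
      inner_negGrad, neg_neg]
  rw [hx, sub_zero, e, sub_neg_eq_add, Real.norm_eq_abs, abs_le] at H1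
  constructor
  · intro h3
    rw [H2]
    nlinarith [mul_lt_mul_of_pos_left h3 hv0]
  · intro h3
    rw [H2, not_lt]
    nlinarith [mul_lt_mul_of_pos_left h3 hv0]

lemma outwardNormal_eq {x n : E d} (h : IsOutwardNormal D x n) : outwardNormal D x = n := by
  have hex : ∃ n, IsOutwardNormal D x n := ⟨n, h⟩
  rw [outwardNormal, dif_pos hex]
  exact hex.choose_spec.unique h

lemma norm_outwardNormal_le (D : Set (E d)) (x : E d) : ‖outwardNormal D x‖ ≤ 1 := by
  rw [outwardNormal]
  split_ifs with h
  · exact h.choose_spec.1.le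
  · simp

/-- In a chart the normal is the normalized opposite gradient of `F`, which is continuous. Its
purpose is the measurability of `ν` for surface measure. -/
lemma continuousOn_outwardNormal (hD : IsC11Domain D) :
    ContinuousOn (outwardNormal D) (frontier D) := by
  intro x hx
  obtain ⟨r, e, F, h⟩ := hD.exists_chart hx
  -- The derivative of `F` along `e` is `-1`, so the gradient never vanishes.
  have hv : ∀ z, negGrad F z ≠ 0 := fun z h0 => by
    have h1 := inner_negGrad F z e
    rw [h0, inner_zero_left, h.fderiv_apply] at h1
    norm_num at h1
  have hc : Continuous (negGrad F) :=
    ((InnerProductSpace.toDual ℝ (E d)).symm.continuous.comp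
      (h.contDiff.continuous_fderiv one_ne_zero)).neg
  have hc' : Continuous fun z => ‖negGrad F z‖⁻¹ • negGrad F z :=
    (hc.norm.inv₀ fun z => norm_ne_zero_iff.2 (hv z)).smul hc
  refine hc'.continuousAt.continuousWithinAt.congr_of_eventuallyEq_of_mem ?_ hx
  have hb : ∀ᶠ z in 𝓝[frontier D] x, z ∈ Metric.ball x r :=
    nhdsWithin_le_nhds (Metric.ball_mem_nhds x h.pos)
  filter_upwards [hb, self_mem_nhdsWithin] with z hz1 hz2
  refine outwardNormal_eq (isOutwardNormal_of_fun (h.contDiff.differentiable one_ne_zero z)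
    (h.eq_zero hD.1 hz2 hz1) (hv z) ?_)
  filter_upwards [Metric.isOpen_ball.mem_nhds hz1] with y hy using h.mem_iff y hy

lemma aestronglyMeasurable_nu (hD : IsC11Domain D) : AEStronglyMeasurable (nu D) (surf D) := by
  have h1 : AEStronglyMeasurable (outwardNormal D) (surf D) :=
    (continuousOn_outwardNormal hD).aestronglyMeasurable isClosed_frontier.measurableSet
  have hc : Continuous fun v : E d => toC3 fun i => ((v i : ℝ) : ℂ) :=
    continuous_toC3.comp (by fun_prop)
  exact hc.comp_aestronglyMeasurable h1

lemma norm_nu_le (hd : d ≤ 3) (D : Set (E d)) (x : E d) : ‖nu D x‖ ≤ 1 := by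
  refine le_trans (le_of_eq ?_) (norm_outwardNormal_le D x)
  rw [nu, norm_toC3 hd, EuclideanSpace.norm_eq, EuclideanSpace.norm_eq]
  simp

end Normal

/-! ### Sobolev functions in thin strips along the boundary -/

section Strip

variable {d : ℕ} {D : Set (E d)}

/-- `Θ` is the primitive of a continuous bump `k` equal to one on `[2η, δ]` and supported in `[η,
2δ]`. The bound `2δ` on `Θ` yields the small factor of the strip estimate, and vanishing below `η`
keeps the argument away from the boundary, where Sobolev functions can be mollified. -/
lemma exists_ramp {η δ : ℝ} (hη : 0 < η) (hηδ : η ≤ δ) : ∃ Θ k : ℝ → ℝ,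
    (∀ t, HasDerivAt Θ (k t) t) ∧ Continuous k ∧ (∀ t, 0 ≤ k t) ∧
      (∀ t, 2 * η ≤ t → t ≤ δ → 1 ≤ k t) ∧ (∀ t ≤ η, Θ t = 0) ∧ ∀ t, |Θ t| ≤ 2 * δ := by
  have hδ : 0 < δ := hη.trans_le hηδ
  set k : ℝ → ℝ := fun t => max 0 (min 1 ((t - η) / η)) * max 0 (min 1 (2 - t / δ)) with hk
  have hkc : Continuous k := by fun_prop
  have hk0 : ∀ t, 0 ≤ k t := fun t => mul_nonneg (le_max_left _ _) (le_max_left _ _)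
  have hk1 : ∀ t, ‖k t‖ ≤ 1 := fun t => by
    rw [Real.norm_of_nonneg (hk0 t)]
    exact mul_le_one₀ (max_le zero_le_one (min_le_left _ _)) (le_max_left _ _)
      (max_le zero_le_one (min_le_left _ _))
  have hkη : ∀ t ≤ η, k t = 0 := fun t ht => by
    have : (t - η) / η ≤ 0 := div_nonpos_of_nonpos_of_nonneg (by linarith) hη.le
    simp only [hk, max_eq_left ((min_le_right 1 _).trans this), zero_mul]
  have hkδ : ∀ t, 2 * δ ≤ t → k t = 0 := fun t ht => by
    have : 2 - t / δ ≤ 0 := by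
      rw [sub_nonpos, le_div_iff₀ hδ]; exact ht
    simp only [hk, max_eq_left ((min_le_right 1 _).trans this), mul_zero]
  have hint : ∀ a b, IntervalIntegrable k volume a b := fun a b => hkc.intervalIntegrable a b
  have hb : ∀ t, η ≤ t → t ≤ 2 * δ → |∫ s in η..t, k s| ≤ 2 * δ := fun t h1 h2 => by
    have := intervalIntegral.norm_integral_le_of_norm_le_const (a := η) (b := t) (f := k) (C := 1)
      fun x _ => hk1 x
    rw [Real.norm_eq_abs, one_mul, abs_of_nonneg (sub_nonneg.2 h1)] at this
    linarith
  have hz : ∀ t ≤ η, ∫ s in η..t, k s = 0 := fun t ht => by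
    rw [intervalIntegral.integral_congr (g := fun _ => 0) fun x hx => hkη x (by
      rw [Set.uIcc_of_ge ht] at hx; exact hx.2)]
    simp
  refine ⟨fun t => ∫ s in η..t, k s, k, fun t => (hkc.integral_hasStrictDerivAt η t).hasDerivAt, hkc,
    hk0, fun t h1 h2 => ?_, hz, fun t => ?_⟩
  · have e1 : 1 ≤ (t - η) / η := by rw [le_div_iff₀ hη]; linarith
    have e2 : 1 ≤ 2 - t / δ := by
      have : t / δ ≤ 1 := (div_le_one hδ).2 h2
      linarith
    simp only [hk, min_eq_left e1, min_eq_left e2]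
    norm_num
  · rcases le_total t η with h | h
    · simp only [hz t h, abs_zero]; positivity
    rcases le_total t (2 * δ) with h2 | h2
    · exact hb t h h2
    · have e : ∫ s in (2 * δ)..t, k s = 0 := by
        rw [intervalIntegral.integral_congr (g := fun _ => 0) fun x hx => hkδ x (by
          rw [Set.uIcc_of_le h2] at hx; exact hx.1)]
        simp
      have := intervalIntegral.integral_add_adjacent_intervals (hint η (2 * δ)) (hint (2 * δ) t)
      simp only [← this, e, add_zero]
      exact hb _ (by linarith) le_rfl

lemma integral_fderiv_eq_zero_of_hasCompactSupport {H : E d → ℝ} (hH : ContDiff ℝ 1 H)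
    (hs : HasCompactSupport H) (v : E d) : ∫ x, fderiv ℝ H x v = 0 := by
  have h1 : Integrable (fun x => fderiv ℝ H x v) volume :=
    ((hH.continuous_fderiv one_ne_zero).clm_apply
      continuous_const).integrable_of_hasCompactSupport (hs.fderiv_apply ℝ v)
  have := integral_mul_fderiv_eq_neg_fderiv_mul_of_integrable (μ := volume) (f := fun _ : E d => (1 : ℝ))
    (g := H) (v := v) (by simp) (by simpa using h1)
    (by simpa using hH.continuous.integrable_of_hasCompactSupport hs)
    (fun x _ => differentiableAt_const _) (fun x _ => hH.differentiable one_ne_zero x)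
  simpa using this

/-- The integral of `∂_e (Θ(F) χ |G|²)` is zero. Since `∂_e F = -1`, this equates the integral of
`k(F) χ |G|²`, which dominates `|G|²` on the strip, with that of `Θ(F) ∂_e (χ |G|²)`, where `|Θ| ≤
2δ`. The constant `4Aδ` is `2δ` times the factor 2 from differentiating the square, times the bound
`A` on `χ` and its derivative. -/
lemma IsChart.setLIntegral_le_of_contDiff {x₀ e : E d} {r : ℝ} {F : E d → ℝ}
    (h : IsChart D x₀ r e F) {χ : E d → ℝ} (hχ : ContDiff ℝ 1 χ) (hχs : HasCompactSupport χ)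
    (hχ0 : ∀ x, 0 ≤ χ x) {A : ℝ} (hA : ∀ x, χ x ≤ A) (hA' : ∀ x, |fderiv ℝ χ x e| ≤ A)
    {B : Set (E d)} (hB : MeasurableSet B) (hχB : ∀ x ∈ B, χ x = 1) {η δ : ℝ} (hη : 0 < η)
    (hηδ : η ≤ δ) {G : E d → ℂ} (hG : ContDiff ℝ 1 G) :
    ∫⁻ x in B ∩ {x | 2 * η ≤ F x ∧ F x ≤ δ}, ‖G x‖ₑ ^ 2 ≤
      ENNReal.ofReal (4 * A * δ) * ((∫⁻ x in tsupport χ ∩ {x | η ≤ F x}, ‖G x‖ₑ ^ 2) +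
        ∫⁻ x in tsupport χ ∩ {x | η ≤ F x}, ‖G x‖ₑ * ‖fderiv ℝ G x e‖ₑ) := by
  have hδ : 0 < δ := hη.trans_le hηδ
  have hA0 : 0 ≤ A := (hχ0 0).trans (hA 0)
  obtain ⟨Θ, k, hΘ, hkc, hk0, hk1, hΘ0, hΘb⟩ := exists_ramp hη hηδ
  have hΘC : ContDiff ℝ 1 Θ := by
    refine contDiff_one_iff_deriv.2 ⟨fun t => (hΘ t).differentiableAt, ?_⟩
    rwa [show deriv Θ = k from funext fun t => (hΘ t).deriv]
  set H : E d → ℝ := fun x => Θ (F x) * (χ x * ‖G x‖ ^ 2) with hH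
  have hGn : ContDiff ℝ 1 fun x => ‖G x‖ ^ 2 := hG.norm_sq ℝ
  have hHC : ContDiff ℝ 1 H := (hΘC.comp h.contDiff).mul (hχ.mul hGn)
  have hχs' : HasCompactSupport fun x => χ x * ‖G x‖ ^ 2 := hχs.mul_right
  have hHs : HasCompactSupport H := hχs'.mul_left
  set P : E d → ℝ := fun x => k (F x) * (χ x * ‖G x‖ ^ 2) with hP
  set W : E d → ℝ := fun x => Θ (F x) * (fderiv ℝ χ x e * ‖G x‖ ^ 2 +
    χ x * (2 * inner ℝ (G x) (fderiv ℝ G x e))) with hW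
  have hder : ∀ x, fderiv ℝ H x e = -P x + W x := by
    intro x
    have d1 := (hΘ (F x)).comp_hasFDerivAt x (h.contDiff.differentiable one_ne_zero x).hasFDerivAt
    have d2 := (hχ.differentiable one_ne_zero x).hasFDerivAt
    have d3 := (hG.differentiable one_ne_zero x).hasFDerivAt.norm_sq
    have d4 := (d1.mul (d2.mul d3)).fderiv
    have d5 : fderiv ℝ H x = _ := d4
    rw [d5]
    simp only [hP, hW, add_apply, smul_apply, Pi.mul_apply, smul_eq_mul,
      h.fderiv_apply, Function.comp, ContinuousLinearMap.comp_apply, innerSL_apply_apply, nsmul_eq_mul]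
    push_cast
    ring
  have hPi : Integrable P volume := by
    refine Continuous.integrable_of_hasCompactSupport ?_ hχs'.mul_left
    exact (hkc.comp h.contDiff.continuous).mul (hχ.continuous.mul hGn.continuous)
  have hHi : Integrable (fun x => fderiv ℝ H x e) volume :=
    ((hHC.continuous_fderiv one_ne_zero).clm_apply
      continuous_const).integrable_of_hasCompactSupport (hHs.fderiv_apply ℝ e)
  have hPW : ∫ x, P x = ∫ x, W x := by
    have e1 : W = fun x => fderiv ℝ H x e + P x := funext fun x => by rw [hder]; ring
    rw [e1, integral_add hHi hPi, integral_fderiv_eq_zero_of_hasCompactSupport hHC hHs, zero_add]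
  have hP0 : ∀ x, 0 ≤ P x := fun x => mul_nonneg (hk0 _) (mul_nonneg (hχ0 _) (by positivity))
  have hFc := h.contDiff.continuous
  set K := tsupport χ ∩ {x | η ≤ F x} with hK
  have hKm : MeasurableSet K := (isClosed_tsupport χ).measurableSet.inter
    (isClosed_le continuous_const hFc).measurableSet
  have hSm : MeasurableSet (B ∩ {x | 2 * η ≤ F x ∧ F x ≤ δ}) :=
    hB.inter ((isClosed_le continuous_const hFc).inter
      (isClosed_le hFc continuous_const)).measurableSet
  have hWK : ∀ x, ‖W x‖ₑ ≤ K.indicator (fun x => ENNReal.ofReal (4 * A * δ) *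
      (‖G x‖ₑ ^ 2 + ‖G x‖ₑ * ‖fderiv ℝ G x e‖ₑ)) x := by
    intro x
    by_cases hx : x ∈ K
    · rw [Set.indicator_of_mem hx]
      have hin : |inner ℝ (G x) (fderiv ℝ G x e)| ≤ ‖G x‖ * ‖fderiv ℝ G x e‖ :=
        abs_real_inner_le_norm _ _
      have hle : ‖W x‖ ≤ (4 * A * δ) * (‖G x‖ ^ 2 + ‖G x‖ * ‖fderiv ℝ G x e‖) := by
        rw [hW, Real.norm_eq_abs, abs_mul]
        have i1 : |fderiv ℝ χ x e * ‖G x‖ ^ 2 + χ x * (2 * inner ℝ (G x) (fderiv ℝ G x e))| ≤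
            A * ‖G x‖ ^ 2 + A * (2 * (‖G x‖ * ‖fderiv ℝ G x e‖)) := by
          refine (abs_add_le _ _).trans (add_le_add ?_ ?_)
          · rw [abs_mul, abs_of_nonneg (by positivity : 0 ≤ ‖G x‖ ^ 2)]
            exact mul_le_mul_of_nonneg_right (hA' x) (by positivity)
          · rw [abs_mul, abs_mul, abs_of_nonneg (hχ0 x), abs_two]
            exact mul_le_mul (hA x) (by linarith) (by positivity) hA0
        calc |Θ (F x)| * _ ≤ (2 * δ) * (A * ‖G x‖ ^ 2 + A * (2 * (‖G x‖ * ‖fderiv ℝ G x e‖))) :=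
              mul_le_mul (hΘb _) i1 (abs_nonneg _) (by positivity)
          _ ≤ _ := by
              have : 0 ≤ A * δ * ‖G x‖ ^ 2 := by positivity
              nlinarith
      rw [← ofReal_norm, ← ofReal_norm, ← ofReal_norm, ← ENNReal.ofReal_pow (norm_nonneg _),
        ← ENNReal.ofReal_mul (norm_nonneg _), ← ENNReal.ofReal_add (by positivity) (by positivity),
        ← ENNReal.ofReal_mul (by positivity)]
      exact ENNReal.ofReal_le_ofReal hle
    · rw [Set.indicator_of_notMem hx]
      have : W x = 0 := by
        by_cases hx1 : x ∈ tsupport χ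
        · have : F x ≤ η := le_of_not_ge fun h2 => hx ⟨hx1, h2⟩
          simp only [hW, hΘ0 _ this, zero_mul]
        · have z1 : χ x = 0 := image_eq_zero_of_notMem_tsupport hx1
          have z2 : fderiv ℝ χ x = 0 := by
            by_contra h0
            exact hx1 (tsupport_fderiv_subset ℝ (subset_tsupport _ h0))
          simp [hW, z1, z2]
      simp [this]
  calc ∫⁻ x in B ∩ {x | 2 * η ≤ F x ∧ F x ≤ δ}, ‖G x‖ₑ ^ 2
      ≤ ∫⁻ x, ENNReal.ofReal (P x) := by
        refine le_trans ?_ (setLIntegral_le_lintegral (B ∩ {x | 2 * η ≤ F x ∧ F x ≤ δ}) _)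
        refine setLIntegral_mono' hSm fun x hx => ?_
        rw [← ofReal_norm, ← ENNReal.ofReal_pow (norm_nonneg _)]
        refine ENNReal.ofReal_le_ofReal ?_
        rw [hP]
        simp only [hχB x hx.1, one_mul]
        exact le_mul_of_one_le_left (by positivity) (hk1 _ hx.2.1 hx.2.2)
    _ = ENNReal.ofReal (∫ x, W x) := by
        rw [← hPW, ofReal_integral_eq_lintegral_ofReal hPi (Eventually.of_forall hP0)]
    _ ≤ ∫⁻ x, ‖W x‖ₑ := by
        refine le_trans ?_ (enorm_integral_le_lintegral_enorm _)
        rw [Real.enorm_eq_ofReal_abs]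
        exact ENNReal.ofReal_le_ofReal (le_abs_self _)
    _ ≤ ∫⁻ x in K, ENNReal.ofReal (4 * A * δ) * (‖G x‖ₑ ^ 2 + ‖G x‖ₑ * ‖fderiv ℝ G x e‖ₑ) := by
        rw [← lintegral_indicator hKm]
        exact lintegral_mono hWK
    _ = _ := by
        rw [lintegral_const_mul' _ _ ENNReal.ofReal_ne_top, lintegral_add_left]
        exact hG.continuous.measurable.enorm.pow_const 2

lemma tendsto_eLpNorm_of_sub {X V : Type*} [MeasurableSpace X] {μ : Measure X}
    [NormedAddCommGroup V] {a : ℕ → X → V} {a₀ : X → V} (ha : ∀ n, AEStronglyMeasurable (a n) μ)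
    (ha₀ : MemLp a₀ 2 μ) (h : Tendsto (fun n => eLpNorm (fun x => a n x - a₀ x) 2 μ) atTop (𝓝 0)) :
    Tendsto (fun n => eLpNorm (a n) 2 μ) atTop (𝓝 (eLpNorm a₀ 2 μ)) := by
  have h1 : Tendsto (fun n => eLpNorm a₀ 2 μ + eLpNorm (fun x => a n x - a₀ x) 2 μ) atTop
      (𝓝 (eLpNorm a₀ 2 μ)) := by
    simpa using (tendsto_const_nhds (x := eLpNorm a₀ 2 μ)).add h
  have h2 : Tendsto (fun n => eLpNorm a₀ 2 μ - eLpNorm (fun x => a n x - a₀ x) 2 μ) atTop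
      (𝓝 (eLpNorm a₀ 2 μ)) := by
    simpa using ENNReal.Tendsto.sub (tendsto_const_nhds (x := eLpNorm a₀ 2 μ)) h
      (Or.inl ha₀.eLpNorm_ne_top)
  refine tendsto_of_tendsto_of_tendsto_of_le_of_le h2 h1 (fun n => ?_) fun n => ?_
  · rw [tsub_le_iff_right]
    have := eLpNorm_sub_le (p := 2) (ha n) ((ha n).sub ha₀.1) (by norm_num)
    calc eLpNorm a₀ 2 μ = eLpNorm (a n - (a n - a₀)) 2 μ := by congr 1; simp
      _ ≤ _ := this
  · have := eLpNorm_add_le (p := 2) ha₀.1 ((ha n).sub ha₀.1) (by norm_num)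
    calc eLpNorm (a n) 2 μ = eLpNorm (a₀ + (a n - a₀)) 2 μ := by congr 1; simp
      _ ≤ _ := this

/-- The `L²` norm of a Sobolev function in a strip of width `δ` along the boundary. -/
lemma IsChart.exists_setLIntegral_strip_le {x₀ e : E d} {r : ℝ} {F : E d → ℝ}
    (h : IsChart D x₀ r e F) (hD : IsOpen D) :
    ∃ A : ℝ≥0, ∀ δ > 0, ∀ (v : E d → ℂ) (dv : Fin d → E d → ℂ), IsH1 D v dv →
      ∫⁻ x in Metric.closedBall x₀ (r / 2) ∩ {x | 0 < F x ∧ F x ≤ δ}, ‖v x‖ₑ ^ 2 ≤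
        A * ENNReal.ofReal δ * (eLpNorm v 2 (vol D) ^ 2 +
          eLpNorm v 2 (vol D) * ∑ i, eLpNorm (dv i) 2 (vol D)) := by
  have hr := h.pos
  set χ : ContDiffBump x₀ := ⟨r / 2, 3 * r / 4, by positivity, by linarith⟩ with hχ
  have hχC : ContDiff ℝ 1 χ := χ.contDiff
  have hχs : HasCompactSupport χ := χ.hasCompactSupport
  have hts : tsupport χ = Metric.closedBall x₀ (3 * r / 4) := χ.tsupport_eq
  obtain ⟨A₀, hA₀⟩ := (hχs.fderiv_apply ℝ e).exists_bound_of_continuous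
    ((hχC.continuous_fderiv one_ne_zero).clm_apply continuous_const)
  set A : ℝ := max A₀ 1 with hA
  have hA0 : 0 < A := by positivity
  set Ce : ℝ≥0 := ∑ i, ‖e i‖₊ with hCe
  have hFc := h.contDiff.continuous
  have hBχ : Metric.closedBall x₀ (r / 2) ⊆ tsupport χ := by
    rw [hts]; exact Metric.closedBall_subset_closedBall (by linarith)
  -- Away from the boundary by `η` the relevant region is a compact subset of `D`, so the estimate
  -- for smooth functions passes to the limit. The constant does not depend on `η`.
  have key : ∀ δ > 0, ∀ η > 0, η ≤ δ → ∀ (v : E d → ℂ) (dv : Fin d → E d → ℂ), IsH1 D v dv →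
      ∫⁻ x in Metric.closedBall x₀ (r / 2) ∩ {x | 2 * η ≤ F x ∧ F x ≤ δ}, ‖v x‖ₑ ^ 2 ≤
        ENNReal.ofReal (4 * A * δ) * (eLpNorm v 2 (vol D) ^ 2 +
          eLpNorm v 2 (vol D) * (Ce * ∑ i, eLpNorm (dv i) 2 (vol D))) := by
    intro δ hδ η hη hηδ v dv hv
    set K := tsupport χ ∩ {x | η ≤ F x} with hK
    set S := Metric.closedBall x₀ (r / 2) ∩ {x | 2 * η ≤ F x ∧ F x ≤ δ} with hS
    have hKc : IsCompact K := (hχs : IsCompact (tsupport χ)).inter_right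
      (isClosed_le continuous_const hFc)
    have hKD : K ⊆ D := by
      rintro x ⟨hx1, hx2⟩
      rw [hts] at hx1
      refine (h.mem_iff x (Metric.closedBall_subset_ball (by linarith) hx1)).2 ?_
      exact hη.trans_le hx2
    have hSK : S ⊆ K := fun x hx => ⟨hBχ hx.1, by
      have h2 : 2 * η ≤ F x := hx.2.1
      show η ≤ F x
      linarith⟩
    have hle : vol K ≤ vol D := Measure.restrict_mono hKD le_rfl
    have hleS : vol S ≤ vol K := Measure.restrict_mono hSK le_rfl
    obtain ⟨G, hG, hG1, hG2⟩ := hv.exists_smooth_approx hD hKc hKD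
    have hGm : ∀ n, AEStronglyMeasurable (G n) (vol K) := fun n =>
      (hG n).continuous.aestronglyMeasurable
    have hpc : ∀ n i, Continuous fun x => pderivs (G n) x i := fun n i =>
      ((hG n).continuous_fderiv (by simp)).clm_apply continuous_const
    have hvK := hv.memLp.mono_measure hle
    have hdvK := fun i => (hv.memLp_deriv i).mono_measure hle
    have tK := tendsto_eLpNorm_of_sub hGm hvK hG1
    have tS := tendsto_eLpNorm_of_sub (fun n => (hGm n).mono_measure hleS)
      (hvK.mono_measure hleS) (tendsto_of_tendsto_of_tendsto_of_le_of_le tendsto_const_nhds hG1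
        (fun _ => zero_le) fun n => eLpNorm_mono_measure _ hleS)
    have tdK := fun i => tendsto_eLpNorm_of_sub (fun n => (hpc n i).aestronglyMeasurable) (hdvK i)
      (hG2 i)
    have hsum : (∑ i, eLpNorm (dv i) 2 (vol K)) ≠ ⊤ :=
      (ENNReal.sum_lt_top.2 fun i _ => (hdvK i).2).ne
    have tR := ENNReal.Tendsto.const_mul (a := ENNReal.ofReal (4 * A * δ))
      (((ENNReal.continuous_pow 2).tendsto _).comp tK |>.add (ENNReal.Tendsto.mul tK
        (Or.inr (ENNReal.mul_ne_top ENNReal.coe_ne_top hsum))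
        (ENNReal.Tendsto.const_mul (a := (Ce : ℝ≥0∞)) (tendsto_finsetSum Finset.univ fun i _ => tdK i)
          (Or.inr ENNReal.coe_ne_top)) (Or.inr hvK.eLpNorm_ne_top)))
      (Or.inr ENNReal.ofReal_ne_top)
    have hlim := le_of_tendsto_of_tendsto' (((ENNReal.continuous_pow 2).tendsto _).comp tS) tR
      fun n => by
        have h1 := h.setLIntegral_le_of_contDiff hχC hχs (fun x => χ.nonneg)
          (A := A) (fun x => χ.le_one.trans (le_max_right _ _))
          (fun x => (hA₀ x).trans (le_max_left _ _)) (B := Metric.closedBall x₀ (r / 2))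
          Metric.isClosed_closedBall.measurableSet
          (fun x hx => χ.one_of_mem_closedBall hx) hη hηδ
          ((hG n).of_le (by simp) : ContDiff ℝ 1 (G n))
        have h2 : eLpNorm (fun x => fderiv ℝ (G n) x e) 2 (vol K) ≤
            Ce * ∑ i, eLpNorm (fun x => pderivs (G n) x i) 2 (vol K) := by
          have h3 := eLpNorm_le_sum_of_norm_le (μ := vol K) Finset.univ
            (f := fun x => fderiv ℝ (G n) x e) (u := fun i x => pderivs (G n) x i)
            (a := fun i => ‖e i‖) (fun i _ => norm_nonneg _)
            (fun i _ => (hpc n i).aestronglyMeasurable) (Eventually.of_forall fun x => by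
              conv_lhs => rw [← sum_smul_basisVec e]
              rw [map_sum]
              refine (norm_sum_le _ _).trans (le_of_eq (Finset.sum_congr rfl fun i _ => ?_))
              rw [map_smul, norm_smul]
              rfl)
          refine h3.trans ?_
          rw [Finset.mul_sum]
          refine Finset.sum_le_sum fun i _ => mul_le_mul' ?_ le_rfl
          rw [ofReal_norm, enorm_eq_nnnorm]
          exact_mod_cast Finset.single_le_sum (f := fun i => ‖e i‖₊) (fun _ _ => zero_le)
            (Finset.mem_univ i)
        have h4 := (lintegral_enorm_mul_le (hGm n)
          (((hG n).continuous_fderiv (by simp)).clm_apply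
            (continuous_const (y := e))).aestronglyMeasurable).trans
          (mul_le_mul' (le_refl (eLpNorm (G n) 2 (vol K))) h2)
        simp only [Function.comp]
        rw [sq_eLpNorm_two, sq_eLpNorm_two]
        exact h1.trans (mul_le_mul' le_rfl (add_le_add le_rfl h4))
    rw [sq_eLpNorm_two] at hlim
    refine hlim.trans ?_
    gcongr
  refine ⟨(4 * A).toNNReal * (1 + Ce), fun δ hδ v dv hv => ?_⟩
  -- With `η = δ/(n+1)` the truncated strips increase to the full strip, and monotone convergence
  -- removes `η`.
  set S : ℕ → Set (E d) := fun n => Metric.closedBall x₀ (r / 2) ∩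
    {x | 2 * (δ / ((n : ℝ) + 1)) ≤ F x ∧ F x ≤ δ} with hS
  have hmono : Monotone S := by
    intro n m hnm x hx
    refine ⟨hx.1, le_trans ?_ hx.2.1, hx.2.2⟩
    have : (n : ℝ) ≤ m := by exact_mod_cast hnm
    gcongr
  have hU : Metric.closedBall x₀ (r / 2) ∩ {x | 0 < F x ∧ F x ≤ δ} = ⋃ n, S n := by
    ext x
    simp only [hS, Set.mem_inter_iff, Set.mem_ofPred_eq, Set.mem_iUnion]
    constructor
    · rintro ⟨h1, h2, h3⟩
      obtain ⟨n, hn⟩ := exists_nat_one_div_lt (show 0 < F x / (2 * δ) by positivity)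
      refine ⟨n, h1, ?_, h3⟩
      rw [lt_div_iff₀ (by positivity)] at hn
      calc 2 * (δ / ((n : ℝ) + 1)) = 1 / ((n : ℝ) + 1) * (2 * δ) := by ring
        _ ≤ F x := hn.le
    · rintro ⟨n, h1, h2, h3⟩
      exact ⟨h1, lt_of_lt_of_le (by positivity) h2, h3⟩
  rw [hU, setLIntegral_iUnion_of_directed _ (directed_of_isDirected_le hmono)]
  refine iSup_le fun n => ?_
  have hn : δ / ((n : ℝ) + 1) ≤ δ := div_le_self hδ.le (by linarith [Nat.cast_nonneg (α := ℝ) n])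
  refine (key δ hδ _ (by positivity) hn v dv hv).trans ?_
  rw [ENNReal.ofReal_mul (by positivity), ENNReal.coe_mul]
  have e1 : ((4 * A).toNNReal : ℝ≥0∞) = ENNReal.ofReal (4 * A) := rfl
  rw [e1]
  push_cast
  set a := eLpNorm v 2 (vol D)
  set b := ∑ i, eLpNorm (dv i) 2 (vol D)
  calc ENNReal.ofReal (4 * A) * ENNReal.ofReal δ * (a ^ 2 + a * (Ce * b))
      ≤ ENNReal.ofReal (4 * A) * ENNReal.ofReal δ * ((1 + Ce) * (a ^ 2 + a * b)) := by
        gcongr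
        have : (1 + (Ce : ℝ≥0∞)) * (a ^ 2 + a * b) = a ^ 2 + a * (Ce * b) + (a * b + Ce * a ^ 2) := by
          ring
        rw [this]
        exact le_self_add
    _ = _ := by ring

end Strip

/-! ### Cut-off functions -/

section Cutoff

variable {d : ℕ} {D : Set (E d)}

lemma fderiv_eq_zero_of_eventually_const {V : Type*} [NormedAddCommGroup V] [NormedSpace ℝ V]
    {f : E d → V} {x : E d} {c : V} (h : ∀ᶠ y in 𝓝 x, f y = c) : fderiv ℝ f x = 0 := by
  have : f =ᶠ[𝓝 x] fun _ => c := h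
  rw [this.fderiv_eq]
  simp

lemma exists_deriv_smoothTransition_le : ∃ B : ℝ, 0 ≤ B ∧
    ∀ t, |deriv Real.smoothTransition t| ≤ B := by
  have hc : Continuous (deriv Real.smoothTransition) :=
    (Real.smoothTransition.contDiff (n := 1)).continuous_deriv le_rfl
  obtain ⟨B, hB⟩ := (isCompact_Icc (a := (0 : ℝ)) (b := 1)).exists_bound_of_continuousOn
    hc.continuousOn
  refine ⟨|B|, abs_nonneg _, fun t => ?_⟩
  by_cases ht : t ∈ Set.Icc (0 : ℝ) 1
  · exact (hB t ht).trans (le_abs_self _)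
  · have h0 : deriv Real.smoothTransition t = 0 := by
      rcases lt_or_ge t 0 with h | h
      · have : Real.smoothTransition =ᶠ[𝓝 t] fun _ => 0 := by
          filter_upwards [Iio_mem_nhds h] with s hs using
            Real.smoothTransition.zero_of_nonpos (le_of_lt hs)
        rw [this.deriv_eq]; simp
      · have h1 : 1 < t := not_le.1 fun h1 => ht ⟨h, h1⟩
        have : Real.smoothTransition =ᶠ[𝓝 t] fun _ => 1 := by
          filter_upwards [Ioi_mem_nhds h1] with s hs using
            Real.smoothTransition.one_of_one_le (le_of_lt hs)
        rw [this.deriv_eq]; simp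
    rw [h0, abs_zero]
    exact abs_nonneg _

/-- A function that vanishes near the boundary in the chart, and equals one away from it. -/
lemma IsChart.exists_cutoff {x₀ e : E d} {r : ℝ} {F : E d → ℝ} (h : IsChart D x₀ r e F) :
    ∃ A : ℝ, 0 ≤ A ∧ ∀ δ : ℝ, 0 < δ → δ ≤ 1 → ∃ a : E d → ℝ, ContDiff ℝ 1 a ∧
      (∀ y, 0 ≤ a y) ∧ (∀ y, a y ≤ 1) ∧
      (∀ y ∈ Metric.ball x₀ (r / 4), F y < δ / 2 → a y = 0) ∧
      (∀ y, y ∉ Metric.closedBall x₀ (r / 2) ∨ δ < F y → a y = 1) ∧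
      ∀ y, ‖fderiv ℝ a y‖ ≤ A / δ := by
  have hr := h.pos
  set ψ : ContDiffBump x₀ := ⟨r / 4, r / 2, by positivity, by linarith⟩ with hψ
  have hψC : ContDiff ℝ 1 ψ := ψ.contDiff
  have hψs : HasCompactSupport ψ := ψ.hasCompactSupport
  obtain ⟨B₁, hB₁⟩ := (hψs.fderiv ℝ).exists_bound_of_continuous (hψC.continuous_fderiv one_ne_zero)
  have hFc := h.contDiff.continuous_fderiv one_ne_zero
  obtain ⟨B₂, hB₂⟩ := (hψs.smul_right (f' := fderiv ℝ F)).exists_bound_of_continuous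
    (hψC.continuous.smul hFc)
  obtain ⟨B₃, hB₃0, hB₃⟩ := exists_deriv_smoothTransition_le
  have hB₁0 : 0 ≤ B₁ := (norm_nonneg _).trans (hB₁ x₀)
  have hB₂0 : 0 ≤ B₂ := (norm_nonneg _).trans (hB₂ x₀)
  refine ⟨B₁ + 2 * B₃ * B₂, by positivity, fun δ hδ hδ1 => ?_⟩
  -- Zero where `F ≤ δ/2` and one where `F ≥ δ`.
  set θ : E d → ℝ := fun y => Real.smoothTransition (2 * (δ⁻¹ * F y) - 1) with hθ
  have hθ0 : ∀ y, 0 ≤ θ y := fun y => Real.smoothTransition.nonneg _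
  have hθ1 : ∀ y, θ y ≤ 1 := fun y => Real.smoothTransition.le_one _
  have hin : ContDiff ℝ 1 fun y => 2 * (δ⁻¹ * F y) - 1 :=
    (contDiff_const.mul (contDiff_const.mul h.contDiff)).sub contDiff_const
  have hθC : ContDiff ℝ 1 θ := Real.smoothTransition.contDiff.comp hin
  -- Interpolates between `θ` near the centre of the chart, where `ψ = 1`, and the constant one
  -- outside the chart.
  refine ⟨fun y => 1 - ψ y * (1 - θ y), contDiff_const.sub (hψC.mul (contDiff_const.sub hθC)),
    fun y => ?_, fun y => ?_, fun y hy hF => ?_, fun y hy => ?_, fun y => ?_⟩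
  · have := mul_le_one₀ (ψ.le_one (x := y)) (sub_nonneg.2 (hθ1 y)) (sub_le_self 1 (hθ0 y))
    linarith
  · have := mul_nonneg (ψ.nonneg (x := y)) (sub_nonneg.2 (hθ1 y))
    linarith
  · have h1 : ψ y = 1 := ψ.one_of_mem_closedBall (Metric.ball_subset_closedBall hy)
    have h2 : θ y = 0 := by
      refine Real.smoothTransition.zero_of_nonpos ?_
      have : δ⁻¹ * F y < δ⁻¹ * (δ / 2) := mul_lt_mul_of_pos_left hF (inv_pos.2 hδ)
      have e : δ⁻¹ * (δ / 2) = 1 / 2 := by field_simp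
      linarith
    simp [h1, h2]
  · rcases hy with hy | hy
    · have h1 : ψ y = 0 := ψ.zero_of_le_dist (by
        rw [Metric.mem_closedBall, not_le] at hy; exact hy.le)
      simp [h1]
    · have h2 : θ y = 1 := by
        refine Real.smoothTransition.one_of_one_le ?_
        have : δ⁻¹ * δ < δ⁻¹ * F y := mul_lt_mul_of_pos_left hy (inv_pos.2 hδ)
        rw [inv_mul_cancel₀ hδ.ne'] at this
        linarith
      simp [h2]
  · have d1 : HasFDerivAt ψ (fderiv ℝ ψ y) y := (hψC.differentiable one_ne_zero y).hasFDerivAt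
    have d2 : HasFDerivAt F (fderiv ℝ F y) y := (h.contDiff.differentiable one_ne_zero y).hasFDerivAt
    have d3 : HasDerivAt Real.smoothTransition
        (deriv Real.smoothTransition (2 * (δ⁻¹ * F y) - 1)) (2 * (δ⁻¹ * F y) - 1) :=
      ((Real.smoothTransition.contDiff (n := 1)).differentiable one_ne_zero _).hasDerivAt
    have d4 := d3.comp_hasFDerivAt y (((d2.const_mul δ⁻¹).const_mul 2).sub_const 1)
    have d5 := ((d1.mul (d4.const_sub 1)).const_sub 1).fderiv
    have d6 : fderiv ℝ (fun y => 1 - ψ y * (1 - θ y)) y =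
      (2 * deriv Real.smoothTransition (2 * (δ⁻¹ * F y) - 1) * δ⁻¹) • (ψ y • fderiv ℝ F y) -
        (1 - θ y) • fderiv ℝ ψ y := by
      refine d5.trans ?_
      ext v
      simp [hθ]
      ring
    rw [d6]
    refine (norm_sub_le _ _).trans ?_
    rw [norm_smul, norm_smul (1 - θ y), Real.norm_eq_abs, Real.norm_eq_abs, abs_mul, abs_mul, abs_two,
      abs_of_pos (inv_pos.2 hδ), abs_of_nonneg (sub_nonneg.2 (hθ1 y)), add_comm, add_div]
    -- The derivative of `ψ` does not grow as `δ` shrinks; `δ ≤ 1` lets it be absorbed in the same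
    -- form `A/δ`.
    have i1 : (1 - θ y) * ‖fderiv ℝ ψ y‖ ≤ B₁ / δ := by
      calc (1 - θ y) * ‖fderiv ℝ ψ y‖ ≤ 1 * B₁ :=
            mul_le_mul (sub_le_self 1 (hθ0 y)) (hB₁ y) (norm_nonneg _) zero_le_one
        _ = B₁ := one_mul _
        _ ≤ B₁ / δ := by
            rw [le_div_iff₀ hδ]
            exact mul_le_of_le_one_right hB₁0 hδ1
    have i2 : 2 * |deriv Real.smoothTransition (2 * (δ⁻¹ * F y) - 1)| * δ⁻¹ * ‖ψ y • fderiv ℝ F y‖ ≤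
        2 * B₃ * B₂ / δ := by
      calc _ ≤ 2 * B₃ * δ⁻¹ * B₂ := by
            gcongr
            · exact hB₃ _
            · exact hB₂ y
        _ = _ := by ring
    exact add_le_add i1 i2

/-- A cut-off function of `D`, equal to one outside of a strip `T` of width `δ` along the boundary. -/
structure IsCutoff (D : Set (E d)) (A : ℝ) (δ : ℝ) (β : E d → ℝ) (T : Set (E d)) : Prop where
  measurableSet : MeasurableSet T
  contDiff : ContDiff ℝ 1 β
  hasCompactSupport : HasCompactSupport β
  tsupport_subset : tsupport β ⊆ D
  nonneg : ∀ x, 0 ≤ β x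
  le_one : ∀ x, β x ≤ 1
  eq_one : ∀ x ∈ D, x ∉ T → β x = 1
  fderiv_eq_zero : ∀ x ∈ D, x ∉ T → fderiv ℝ β x = 0
  norm_fderiv_le : ∀ x, ‖fderiv ℝ β x‖ ≤ A / δ

/-- Finitely many charts cover the compact boundary. The product of their cut-offs vanishes near
`Γ`, and inside `D` it differs from one only in the union `T` of the chart strips, where the strip
estimates add up. -/
lemma exists_isCutoff (hD : IsC11Domain D) : ∃ A : ℝ≥0, ∀ δ : ℝ, 0 < δ → δ ≤ 1 →
    ∃ (β : E d → ℝ) (T : Set (E d)), IsCutoff D A δ β T ∧ T ⊆ D ∧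
      ∀ (v : E d → ℂ) (dv : Fin d → E d → ℂ), IsH1 D v dv → ∫⁻ x in T, ‖v x‖ₑ ^ 2 ≤
        A * ENNReal.ofReal δ * (eLpNorm v 2 (vol D) ^ 2 +
          eLpNorm v 2 (vol D) * ∑ i, eLpNorm (dv i) 2 (vol D)) := by
  classical
  have hfc : IsCompact (frontier D) := hD.2.1.isCompact_closure.of_isClosed_subset isClosed_frontier
    frontier_subset_closure
  choose! r e F hch using fun x (hx : x ∈ frontier D) => hD.exists_chart hx
  choose! A₁ hA₁0 hA₁ using fun x (hx : x ∈ frontier D) => (hch x hx).exists_cutoff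
  choose! A₂ hA₂ using fun x (hx : x ∈ frontier D) =>
    (hch x hx).exists_setLIntegral_strip_le hD.1
  obtain ⟨t, htf, htU⟩ := hfc.elim_nhds_subcover (fun x => Metric.ball x (r x / 4)) fun x hx =>
    Metric.ball_mem_nhds x (by have := (hch x hx).pos; positivity)
  -- One constant for two purposes: the first sum bounds the gradient of the product, since each
  -- factor lies in `[0,1]`; the second bounds the strip integrals.
  refine ⟨(∑ x ∈ t, A₁ x).toNNReal + ∑ x ∈ t, A₂ x, fun δ hδ hδ1 => ?_⟩
  choose! a haC ha0 ha1 haz haone had using fun x (hx : x ∈ frontier D) => hA₁ x hx δ hδ hδ1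
  have hFc : ∀ x ∈ t, Continuous (F x) := fun x hx => (hch x (htf x hx)).contDiff.continuous
  set b : E d → ℝ := fun y => ∏ x ∈ t, a x y with hb
  have hbC : ContDiff ℝ 1 b := contDiff_prod fun x hx => haC x (htf x hx)
  have hb0 : ∀ y, 0 ≤ b y := fun y => Finset.prod_nonneg fun x hx => ha0 x (htf x hx) y
  have hb1 : ∀ y, b y ≤ 1 := fun y => Finset.prod_le_one (fun x hx => ha0 x (htf x hx) y)
    fun x hx => ha1 x (htf x hx) y
  have hbd : ∀ y, ‖fderiv ℝ b y‖ ≤ (∑ x ∈ t, A₁ x) / δ := by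
    intro y
    have := (HasFDerivAt.finsetProd (u := t) (g := a) (x := y) fun x hx =>
      ((haC x (htf x hx)).differentiable one_ne_zero y).hasFDerivAt).fderiv
    rw [show fderiv ℝ b y = _ from this, Finset.sum_div]
    refine (norm_sum_le _ _).trans (Finset.sum_le_sum fun x hx => ?_)
    rw [norm_smul, Real.norm_of_nonneg (Finset.prod_nonneg fun z hz =>
      ha0 z (htf z (Finset.mem_of_mem_erase hz)) y)]
    refine (mul_le_of_le_one_left (norm_nonneg _) ?_).trans (had x (htf x hx) y)
    exact Finset.prod_le_one (fun z hz => ha0 z (htf z (Finset.mem_of_mem_erase hz)) y)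
      fun z hz => ha1 z (htf z (Finset.mem_of_mem_erase hz)) y
  -- Cutting at the boundary of `D` costs no regularity: near each boundary point one of the factors
  -- already vanishes on the side of `D`.
  set β : E d → ℝ := D.indicator b with hβ
  set S : E d → Set (E d) := fun x => Metric.closedBall x (r x / 2) ∩ {y | 0 < F x y ∧ F x y ≤ δ}
    with hS
  have hβs : tsupport β ⊆ D := by
    intro y hy
    have hyc : y ∈ closure D := closure_mono (Set.support_indicator_subset) hy
    by_contra hyD
    have hyf : y ∈ frontier D := by rw [hD.1.frontier_eq]; exact ⟨hyc, hyD⟩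
    obtain ⟨x, hx, hyx⟩ := Set.mem_iUnion₂.1 (htU hyf)
    have hxr := (hch x (htf x hx)).pos
    have hF0 : F x y = 0 := (hch x (htf x hx)).eq_zero hD.1 hyf
      (Metric.ball_subset_ball (by linarith) hyx)
    have h1 : ∀ᶠ z in 𝓝 y, F x z < δ / 2 :=
      (hFc x hx).continuousAt.eventually_lt_const (by rw [hF0]; positivity)
    have h2 : ∀ᶠ z in 𝓝 y, β z = 0 := by
      filter_upwards [h1, Metric.isOpen_ball.mem_nhds hyx] with z hz1 hz2
      by_cases hzD : z ∈ D
      · rw [hβ, Set.indicator_of_mem hzD]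
        exact Finset.prod_eq_zero hx (haz x (htf x hx) z hz2 hz1)
      · rw [hβ, Set.indicator_of_notMem hzD]
    exact (notMem_tsupport_iff_eventuallyEq.2 h2) hy
  have hβb : ∀ y ∈ D, β =ᶠ[𝓝 y] b := fun y hy => by
    filter_upwards [hD.1.mem_nhds hy] with z hz
    rw [hβ, Set.indicator_of_mem hz]
  have hβ0 : ∀ y ∉ D, β =ᶠ[𝓝 y] fun _ => 0 := fun y hy =>
    notMem_tsupport_iff_eventuallyEq.1 fun h => hy (hβs h)
  -- Equality with one holds on a neighbourhood, which gives the value and the vanishing derivative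
  -- together. This uses the strict inequality `δ < F` outside the strips.
  have hone : ∀ y ∈ D, y ∉ ⋃ x ∈ t, S x → ∀ᶠ z in 𝓝 y, β z = 1 := by
    intro y hy hyT
    have h1 : ∀ x ∈ t, ∀ᶠ z in 𝓝 y, a x z = 1 := by
      intro x hx
      have hxf := htf x hx
      by_cases hyb : y ∈ Metric.closedBall x (r x / 2)
      · have hFy : δ < F x y := by
          by_contra hle
          refine hyT (Set.mem_iUnion₂.2 ⟨x, hx, hyb, ?_, not_lt.1 hle⟩)
          exact ((hch x hxf).mem_iff y (Metric.closedBall_subset_ball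
            (by linarith [(hch x hxf).pos]) hyb)).1 hy
        filter_upwards [(hFc x hx).continuousAt.eventually_const_lt hFy] with z hz using
          haone x hxf z (Or.inr hz)
      · filter_upwards [Metric.isClosed_closedBall.isOpen_compl.mem_nhds hyb] with z hz using
          haone x hxf z (Or.inl hz)
    filter_upwards [(Filter.eventually_all_finset t).2 h1, hβb y hy] with z hz1 hz2
    rw [hz2]
    exact Finset.prod_eq_one hz1
  refine ⟨β, ⋃ x ∈ t, S x, ⟨?_, ?_, ?_, hβs, ?_, ?_, fun y hy hyT => (hone y hy hyT).self_of_nhds,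
    fun y hy hyT => fderiv_eq_zero_of_eventually_const (hone y hy hyT), ?_⟩, ?_, ?_⟩
  · refine t.measurableSet_biUnion fun x hx => Metric.isClosed_closedBall.measurableSet.inter ?_
    exact (isOpen_lt continuous_const (hFc x hx)).measurableSet.inter
      (isClosed_le (hFc x hx) continuous_const).measurableSet
  · refine contDiff_iff_contDiffAt.2 fun y => ?_
    by_cases hy : y ∈ D
    · exact hbC.contDiffAt.congr_of_eventuallyEq (hβb y hy)
    · exact contDiffAt_const.congr_of_eventuallyEq (hβ0 y hy)
  · exact (hD.2.1.subset hβs).isCompact_closure.of_isClosed_subset (isClosed_tsupport β)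
      subset_closure
  · exact fun y => Set.indicator_nonneg (fun z _ => hb0 z) y
  · exact fun y => Set.indicator_le' (fun z _ => hb1 z) (fun _ _ => zero_le_one) y
  · intro y
    have hA : (∑ x ∈ t, A₁ x) / δ ≤
        (((∑ x ∈ t, A₁ x).toNNReal + ∑ x ∈ t, A₂ x : ℝ≥0) : ℝ) / δ := by
      refine div_le_div_of_nonneg_right ?_ hδ.le
      push_cast
      exact (Real.le_coe_toNNReal _).trans (le_add_of_nonneg_right (by positivity))
    refine le_trans ?_ hA
    by_cases hy : y ∈ D
    · rw [(hβb y hy).fderiv_eq]; exact hbd y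
    · rw [fderiv_eq_zero_of_eventually_const (hβ0 y hy), norm_zero]
      exact div_nonneg (Finset.sum_nonneg fun x hx => hA₁0 x (htf x hx)) hδ.le
  · refine Set.iUnion₂_subset fun x hx y hy => ?_
    exact ((hch x (htf x hx)).mem_iff y (Metric.closedBall_subset_ball
      (by linarith [(hch x (htf x hx)).pos]) hy.1)).2 hy.2.1
  · intro v dv hv
    have h1 : ∫⁻ y in ⋃ x ∈ t, S x, ‖v y‖ₑ ^ 2 ≤ ∑ x ∈ t, ∫⁻ y in S x, ‖v y‖ₑ ^ 2 := by
      have e1 : ⋃ x ∈ t, S x = ⋃ x : t, S x := by ext; simp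
      rw [← Finset.sum_coe_sort t (f := fun x => ∫⁻ y in S x, ‖v y‖ₑ ^ 2), e1]
      refine (lintegral_iUnion_le _ _).trans (le_of_eq ?_)
      rw [tsum_fintype]
    refine h1.trans ((Finset.sum_le_sum fun x hx => hA₂ x (htf x hx) δ hδ v dv hv).trans ?_)
    rw [← Finset.sum_mul, ← Finset.sum_mul]
    gcongr
    push_cast
    exact le_add_self

end Cutoff

/-! ### Linear combinations of periodic fields -/

section Combination

variable {d : ℕ}

/-- The underlying function, as a linear map. -/
def valₗ (d : ℕ) : H1sharp d →ₗ[ℂ] L2Y d where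
  toFun := H1sharp.val
  map_add' _ _ := rfl
  map_smul' _ _ := rfl

/-- The partial derivative, as a linear map. -/
def gradₗ (i : Fin d) : H1sharp d →ₗ[ℂ] L2Y d where
  toFun w := H1sharp.grad w i
  map_add' _ _ := rfl
  map_smul' _ _ := rfl

lemma coeFn_sum_smul (L : H1sharp d →ₗ[ℂ] L2Y d) (c : Fin d → ℂ) (W : Fin d → H1sharp d) :
    (L (∑ j, c j • W j) : E d → C3) =ᵐ[cellVol d] fun y => ∑ j, c j • (L (W j) : E d → C3) y := by
  rw [map_sum]
  have h2 : ∀ j, (L (c j • W j) : E d → C3) =ᵐ[cellVol d] fun y => c j • (L (W j) : E d → C3) y :=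
    fun j => by rw [map_smul]; exact Lp.coeFn_smul _ _
  filter_upwards [Lp.coeFn_fun_finsetSum Finset.univ fun j => L (c j • W j),
    ae_all_iff.2 h2] with y h3 h4
  rw [h3]
  exact Finset.sum_congr rfl fun j _ => h4 j

lemma ext3_sum_smul {ι : Type*} (s : Finset ι) (c : ι → ℂ) (G : ι → Fin d → C3) (k : Fin 3) :
    ext3 (fun i => ∑ j ∈ s, c j • G j i) k = ∑ j ∈ s, c j • ext3 (G j) k := by
  unfold ext3
  split_ifs <;> simp

lemma curlOf_sum_smul {ι : Type*} (s : Finset ι) (c : ι → ℂ) (G : ι → Fin d → C3) :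
    curlOf (ext3 fun i => ∑ j ∈ s, c j • G j i) = ∑ j ∈ s, c j • curlOf (ext3 (G j)) := by
  ext k
  fin_cases k <;> simp [curlOf, ext3_sum_smul, mul_sub, Finset.sum_sub_distrib]

lemma divOf_sum_smul {ι : Type*} (s : Finset ι) (c : ι → ℂ) (G : ι → Fin d → C3) :
    divOf (ext3 fun i => ∑ j ∈ s, c j • G j i) = ∑ j ∈ s, c j * divOf (ext3 (G j)) := by
  simp only [divOf, ext3_sum_smul, Finset.mul_sum]
  rw [Finset.sum_comm]
  simp

lemma H1sharp.curl_sum_smul (c : Fin d → ℂ) (W : Fin d → H1sharp d) :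
    ∀ᵐ y ∂(cellVol d), H1sharp.curl (∑ j, c j • W j) y = ∑ j, c j • H1sharp.curl (W j) y := by
  filter_upwards [ae_all_iff.2 fun i => coeFn_sum_smul (gradₗ i) c W] with y hy
  have h : (fun i => (H1sharp.grad (∑ j, c j • W j) i : E d → C3) y) =
      fun i => ∑ j, c j • (H1sharp.grad (W j) i : E d → C3) y := funext fun i => hy i
  rw [H1sharp.curl, h, curlOf_sum_smul]
  rfl

lemma H1sharp.div_sum_smul (c : Fin d → ℂ) (W : Fin d → H1sharp d) :
    ∀ᵐ y ∂(cellVol d), H1sharp.div (∑ j, c j • W j) y = ∑ j, c j * H1sharp.div (W j) y := by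
  filter_upwards [ae_all_iff.2 fun i => coeFn_sum_smul (gradₗ i) c W] with y hy
  have h : (fun i => (H1sharp.grad (∑ j, c j • W j) i : E d → C3) y) =
      fun i => ∑ j, c j • (H1sharp.grad (W j) i : E d → C3) y := funext fun i => hy i
  rw [H1sharp.div, h, divOf_sum_smul]
  rfl

lemma H1sharp_eq_of_curl_div (hd : d ≤ 3) {w v : H1sharp d}
    (hcurl : ∀ᵐ y ∂(cellVol d), H1sharp.curl w y = H1sharp.curl v y)
    (hdiv : ∀ᵐ y ∂(cellVol d), H1sharp.div w y = H1sharp.div v y) : w = v := by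
  have hg : ∀ i, (H1sharp.grad (w - v) i : E d → C3) =ᵐ[cellVol d]
      fun y => H1sharp.grad w i y - H1sharp.grad v i y := fun i =>
    Lp.coeFn_sub (H1sharp.grad w i) (H1sharp.grad v i)
  refine sub_eq_zero.1 (H1sharp_eq_zero hd ?_ ?_)
  · filter_upwards [ae_all_iff.2 hg, hcurl] with y h1 h2
    rw [H1sharp.curl, show (fun i => (H1sharp.grad (w - v) i : E d → C3) y) =
      fun i => H1sharp.grad w i y - H1sharp.grad v i y from funext h1, ← curlOf_ext3_sub]
    exact sub_eq_zero.2 h2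
  · filter_upwards [ae_all_iff.2 hg, hdiv] with y h1 h2
    rw [H1sharp.div, show (fun i => (H1sharp.grad (w - v) i : E d → C3) y) =
      fun i => H1sharp.grad w i y - H1sharp.grad v i y from funext h1, ext3_sub]
    simp only [divOf, PiLp.sub_apply, Finset.sum_sub_distrib]
    exact sub_eq_zero.2 h2

/-- Makes `osc` computable: the representative chosen there coincides with any other. -/
lemma IsContRep.unique {w : H1sharp d} {f f' : E d → C3} (h : IsContRep w f)
    (h' : IsContRep w f') : f = f' := by
  refine (Continuous.ae_eq_iff_eq volume h.1 h'.1).1 ?_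
  refine IsPeriodic.ae_of_ae_cell (p := fun y => f y = f' y)
    (fun i y => by simp only [h.2.1 i y, h'.2.1 i y]) ?_
  filter_upwards [h.2.2, h'.2.2] with y h1 h2
  rw [← h1, h2]

lemma IsContRep.sum_smul {W : Fin d → H1sharp d} {Q : Fin d → E d → C3}
    (h : ∀ j, IsContRep (W j) (Q j)) (c : Fin d → ℂ) :
    IsContRep (∑ j, c j • W j) fun y => ∑ j, c j • Q j y := by
  refine ⟨continuous_finsetSum _ fun j _ => (h j).1.const_smul (c j), fun i y => ?_, ?_⟩
  · simp only [(h _).2.1 i y]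
  · filter_upwards [coeFn_sum_smul (valₗ d) c W, ae_all_iff.2 fun j => (h j).2.2] with y h1 h2
    refine h1.trans (Finset.sum_congr rfl fun j _ => ?_)
    exact congrArg _ (h2 j)

lemma osc_eq {ε : ℝ} {q : E d → H1sharp d} {x : E d} {f : E d → C3} (h : IsContRep (q x) f) :
    osc ε q x = f (ε⁻¹ • x) := by
  have hex : ∃ f, IsContRep (q x) f := ⟨f, h⟩
  rw [osc, dif_pos hex, hex.choose_spec.unique h]

lemma toC3_mulVec (A : E d → Matrix (Fin d) (Fin d) ℂ) (y : E d) (c : Fin d → ℂ) :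
    toC3 ((A y).mulVec c) = ∑ j, c j • column A j y := by
  ext k
  simp only [toC3, column, WithLp.ofLp_sum, WithLp.ofLp_smul, Finset.sum_apply, Pi.smul_apply,
    smul_eq_mul]
  unfold ext3
  split_ifs with h
  · simp [Matrix.mulVec, dotProduct, mul_comm]
  · simp

/-- The slow curl of `∑ⱼ gⱼ(x) Rⱼ` differentiates only the coefficients, so each term is `∇gⱼ × Rⱼ`.
-/
lemma curlOf_sum_smul_right (c : Fin d → Fin d → ℂ) (R : Fin d → C3) :
    curlOf (ext3 fun i => ∑ j, c j i • R j) = ∑ j, cross (toC3 fun i => c j i) (R j) := by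
  have h : ∀ k : Fin 3, ext3 (fun i => ∑ j, c j i • R j) k =
      ∑ j, (toC3 (fun i => c j i) k) • R j := by
    intro k
    simp only [toC3]
    unfold ext3
    split_ifs <;> simp
  ext k
  fin_cases k <;> simp [curlOf, h, cross, Finset.sum_sub_distrib]

end Combination

/-! ### Vector-valued Sobolev functions -/

section VectorValued

variable {d : ℕ} {D : Set (E d)} {V V' : Type*} [NormedAddCommGroup V] [NormedSpace ℝ V]
  [NormedAddCommGroup V'] [NormedSpace ℝ V']

lemma IsH1.clm_comp [CompleteSpace V] [CompleteSpace V'] {f : E d → V} {df : Fin d → E d → V}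
    (h : IsH1 D f df) (L : V →L[ℝ] V') :
    IsH1 D (fun x => L (f x)) fun i x => L (df i x) := by
  refine ⟨L.comp_memLp' h.memLp, fun i => L.comp_memLp' (h.memLp_deriv i), fun i φ hφ hs hD => ?_⟩
  have h1 : MemLp (fun x => fderiv ℝ φ x (basisVec d i)) 2 (vol D) :=
    (((hφ.continuous_fderiv (by simp)).clm_apply continuous_const).memLp_of_hasCompactSupport
      (hs.fderiv_apply ℝ _)).mono_measure Measure.restrict_le_self
  have h2 : MemLp φ 2 (vol D) :=
    (hφ.continuous.memLp_of_hasCompactSupport hs).mono_measure Measure.restrict_le_self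
  have i1 : Integrable (fun x => fderiv ℝ φ x (basisVec d i) • f x) (vol D) :=
    memLp_one_iff_integrable.1 (h.memLp.smul h1)
  have i2 : Integrable (fun x => φ x • df i x) (vol D) :=
    memLp_one_iff_integrable.1 ((h.memLp_deriv i).smul h2)
  simp only [← map_smul]
  rw [L.integral_comp_comm i1, L.integral_comp_comm i2, h.weak_deriv i φ hφ hs hD, map_neg]

lemma IsH1.sum {ι : Type*} (s : Finset ι) {f : ι → E d → V} {df : ι → Fin d → E d → V}
    (h : ∀ j ∈ s, IsH1 D (f j) (df j)) :
    IsH1 D (fun x => ∑ j ∈ s, f j x) fun i x => ∑ j ∈ s, df j i x := by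
  refine ⟨memLp_finsetSum s fun j hj => (h j hj).memLp,
    fun i => memLp_finsetSum s fun j hj => (h j hj).memLp_deriv i, fun i φ hφ hs hD => ?_⟩
  have h1 : MemLp (fun x => fderiv ℝ φ x (basisVec d i)) 2 (vol D) :=
    (((hφ.continuous_fderiv (by simp)).clm_apply continuous_const).memLp_of_hasCompactSupport
      (hs.fderiv_apply ℝ _)).mono_measure Measure.restrict_le_self
  have h2 : MemLp φ 2 (vol D) :=
    (hφ.continuous.memLp_of_hasCompactSupport hs).mono_measure Measure.restrict_le_self
  have i1 : ∀ j ∈ s, Integrable (fun x => fderiv ℝ φ x (basisVec d i) • f j x) (vol D) :=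
    fun j hj => memLp_one_iff_integrable.1 ((h j hj).memLp.smul h1)
  have i2 : ∀ j ∈ s, Integrable (fun x => φ x • df j i x) (vol D) :=
    fun j hj => memLp_one_iff_integrable.1 (((h j hj).memLp_deriv i).smul h2)
  simp only [Finset.smul_sum]
  rw [integral_finsetSum s i1, integral_finsetSum s i2, ← Finset.sum_neg_distrib]
  exact Finset.sum_congr rfl fun j hj => (h j hj).weak_deriv i φ hφ hs hD

/-- Each term is the image of a scalar Sobolev function under the bounded linear map `z ↦ z W_j`,
which commutes with the integrals defining weak derivatives. -/
lemma isH1_sum_smul {g : Fin d → E d → ℂ} {h : Fin d → Fin d → E d → ℂ}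
    (hg : ∀ j, IsH1 D (g j) (h j)) (W : Fin d → H1sharp d) :
    IsH1 D (fun x => ∑ j, g j x • W j) fun i x => ∑ j, h j i x • W j := by
  refine IsH1.sum Finset.univ fun j _ => ?_
  exact (hg j).clm_comp
    (((ContinuousLinearMap.id ℂ ℂ).smulRight (W j)).restrictScalars ℝ : ℂ →L[ℝ] H1sharp d)

end VectorValued

/-! ### The normal trace of a curl -/

section NormalTrace

variable {d : ℕ} {D : Set (E d)}

lemma IsH1.sub {f f' : E d → ℂ} {df df' : Fin d → E d → ℂ} (h : IsH1 D f df) (h' : IsH1 D f' df') :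
    IsH1 D (f - f') fun i x => df i x - df' i x := by
  refine ⟨h.memLp.sub h'.memLp, fun i => (h.memLp_deriv i).sub (h'.memLp_deriv i),
    fun i φ hφ hs hD => ?_⟩
  have h1 : MemLp (fun x => fderiv ℝ φ x (basisVec d i)) 2 (vol D) :=
    (((hφ.continuous_fderiv (by simp)).clm_apply continuous_const).memLp_of_hasCompactSupport
      (hs.fderiv_apply ℝ _)).mono_measure Measure.restrict_le_self
  have h2 : MemLp φ 2 (vol D) :=
    (hφ.continuous.memLp_of_hasCompactSupport hs).mono_measure Measure.restrict_le_self
  have i1 : Integrable (fun x => fderiv ℝ φ x (basisVec d i) • f x) (vol D) :=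
    memLp_one_iff_integrable.1 (h.memLp.smul h1)
  have i2 : Integrable (fun x => φ x • df i x) (vol D) :=
    memLp_one_iff_integrable.1 ((h.memLp_deriv i).smul h2)
  have i3 : Integrable (fun x => fderiv ℝ φ x (basisVec d i) • f' x) (vol D) :=
    memLp_one_iff_integrable.1 (h'.memLp.smul h1)
  have i4 : Integrable (fun x => φ x • df' i x) (vol D) :=
    memLp_one_iff_integrable.1 ((h'.memLp_deriv i).smul h2)
  simp only [Pi.sub_apply, smul_sub]
  rw [integral_sub i1 i3, integral_sub i2 i4, h.weak_deriv i φ hφ hs hD,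
    h'.weak_deriv i φ hφ hs hD]
  ring

lemma isH1_of_contDiff {ρ : E d → ℂ} (hρ : ContDiff ℝ (⊤ : ℕ∞) ρ) (hs : HasCompactSupport ρ) :
    IsH1 D ρ fun i x => pderivs ρ x i := by
  refine ⟨(hρ.continuous.memLp_of_hasCompactSupport hs).mono_measure Measure.restrict_le_self,
    fun i => (((hρ.continuous_fderiv (by simp)).clm_apply
      continuous_const).memLp_of_hasCompactSupport (hs.fderiv_apply ℝ _)).mono_measure
      Measure.restrict_le_self, fun i φ hφ hφs hφD => ?_⟩
  have hφ1 : ContDiff ℝ 1 fun x => (φ x : ℂ) :=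
    Complex.ofRealCLM.contDiff.comp (hφ.of_le (by simp))
  have hd : ∀ x, fderiv ℝ (fun x => (φ x : ℂ)) x (basisVec d i) =
      (fderiv ℝ φ x (basisVec d i) : ℂ) := by
    intro x
    have h1 : fderiv ℝ (fun x => (φ x : ℂ)) x = _ := (Complex.ofRealCLM.hasFDerivAt.comp x
      (hφ.differentiable (by simp) x).hasFDerivAt).fderiv
    rw [h1]
    rfl
  have := integral_mul_fderiv (hρ.of_le (by simp) : ContDiff ℝ 1 ρ) hφ1
    (hφs.comp_left (g := fun t : ℝ => (t : ℂ)) Complex.ofReal_zero) (basisVec d i)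
  rw [setIntegral_eq_integral_of_forall_compl_eq_zero,
    setIntegral_eq_integral_of_forall_compl_eq_zero]
  · simp only [Complex.real_smul]
    simp only [hd] at this
    simp only [mul_comm _ (ρ _), this, pderivs]
    simp only [mul_comm]
  · intro x hx
    rw [image_eq_zero_of_notMem_tsupport fun h => hx (hφD h), zero_smul]
  · intro x hx
    have h : fderiv ℝ φ x = 0 := by
      by_contra h
      exact hx (hφD (tsupport_fderiv_subset ℝ (subset_tsupport _ h)))
    simp [h]

/-- Uses `∇ρ` as test field in the definition of the weak curl; its own curl is zero. -/
lemma IsHcurl.integral_dot_grad_eq_zero {U c : E d → C3} (h : IsHcurl D U c) {ρ : E d → ℂ}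
    (hρ : ContDiff ℝ (⊤ : ℕ∞) ρ) (hs : HasCompactSupport ρ) (hD : tsupport ρ ⊆ D) :
    ∫ x in D, dot (c x) (toC3 (pderivs ρ x)) = 0 := by
  have hC : ContDiff ℝ (⊤ : ℕ∞) fun x => toC3 (pderivs ρ x) :=
    contDiff_toC3_pderivs (by simpa using hρ)
  have hsub : tsupport (fun x => toC3 (pderivs ρ x)) ⊆ tsupport ρ := by
    refine closure_minimal (fun x hx => ?_) (isClosed_tsupport ρ)
    by_contra hx'
    refine hx ?_
    have h : fderiv ℝ ρ x = 0 := by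
      by_contra h
      exact hx' (tsupport_fderiv_subset ℝ (subset_tsupport _ h))
    ext k
    simp [toC3, ext3_pderivs, h]
  have := h.weak_curl _ hC (hs.of_isClosed_subset (isClosed_tsupport _) hsub) (hsub.trans hD)
  rw [← this]
  simp only [curl_toC3_pderivs hρ]
  simp [dot]

/-- A bound of the pairing of a divergence-free field with gradients bounds its normal trace. -/
lemma IsHcurl.normalTraceNorm_le {U c : E d → C3} (h : IsHcurl D U c) (hd : d ≤ 3) {B : ℝ≥0∞}
    (hBt : B ≠ ⊤)
    (hB : ∀ (w : E d → ℂ) (dw : Fin d → E d → ℂ), IsH1 D w dw →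
      ‖∫ x in D, dot (c x) (toC3 fun i => dw i x)‖ₑ ≤ B * h1Norm D w dw) :
    normalTraceNorm D c ≤ B := by
  refine sInf_le fun w dw hw => ?_
  have hne : Nonempty {ρ : E d → ℂ // ContDiff ℝ (⊤ : ℕ∞) ρ ∧ HasCompactSupport ρ ∧
      tsupport ρ ⊆ D} :=
    ⟨⟨fun _ => 0, contDiff_const, HasCompactSupport.zero, by simp [tsupport]⟩⟩
  -- Finiteness of `B` is what allows the product to enter the infimum.
  rw [traceHalfNorm, ENNReal.mul_iInf fun h => absurd h hBt]
  refine le_iInf fun ρ => ?_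
  obtain ⟨ρ, hρ, hρs, hρD⟩ := ρ
  have hρ1 := isH1_of_contDiff (D := D) hρ hρs
  -- Subtracting a test function from `w` does not change the pairing, so the full `H¹` bound
  -- applies to every representative of the trace.
  refine le_trans (le_of_eq ?_) (hB _ _ (hw.sub hρ1))
  congr 1
  have e : ∀ x, dot (c x) (toC3 fun i => dw i x - pderivs ρ x i) =
      dot (c x) (toC3 fun i => dw i x) - dot (c x) (toC3 (pderivs ρ x)) := fun x => by
    rw [toC3_sub, dot_sub]
  simp only [e]
  rw [integral_sub (integrable_dot h.memLp_curl (memLp_toC3 hd hw.memLp_deriv))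
    (integrable_dot h.memLp_curl (memLp_toC3 hd hρ1.memLp_deriv)),
    h.integral_dot_grad_eq_zero hρ hρs hρD, sub_zero]

lemma norm_basisVec_le (d i : ℕ) : ‖basisVec d i‖ ≤ 1 := by
  unfold basisVec
  split_ifs <;> simp

lemma norm_toC3_pderivs_ofReal_le (hd : d ≤ 3) {β : E d → ℝ} (hβ : ContDiff ℝ 1 β) (x : E d) :
    ‖toC3 (pderivs (fun y => (β y : ℂ)) x)‖ ≤ d * ‖fderiv ℝ β x‖ := by
  refine (norm_toC3_le hd _).trans ?_
  have h1 : fderiv ℝ (fun x => (β x : ℂ)) x = _ := (Complex.ofRealCLM.hasFDerivAt.comp x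
      (hβ.differentiable one_ne_zero x).hasFDerivAt).fderiv
  calc ∑ i, ‖pderivs (fun y => (β y : ℂ)) x i‖ ≤ ∑ _i : Fin d, ‖fderiv ℝ β x‖ := by
        refine Finset.sum_le_sum fun i _ => ?_
        rw [pderivs, h1]
        have h2 : ‖fderiv ℝ β x (basisVec d i)‖ ≤ ‖fderiv ℝ β x‖ :=
          ((fderiv ℝ β x).le_opNorm _).trans
            (mul_le_of_le_one_right (norm_nonneg _) (norm_basisVec_le d i))
        simpa using h2
    _ = _ := by simp

/-- Localization of the pairing of a curl with gradients to the strip of a cut-off function. -/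
lemma exists_localized (hd : d ≤ 3) (hD : IsOpen D) {U c : E d → C3}
    (hU : MemLp U 2 (vol D)) (hc : MemLp c 2 (vol D))
    (h : ∀ K, IsCompact K → K ⊆ D → IsCurlLimit K U c) {A δ : ℝ} {β : E d → ℝ} {T : Set (E d)}
    (hβ : IsCutoff D A δ β T) : ∃ V : E d → C3, MemLp V 2 (vol D) ∧
      (∀ x ∈ D, ‖V x‖ ≤ T.indicator (fun x => ‖c x‖ + 6 * (d * (A / δ)) * ‖U x‖) x) ∧
      ∀ (w : E d → ℂ) (dw : Fin d → E d → ℂ), IsH1 D w dw →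
        ∫ x in D, dot (c x) (toC3 fun i => dw i x) = ∫ x in D, dot (V x) (toC3 fun i => dw i x) := by
  set b : E d → ℂ := fun x => (β x : ℂ) with hb
  have hbC : ContDiff ℝ 1 b := Complex.ofRealCLM.contDiff.comp hβ.contDiff
  have hbs : HasCompactSupport b :=
    hβ.hasCompactSupport.comp_left (g := fun t : ℝ => (t : ℂ)) Complex.ofReal_zero
  have hts : tsupport b ⊆ D := by
    refine Set.Subset.trans (closure_mono fun x hx => ?_) hβ.tsupport_subset
    intro h0
    exact hx (by simp [hb, h0])
  have cb : Continuous fun x => toC3 (pderivs b x) :=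
    continuous_toC3.comp (continuous_pi fun i =>
      (hbC.continuous_fderiv one_ne_zero).clm_apply continuous_const)
  have hn : ∀ x, ‖toC3 (pderivs b x)‖ ≤ d * (A / δ) := fun x =>
    (norm_toC3_pderivs_ofReal_le hd hβ.contDiff x).trans
      (mul_le_mul_of_nonneg_left (hβ.norm_fderiv_le x) (Nat.cast_nonneg d))
  have hcr : ∀ x, ‖cross (toC3 (pderivs b x)) (U x)‖ ≤ 6 * (d * (A / δ)) * ‖U x‖ := fun x => by
    refine (norm_cross_le _ _).trans ?_
    have := hn x
    gcongr
  have m1 : MemLp (fun x => cross (toC3 (pderivs b x)) (U x)) 2 (vol D) :=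
    (hU.norm.const_mul (6 * (d * (A / δ)))).mono'
      (aestronglyMeasurable_cross cb.aestronglyMeasurable hU.1) (Eventually.of_forall hcr)
  have m2 : MemLp (fun x => b x • c x) 2 (vol D) := by
    refine hc.norm.mono' (hbC.continuous.aestronglyMeasurable.smul hc.1)
      (Eventually.of_forall fun x => ?_)
    rw [norm_smul, hb, Complex.norm_real, Real.norm_of_nonneg (hβ.nonneg x)]
    exact mul_le_of_le_one_left (norm_nonneg _) (hβ.le_one x)
  have m3 : MemLp (fun x => cross (toC3 (pderivs b x)) (U x) + b x • c x) 2 (vol D) := m1.add m2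
  -- `V` is the curl of `(1 - β) U`, written by the product rule. It vanishes where `β = 1` and `∇β
  -- = 0`, that is, off the strip.
  refine ⟨fun x => c x - (cross (toC3 (pderivs b x)) (U x) + b x • c x), hc.sub m3,
    fun x hx => ?_, fun w dw hw => ?_⟩
  · have e : c x - (cross (toC3 (pderivs b x)) (U x) + b x • c x) =
        (1 - b x) • c x - cross (toC3 (pderivs b x)) (U x) := by
      rw [sub_smul, one_smul]; abel
    simp only [e]
    by_cases hT : x ∈ T
    · rw [Set.indicator_of_mem hT]
      refine (norm_sub_le _ _).trans (add_le_add ?_ (hcr x))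
      have e2 : (1 : ℂ) - b x = ((1 - β x : ℝ) : ℂ) := by simp [hb]
      rw [norm_smul, e2, Complex.norm_real, Real.norm_of_nonneg (sub_nonneg.2 (hβ.le_one x))]
      exact mul_le_of_le_one_left (norm_nonneg _) (sub_le_self 1 (hβ.nonneg x))
    · rw [Set.indicator_of_notMem hT]
      have z1 : b x = 1 := by simp [hb, hβ.eq_one x hx hT]
      have z2 : toC3 (pderivs b x) = 0 := by
        have := norm_toC3_pderivs_ofReal_le hd hβ.contDiff x
        rw [hβ.fderiv_eq_zero x hx hT, norm_zero, mul_zero] at this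
        exact norm_le_zero_iff.1 this
      rw [z1, z2, cross_zero_left]
      simp
  · have hdw := memLp_toC3 hd hw.memLp_deriv
    simp only [sub_dot]
    rw [integral_sub (integrable_dot hc hdw) (integrable_dot m3 hdw),
      integral_dot_curl_mul_eq_zero hd hD hU hc h hw hbC hbs hts, sub_zero]

/-- With `δ = min ε 1` the left side is `√(xy/δ)` and `δ⁻¹ ≤ 1 + ε⁻¹`. The part with `ε⁻¹` is
`√((kε)⁻¹ · kx · y)`, and geometric means are bounded by the sum `kx + y`; the remaining `√(xy)` is
at most `y` because `x ≤ y`. -/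
lemma inv_mul_sqrt_le {k ε x y : ℝ} (hk : 0 < k) (hε : 0 < ε) (hx : 0 ≤ x) (hxy : x ≤ y) :
    (min ε 1)⁻¹ * √(min ε 1 * (x * y)) ≤ (1 + (k * ε) ^ (-(1 / 2) : ℝ)) * (k * x + y) := by
  have hy : 0 ≤ y := hx.trans hxy
  set δ := min ε 1 with hδ
  have hδ0 : 0 < δ := lt_min hε one_pos
  have hkε : 0 < k * ε := mul_pos hk hε
  have e0 : (k * ε) ^ (-(1 / 2) : ℝ) = √((k * ε)⁻¹) := by
    rw [Real.rpow_neg hkε.le, Real.sqrt_eq_rpow, Real.inv_rpow hkε.le]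
  have e1 : δ⁻¹ * √(δ * (x * y)) = √(δ⁻¹ * (x * y)) := by
    rw [← Real.sqrt_sq (inv_pos.2 hδ0).le, ← Real.sqrt_mul (by positivity)]
    congr 1
    rw [Real.sqrt_sq (inv_pos.2 hδ0).le]
    field_simp
  have e2 : δ⁻¹ ≤ 1 + ε⁻¹ := by
    rcases min_choice ε 1 with h | h
    · rw [hδ, h]; linarith
    · rw [hδ, h, inv_one]
      have := inv_pos.2 hε
      linarith
  have hkx : 0 ≤ k * x := by positivity
  rw [e1, e0]
  calc √(δ⁻¹ * (x * y)) ≤ √((x * y) + (k * ε)⁻¹ * (k * x * y)) := by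
        refine Real.sqrt_le_sqrt ?_
        have : (k * ε)⁻¹ * (k * x * y) = ε⁻¹ * (x * y) := by field_simp
        rw [this]
        have := mul_le_mul_of_nonneg_right e2 (mul_nonneg hx hy)
        linarith
    _ ≤ √(x * y) + √((k * ε)⁻¹ * (k * x * y)) := by
        refine Real.sqrt_le_iff.2 ⟨by positivity, ?_⟩
        have h1 := Real.sq_sqrt (mul_nonneg hx hy)
        have h2 := Real.sq_sqrt (show 0 ≤ (k * ε)⁻¹ * (k * x * y) by positivity)
        have h3 : 0 ≤ √(x * y) * √((k * ε)⁻¹ * (k * x * y)) := by positivity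
        nlinarith
    _ ≤ (k * x + y) + √((k * ε)⁻¹) * (k * x + y) := by
        rw [Real.sqrt_mul (by positivity) (k * x * y)]
        refine add_le_add ?_ (mul_le_mul_of_nonneg_left ?_ (Real.sqrt_nonneg _))
        · refine Real.sqrt_le_iff.2 ⟨by positivity, ?_⟩
          nlinarith
        · refine Real.sqrt_le_iff.2 ⟨by positivity, ?_⟩
          nlinarith
    _ = _ := by ring

lemma h2Norm_eq (D : Set (E d)) (u : E d → ℂ) (g : Fin d → E d → ℂ) (h : Fin d → Fin d → E d → ℂ) :
    h2Norm D u g h ^ 2 = eLpNorm u 2 (vol D) ^ 2 + ∑ i, eLpNorm (g i) 2 (vol D) ^ 2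
      + ∑ i, ∑ j, eLpNorm (h i j) 2 (vol D) ^ 2 := by
  rw [h2Norm, ← ENNReal.rpow_natCast, ← ENNReal.rpow_mul]
  norm_num

lemma h1Norm_le_h2Norm (D : Set (E d)) (u : E d → ℂ) (g : Fin d → E d → ℂ)
    (h : Fin d → Fin d → E d → ℂ) : h1Norm D u g ≤ h2Norm D u g h := by
  rw [← ENNReal.pow_le_pow_left_iff two_ne_zero, h1Norm_eq, h2Norm_eq]
  exact le_self_add

lemma h2Semi_eq (D : Set (E d)) (h : Fin d → Fin d → E d → ℂ) :
    h2Semi D h ^ 2 = ∑ i, ∑ j, eLpNorm (h i j) 2 (vol D) ^ 2 := by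
  rw [h2Semi, ← ENNReal.rpow_natCast, ← ENNReal.rpow_mul]
  norm_num

lemma eLpNorm_le_h2Semi (D : Set (E d)) (h : Fin d → Fin d → E d → ℂ) (i j : Fin d) :
    eLpNorm (h i j) 2 (vol D) ≤ h2Semi D h := by
  rw [← ENNReal.pow_le_pow_left_iff two_ne_zero, h2Semi_eq]
  exact (Finset.single_le_sum (f := fun j => eLpNorm (h i j) 2 (vol D) ^ 2) (fun _ _ => zero_le)
    (Finset.mem_univ j)).trans (Finset.single_le_sum
      (f := fun i => ∑ j, eLpNorm (h i j) 2 (vol D) ^ 2) (fun _ _ => zero_le) (Finset.mem_univ i))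

lemma h2Semi_le_h2Norm (D : Set (E d)) (u : E d → ℂ) (g : Fin d → E d → ℂ)
    (h : Fin d → Fin d → E d → ℂ) : h2Semi D h ≤ h2Norm D u g h := by
  rw [← ENNReal.pow_le_pow_left_iff two_ne_zero, h2Semi_eq, h2Norm_eq]
  exact le_add_self

lemma IsH2.h2Norm_ne_top {u : E d → ℂ} {g : Fin d → E d → ℂ} {h : Fin d → Fin d → E d → ℂ}
    (hu : IsH2 D u g h) : h2Norm D u g h ≠ ⊤ := by
  have h1 : h2Norm D u g h ^ 2 ≠ ⊤ := by
    rw [h2Norm_eq]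
    refine ENNReal.add_ne_top.2 ⟨ENNReal.add_ne_top.2 ⟨ENNReal.pow_ne_top hu.1.memLp.eLpNorm_ne_top,
      (ENNReal.sum_lt_top.2 fun i _ =>
        ENNReal.pow_lt_top (hu.1.memLp_deriv i).2).ne⟩, ?_⟩
    exact (ENNReal.sum_lt_top.2 fun i _ => ENNReal.sum_lt_top.2 fun j _ =>
      ENNReal.pow_lt_top ((hu.2 i).memLp_deriv j).2).ne
  intro h2
  rw [h2] at h1
  exact h1 (by simp)

end NormalTrace

/-! ### The normal trace estimate for `curl (∑ⱼ gⱼ Rⱼ)`. -/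

section NormalTraceEstimate

variable {d : ℕ} {D : Set (E d)}

lemma norm_curlProd_le {C C' : ℝ} (g : E d → ℂ) (dg : Fin d → E d → ℂ) (R m : E d → C3) (x : E d)
    (hR : ‖R x‖ ≤ C) (hm : ‖m x‖ ≤ C') :
    ‖curlProd g dg R m x‖ ≤ 6 * C * ‖toC3 fun i => dg i x‖ + C' * ‖g x‖ := by
  refine (norm_add_le _ _).trans (add_le_add ((norm_cross_le _ _).trans ?_) ?_)
  · have := mul_le_mul_of_nonneg_left hR (norm_nonneg (toC3 fun i => dg i x))
    linarith
  · rw [norm_smul, mul_comm]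
    exact mul_le_mul_of_nonneg_right hm (norm_nonneg _)

/-- The `L²` norm of a Sobolev function in a strip, in terms of norms that dominate it. -/
lemma eLpNorm_indicator_le {T : Set (E d)} (hT : MeasurableSet T) (hTD : T ⊆ D) {A : ℝ≥0} {δ : ℝ}
    (hδ : 0 ≤ δ)
    {v : E d → ℂ} {dv : Fin d → E d → ℂ}
    (h : ∫⁻ x in T, ‖v x‖ₑ ^ 2 ≤ A * ENNReal.ofReal δ * (eLpNorm v 2 (vol D) ^ 2 +
      eLpNorm v 2 (vol D) * ∑ i, eLpNorm (dv i) 2 (vol D))) {x y : ℝ} (hx : 0 ≤ x) (hxy : x ≤ y)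
    (hvx : eLpNorm v 2 (vol D) ≤ ENNReal.ofReal x)
    (hvy : ∀ i, eLpNorm (dv i) 2 (vol D) ≤ ENNReal.ofReal y) :
    eLpNorm (T.indicator v) 2 (vol D) ≤ ENNReal.ofReal (√(A * (1 + d)) * √(δ * (x * y))) := by
  have hy : 0 ≤ y := hx.trans hxy
  rw [eLpNorm_indicator_eq_eLpNorm_restrict hT, Measure.restrict_restrict_of_subset hTD,
    ← ENNReal.pow_le_pow_left_iff two_ne_zero, sq_eLpNorm_two]
  refine h.trans ?_
  rw [← ENNReal.ofReal_pow (by positivity), mul_pow, Real.sq_sqrt (by positivity),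
    Real.sq_sqrt (by positivity)]
  have hsum : ∑ i, eLpNorm (dv i) 2 (vol D) ≤ ENNReal.ofReal (d * y) := by
    refine (Finset.sum_le_sum fun i _ => hvy i).trans (le_of_eq ?_)
    rw [Finset.sum_const, Finset.card_univ, Fintype.card_fin, nsmul_eq_mul,
      ENNReal.ofReal_mul (Nat.cast_nonneg d), ENNReal.ofReal_natCast]
  calc (A : ℝ≥0∞) * ENNReal.ofReal δ * (eLpNorm v 2 (vol D) ^ 2 +
        eLpNorm v 2 (vol D) * ∑ i, eLpNorm (dv i) 2 (vol D))
      ≤ ENNReal.ofReal A * ENNReal.ofReal δ * (ENNReal.ofReal x ^ 2 +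
        ENNReal.ofReal x * ENNReal.ofReal (d * y)) := by
        rw [ENNReal.ofReal_coe_nnreal]
        gcongr
    _ = ENNReal.ofReal (A * δ * (x ^ 2 + x * (d * y))) := by
        rw [← ENNReal.ofReal_pow hx, ← ENNReal.ofReal_mul hx,
          ← ENNReal.ofReal_add (by positivity) (by positivity), ← ENNReal.ofReal_mul A.coe_nonneg,
          ← ENNReal.ofReal_mul (by positivity)]
    _ ≤ _ := by
        refine ENNReal.ofReal_le_ofReal ?_
        have h1 : x ^ 2 ≤ x * y := by rw [sq]; exact mul_le_mul_of_nonneg_left hxy hx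
        calc A * δ * (x ^ 2 + x * (d * y)) ≤ A * δ * (x * y + x * (d * y)) := by gcongr
          _ = _ := by ring

/-- The estimate of the normal trace of `curl (∑ⱼ gⱼ Rⱼ)`. -/
lemma exists_normalTraceNorm_le (hd : d ≤ 3) (hD : IsC11Domain D) {C K : ℝ} (hC : 0 ≤ C)
    (hK : 0 ≤ K) : ∃ C₂ : ℝ≥0, ∀ ε : ℝ, 0 < ε → ∀ (R m : Fin d → E d → C3)
      (P : Fin d → ℕ → E d → C3), (∀ j, IsRoughField D C (ε⁻¹ * K) (R j) (m j) (P j)) →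
      ∀ (u : E d → ℂ) (g : Fin d → E d → ℂ) (h : Fin d → Fin d → E d → ℂ), IsH2 D u g h →
      ∀ k : ℝ, 0 < k → normalTraceNorm D (sumCurl g h R m) ≤
        C₂ * ENNReal.ofReal (1 + (k * ε) ^ (-(1 / 2) : ℝ)) *
          (ENNReal.ofReal k * h1Norm D u g + h2Norm D u g h) := by
  obtain ⟨A, hcut⟩ := exists_isCutoff hD
  -- `B` bounds the localized field: the first term comes from `∇gⱼ × Rⱼ`, the second from `gⱼ` on
  -- the strip. The pairing with `∇w` then contributes `3` from `norm_dot_le` and `d` from the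
  -- components of `∇w`.
  set B : ℝ := d * (6 * C * d + (K + 6 * d * A * C) * √(A * (1 + d))) with hB
  have hB0 : 0 ≤ B := by positivity
  refine ⟨(3 * d * B).toNNReal, fun ε hε R m P hR u g h hu k hk => ?_⟩
  have hHc := isHcurl_sumField hd hD.1 hR hu.2
  have hδ : 0 < min ε 1 := lt_min hε one_pos
  -- A strip of width `ε` balances the gradient of the cut-off against the oscillating curl, both of
  -- order `ε⁻¹`. The minimum is needed because cut-offs are available only for widths at most one.
  set δ := min ε 1 with hδdef
  obtain ⟨β, T, hβ, hTD, hstrip⟩ := hcut δ hδ (min_le_right _ _)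
  obtain ⟨V, hV, hVle, hVint⟩ := exists_localized hd hD.1 hHc.memLp hHc.memLp_curl
    (isCurlLimit_sumField hd hD.1 hR hu.2) hβ
  have hYt := hu.h2Norm_ne_top
  have hXY := h1Norm_le_h2Norm D u g h
  have hXt : h1Norm D u g ≠ ⊤ := ne_top_of_le_ne_top hYt hXY
  set x : ℝ := (h1Norm D u g).toReal with hx
  set y : ℝ := (h2Norm D u g h).toReal with hy
  have hX : h1Norm D u g = ENNReal.ofReal x := (ENNReal.ofReal_toReal hXt).symm
  have hY : h2Norm D u g h = ENNReal.ofReal y := (ENNReal.ofReal_toReal hYt).symm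
  have hx0 : 0 ≤ x := ENNReal.toReal_nonneg
  have hxy : x ≤ y := ENNReal.toReal_mono hYt hXY
  have hy0 : 0 ≤ y := hx0.trans hxy
  have hgx : ∀ j, eLpNorm (g j) 2 (vol D) ≤ ENNReal.ofReal x := fun j =>
    hX ▸ eLpNorm_deriv_le_h1Norm D u g j
  have hhy : ∀ j i, eLpNorm (h j i) 2 (vol D) ≤ ENNReal.ofReal y := fun j i =>
    hY ▸ (eLpNorm_le_h2Semi D h j i).trans (h2Semi_le_h2Norm D u g h)
  set Z : ℝ := (1 + (k * ε) ^ (-(1 / 2) : ℝ)) * (k * x + y) with hZ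
  have hkε : 0 ≤ (k * ε) ^ (-(1 / 2) : ℝ) := Real.rpow_nonneg (by positivity) _
  have hyZ : y ≤ Z := by
    rw [hZ]
    have h1 : 0 ≤ k * x := by positivity
    nlinarith [mul_nonneg hkε (add_nonneg h1 hy0)]
  have hZ0 : 0 ≤ Z := hy0.trans hyZ
  -- The coefficient of `|gⱼ|` on the strip: `ε⁻¹K` from the curl of `Rⱼ`, the rest from the
  -- gradient of the cut-off. Both are of order `δ⁻¹`, and the strip estimate returns `√δ`.
  set L : ℝ := ε⁻¹ * K + 6 * (d * (A / δ)) * C with hL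
  have hL0 : 0 ≤ L := by positivity
  have hLδ : L * √(δ * (x * y)) ≤ (K + 6 * d * A * C) * Z := by
    have h1 : L ≤ (K + 6 * d * A * C) * δ⁻¹ := by
      have h2 : ε⁻¹ ≤ δ⁻¹ := inv_anti₀ hδ (min_le_left _ _)
      have h3 : ε⁻¹ * K ≤ δ⁻¹ * K := mul_le_mul_of_nonneg_right h2 hK
      have h4 : 6 * (d * (A / δ)) * C = 6 * d * A * C * δ⁻¹ := by rw [div_eq_mul_inv]; ring
      rw [hL, h4]
      linarith
    calc L * √(δ * (x * y)) ≤ (K + 6 * d * A * C) * δ⁻¹ * √(δ * (x * y)) :=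
          mul_le_mul_of_nonneg_right h1 (Real.sqrt_nonneg _)
      _ = (K + 6 * d * A * C) * (δ⁻¹ * √(δ * (x * y))) := by ring
      _ ≤ _ := mul_le_mul_of_nonneg_left (inv_mul_sqrt_le hk hε hx0 hxy) (by positivity)
  have hVn : eLpNorm V 2 (vol D) ≤ ENNReal.ofReal (B * Z) := by
    -- The left summands are the terms in `∇gⱼ`, bounded over all of `D` as they carry no inverse
    -- power of `δ`. The right summands are the terms in `gⱼ`, kept on the strip.
    have h1 := eLpNorm_le_sum_of_norm_le (μ := vol D) (Finset.univ : Finset (Fin d ⊕ Fin d)) (f := V)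
      (u := Sum.elim (fun j x => ‖toC3 fun i => h j i x‖) fun j x => ‖T.indicator (g j) x‖)
      (a := Sum.elim (fun _ => 6 * C) fun _ => L)
      (by rintro (j | j) - <;> simp <;> positivity)
      (by
        rintro (j | j) -
        · exact (memLp_toC3 hd (hu.2 j).memLp_deriv).1.norm
        · exact ((hu.2 j).memLp.1.indicator hβ.measurableSet).norm)
      (by
        filter_upwards [ae_restrict_mem hD.1.measurableSet,
          ae_all_iff.2 fun j => (hR j).bound_curl] with z hz hm
        refine (hVle z hz).trans ?_
        rw [Fintype.sum_sum_type]
        simp only [Sum.elim_inl, Sum.elim_inr, norm_norm]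
        by_cases hzT : z ∈ T
        · simp only [Set.indicator_of_mem hzT]
          have b1 : ‖sumCurl g h R m z‖ ≤
              ∑ j, (6 * C * ‖toC3 fun i => h j i z‖ + ε⁻¹ * K * ‖g j z‖) :=
            (norm_sum_le _ _).trans (Finset.sum_le_sum fun j _ =>
              norm_curlProd_le _ _ _ _ _ ((hR j).bound z) (hm j))
          have b2 : ‖sumField g R z‖ ≤ ∑ j, C * ‖g j z‖ :=
            (norm_sum_le _ _).trans (Finset.sum_le_sum fun j _ => by
              rw [norm_smul, mul_comm]
              exact mul_le_mul_of_nonneg_right ((hR j).bound z) (norm_nonneg _))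
          have b3 : 0 ≤ 6 * (d * ((A : ℝ) / δ)) := by positivity
          refine (add_le_add b1 (mul_le_mul_of_nonneg_left b2 b3)).trans (le_of_eq ?_)
          rw [Finset.mul_sum, ← Finset.sum_add_distrib, ← Finset.sum_add_distrib]
          refine Finset.sum_congr rfl fun j _ => ?_
          rw [hL]
          ring
        · rw [Set.indicator_of_notMem hzT]
          positivity)
    refine h1.trans ?_
    rw [Fintype.sum_sum_type]
    simp only [Sum.elim_inl, Sum.elim_inr, eLpNorm_norm]
    have c1 : ∀ j, ENNReal.ofReal (6 * C) * eLpNorm (fun x => toC3 fun i => h j i x) 2 (vol D) ≤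
        ENNReal.ofReal (6 * C * (d * y)) := fun j => by
      rw [ENNReal.ofReal_mul (p := 6 * C) (by positivity)]
      refine mul_le_mul' le_rfl ?_
      refine (eLpNorm_toC3_le hd fun i => ((hu.2 j).memLp_deriv i).1).trans
        ((Finset.sum_le_sum fun i _ => hhy j i).trans (le_of_eq ?_))
      rw [Finset.sum_const, Finset.card_univ, Fintype.card_fin, nsmul_eq_mul,
        ENNReal.ofReal_mul (Nat.cast_nonneg d), ENNReal.ofReal_natCast]
    have c2 : ∀ j, ENNReal.ofReal L * eLpNorm (fun x => T.indicator (g j) x) 2 (vol D) ≤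
        ENNReal.ofReal ((K + 6 * d * A * C) * √(A * (1 + d)) * Z) := fun j => by
      calc _ ≤ ENNReal.ofReal L * ENNReal.ofReal (√(A * (1 + d)) * √(δ * (x * y))) :=
            mul_le_mul' le_rfl (eLpNorm_indicator_le hβ.measurableSet hTD hδ.le
              (hstrip _ _ (hu.2 j)) hx0 hxy (hgx j) (hhy j))
        _ ≤ _ := by
            rw [← ENNReal.ofReal_mul hL0]
            refine ENNReal.ofReal_le_ofReal ?_
            have := mul_le_mul_of_nonneg_left hLδ (Real.sqrt_nonneg ((A : ℝ) * (1 + d)))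
            linarith
    calc _ ≤ ∑ _j : Fin d, ENNReal.ofReal (6 * C * (d * y)) +
          ∑ _j : Fin d, ENNReal.ofReal ((K + 6 * d * A * C) * √(A * (1 + d)) * Z) :=
          add_le_add (Finset.sum_le_sum fun j _ => c1 j) (Finset.sum_le_sum fun j _ => c2 j)
      _ = ENNReal.ofReal (d * (6 * C * (d * y)) + d * ((K + 6 * d * A * C) * √(A * (1 + d)) * Z)) := by
          simp only [Finset.sum_const, Finset.card_univ, Fintype.card_fin, nsmul_eq_mul]
          rw [ENNReal.ofReal_add (by positivity) (by positivity),
            ENNReal.ofReal_mul (Nat.cast_nonneg d), ENNReal.ofReal_mul (Nat.cast_nonneg d),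
            ENNReal.ofReal_natCast]
      _ ≤ _ := by
          refine ENNReal.ofReal_le_ofReal ?_
          have : (d : ℝ) * (6 * C * (d * y)) ≤ d * (6 * C * (d * Z)) := by gcongr
          rw [hB]
          linarith
  have hbound : ∀ (w : E d → ℂ) (dw : Fin d → E d → ℂ), IsH1 D w dw →
      ‖∫ x in D, dot (sumCurl g h R m x) (toC3 fun i => dw i x)‖ₑ ≤
        ENNReal.ofReal (3 * d * B * Z) * h1Norm D w dw := by
    intro w dw hw
    rw [hVint w dw hw]
    have hdw := memLp_toC3 hd hw.memLp_deriv
    refine (enorm_integral_dot_le hV.1 hdw.1).trans ?_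
    have h1 : eLpNorm (fun x => toC3 fun i => dw i x) 2 (vol D) ≤ d * h1Norm D w dw := by
      refine (eLpNorm_toC3_le hd fun i => (hw.memLp_deriv i).1).trans
        ((Finset.sum_le_sum fun i _ => eLpNorm_deriv_le_h1Norm D w dw i).trans (le_of_eq ?_))
      rw [Finset.sum_const, Finset.card_univ, Fintype.card_fin, nsmul_eq_mul]
    calc _ ≤ 3 * (ENNReal.ofReal (B * Z) * (d * h1Norm D w dw)) := by gcongr
      _ = _ := by
          rw [show 3 * (d : ℝ) * B * Z = 3 * (d * (B * Z)) by ring,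
            ENNReal.ofReal_mul (by norm_num : (0 : ℝ) ≤ 3), ENNReal.ofReal_mul (Nat.cast_nonneg d),
            ENNReal.ofReal_natCast, ENNReal.ofReal_ofNat]
          ring
  refine (hHc.normalTraceNorm_le hd ENNReal.ofReal_ne_top hbound).trans (le_of_eq ?_)
  rw [hX, hY, ← ENNReal.ofReal_mul hk.le, ← ENNReal.ofReal_add (by positivity) hy0,
    show (((3 * d * B).toNNReal : ℝ≥0) : ℝ≥0∞) = ENNReal.ofReal (3 * d * B) from rfl,
    ← ENNReal.ofReal_mul (by positivity), ← ENNReal.ofReal_mul (by positivity), hZ]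
  congr 1
  ring

end NormalTraceEstimate

/-! ### The two-scale field: uniqueness, oscillating evaluation and bounds. -/

section TwoScale

variable {d : ℕ} {D : Set (E d)}

lemma latticeSum_nonneg (d : ℕ) (s : ℝ) : 0 ≤ latticeSum d s := by
  unfold latticeSum
  split_ifs
  · exact tsum_nonneg fun α => Set.indicator_nonneg (fun _ _ => Real.rpow_nonneg (idxNorm_nonneg _) _) _
  · exact le_rfl

lemma aestronglyMeasurable_column {M : E d → Matrix (Fin d) (Fin d) ℂ} (hM : IsAdmissible M)
    (j : Fin d) : AEStronglyMeasurable (column M j) volume :=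
  continuous_toC3.comp_aestronglyMeasurable
    (aemeasurable_pi_lambda _ fun i => (hM.measurable i j).aemeasurable).aestronglyMeasurable

lemma isPeriodic_column {M : E d → Matrix (Fin d) (Fin d) ℂ} (hM : IsAdmissible M) (j : Fin d) :
    IsPeriodic (column M j) := fun i y => by rw [column, column, hM.periodic i y]

lemma ae_norm_column_le (hd : d ≤ 3) {M : E d → Matrix (Fin d) (Fin d) ℂ} (hM : IsAdmissible M)
    {K : ℝ≥0} (hK : matLinfNorm M ≤ K) (j : Fin d) : ∀ᵐ y, ‖column M j y‖ ≤ d * K := by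
  filter_upwards [hM.ae_norm_le hK] with y hy
  refine (norm_toC3_le hd _).trans ((Finset.sum_le_sum fun i _ => hy i j).trans (le_of_eq ?_))
  simp

/-- A periodic vector potential of a combination of columns is determined by them. -/
lemma isVectorPotential_sum_smul {M : E d → Matrix (Fin d) (Fin d) ℂ} {C : ℝ}
    {W : Fin d → H1sharp d} {Q : Fin d → E d → C3} {P : Fin d → ℕ → E d → C3}
    (hW : ∀ j, IsColumnPotential C (column M j) (W j) (Q j) (P j)) {g : Fin d → E d → ℂ}
    {h : Fin d → Fin d → E d → ℂ} (hg : ∀ j, IsH1 D (g j) (h j)) :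
    IsVectorPotential D M g (fun x => ∑ j, g j x • W j) fun i x => ∑ j, h j i x • W j := by
  refine ⟨isH1_sum_smul hg W, Eventually.of_forall fun x => ?_, Eventually.of_forall fun x => ?_⟩
  · filter_upwards [H1sharp.curl_sum_smul (fun j => g j x) W,
      ae_all_iff.2 fun j => (hW j).curl_eq] with y h1 h2
    rw [h1, toC3_mulVec]
    exact Finset.sum_congr rfl fun j _ => by rw [h2 j]
  · filter_upwards [H1sharp.div_sum_smul (fun j => g j x) W,
      ae_all_iff.2 fun j => (hW j).div_eq] with y h1 h2
    rw [h1]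
    exact Finset.sum_eq_zero fun j _ => by rw [h2 j, mul_zero]

/-- The cell problem has at most one solution for each `x`, so uniqueness holds pointwise and does
not involve the dependence on `x`. -/
lemma IsVectorPotential.ae_unique (hd : d ≤ 3) {M : E d → Matrix (Fin d) (Fin d) ℂ}
    {g : Fin d → E d → ℂ} {q q' : E d → H1sharp d} {dq dq' : Fin d → E d → H1sharp d}
    (h : IsVectorPotential D M g q dq) (h' : IsVectorPotential D M g q' dq') :
    q' =ᵐ[vol D] q := by
  filter_upwards [h.curl_eq, h.div_eq, h'.curl_eq, h'.div_eq] with x h1 h2 h3 h4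
  refine H1sharp_eq_of_curl_div hd ?_ ?_
  · filter_upwards [h1, h3] with y e1 e3
    rw [e1, e3]
  · filter_upwards [h2, h4] with y e2 e4
    rw [e2, e4]

lemma norm_sum_smul_le {C : ℝ} (c : Fin d → ℂ) (v : Fin d → C3)
    (hv : ∀ j, ‖v j‖ ≤ C) :
    ‖∑ j, c j • v j‖ ≤ d * C * ‖(WithLp.toLp 2 c : EuclideanSpace ℂ (Fin d))‖ := by
  refine (norm_sum_le _ _).trans ?_
  calc ∑ j, ‖c j • v j‖ ≤ ∑ _j : Fin d, ‖(WithLp.toLp 2 c : EuclideanSpace ℂ (Fin d))‖ * C := by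
        refine Finset.sum_le_sum fun j _ => ?_
        rw [norm_smul]
        exact mul_le_mul (PiLp.norm_apply_le (WithLp.toLp 2 c : EuclideanSpace ℂ (Fin d)) j) (hv j)
          (norm_nonneg _) (norm_nonneg _)
    _ = _ := by simp; ring

lemma osc_sum_smul {W : Fin d → H1sharp d} {Q : Fin d → E d → C3}
    (hW : ∀ j, IsContRep (W j) (Q j)) (ε : ℝ) (c : Fin d → E d → ℂ) (x : E d) :
    osc ε (fun x => ∑ j, c j x • W j) x = ∑ j, c j x • Q j (ε⁻¹ • x) := by
  rw [osc_eq (q := fun x => ∑ j, c j x • W j) (f := fun y => ∑ j, c j x • Q j y)]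
  exact IsContRep.sum_smul hW fun j => c j x

lemma curlXOsc_sum_smul {W : Fin d → H1sharp d} {Q : Fin d → E d → C3}
    (hW : ∀ j, IsContRep (W j) (Q j)) (ε : ℝ) (h : Fin d → Fin d → E d → ℂ) (x : E d) :
    curlXOsc ε (fun i x => ∑ j, h j i x • W j) x =
      ∑ j, cross (toC3 fun i => h j i x) (Q j (ε⁻¹ • x)) := by
  rw [curlXOsc, ← curlOf_sum_smul_right (fun j i => h j i x)]
  simp only [osc_sum_smul hW]

lemma aestronglyMeasurable_sum_cross {R : Fin d → E d → C3} (hR : ∀ j, Continuous (R j))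
    {h : Fin d → Fin d → E d → ℂ} (hh : ∀ j i, AEStronglyMeasurable (h j i) (vol D)) :
    AEStronglyMeasurable (fun x => ∑ j, cross (toC3 fun i => h j i x) (R j x)) (vol D) := by
  refine Finset.aestronglyMeasurable_fun_sum _ fun j _ => ?_
  have h1 : AEStronglyMeasurable (fun x => toC3 fun i => h j i x) (vol D) :=
    continuous_toC3.comp_aestronglyMeasurable
      (aemeasurable_pi_lambda _ fun i => (hh j i).aemeasurable).aestronglyMeasurable
  exact aestronglyMeasurable_cross h1 (hR j).aestronglyMeasurable

lemma eLpNorm_sum_cross_le (hd : d ≤ 3) {C : ℝ} (hC : 0 ≤ C) {R : Fin d → E d → C3}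
    (hR : ∀ j x, ‖R j x‖ ≤ C) {h : Fin d → Fin d → E d → ℂ}
    (hh : ∀ j i, AEStronglyMeasurable (h j i) (vol D)) :
    eLpNorm (fun x => ∑ j, cross (toC3 fun i => h j i x) (R j x)) 2 (vol D) ≤
      ENNReal.ofReal (6 * d ^ 2 * C) * h2Semi D h := by
  have h1 : ∀ j, AEStronglyMeasurable (fun x => toC3 fun i => h j i x) (vol D) := fun j =>
    continuous_toC3.comp_aestronglyMeasurable
      (aemeasurable_pi_lambda _ fun i => (hh j i).aemeasurable).aestronglyMeasurable
  have h2 := eLpNorm_le_sum_of_norm_le (μ := vol D) Finset.univ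
    (f := fun x => ∑ j, cross (toC3 fun i => h j i x) (R j x))
    (u := fun j x => toC3 fun i => h j i x) (a := fun _ => 6 * C) (fun _ _ => by positivity)
    (fun j _ => h1 j) (Eventually.of_forall fun x => (norm_sum_le _ _).trans
      (Finset.sum_le_sum fun j _ => by
        refine (norm_cross_le _ _).trans ?_
        have := mul_le_mul_of_nonneg_left (hR j x) (norm_nonneg (toC3 fun i => h j i x))
        linarith))
  refine h2.trans ?_
  have h3 : ∀ j, eLpNorm (fun x => toC3 fun i => h j i x) 2 (vol D) ≤ d * h2Semi D h := fun j => by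
    refine (eLpNorm_toC3_le hd (hh j)).trans
      ((Finset.sum_le_sum fun i _ => eLpNorm_le_h2Semi D h j i).trans (le_of_eq ?_))
    rw [Finset.sum_const, Finset.card_univ, Fintype.card_fin, nsmul_eq_mul]
  calc _ ≤ ∑ _j : Fin d, ENNReal.ofReal (6 * C) * (d * h2Semi D h) :=
        Finset.sum_le_sum fun j _ => mul_le_mul' le_rfl (h3 j)
    _ = _ := by
        rw [Finset.sum_const, Finset.card_univ, Fintype.card_fin, nsmul_eq_mul,
          show 6 * (d : ℝ) ^ 2 * C = d * d * (6 * C) by ring,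
          ENNReal.ofReal_mul (p := (d : ℝ) * d) (by positivity),
          ENNReal.ofReal_mul (Nat.cast_nonneg d), ENNReal.ofReal_natCast]
        ring

lemma sum_le_mul_sqrt_sum_sq (a : Fin d → ℝ≥0∞) :
    ∑ j, a j ≤ d * (∑ j, a j ^ 2) ^ (1 / 2 : ℝ) := by
  have h1 : ∀ j, a j ≤ (∑ j, a j ^ 2) ^ (1 / 2 : ℝ) := fun j => by
    have h2 : ((∑ j, a j ^ 2) ^ (1 / 2 : ℝ)) ^ 2 = ∑ j, a j ^ 2 := by
      rw [← ENNReal.rpow_natCast, ← ENNReal.rpow_mul]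
      norm_num
    rw [← ENNReal.pow_le_pow_left_iff two_ne_zero, h2]
    exact Finset.single_le_sum (f := fun j => a j ^ 2) (fun _ _ => zero_le) (Finset.mem_univ j)
  refine (Finset.sum_le_sum fun j _ => h1 j).trans (le_of_eq ?_)
  rw [Finset.sum_const, Finset.card_univ, Fintype.card_fin, nsmul_eq_mul]

end TwoScale

end PeriodicPotential
end

/-! ### Assembly of the theorem. -/

theorem mainTheorem7 (d : ℕ) (hd : d = 2 ∨ d = 3)
    (D : Set (E d)) (hD : IsC11Domain D) (s : ℝ) (hs : 0 < s) (K₁ K₂ : ℝ≥0) :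
    ∃ (C₁ : ℝ≥0) (C₂ : ℝ → ℝ≥0),
      ∀ M : E d → Matrix (Fin d) (Fin d) ℂ, IsAdmissible M →
        matHsNorm s M ≤ K₁ → matLinfNorm M ≤ K₂ →
      ∀ (u : E d → ℂ) (g : Fin d → E d → ℂ) (h : Fin d → Fin d → E d → ℂ), IsH2 D u g h →
      ∃ (q : E d → H1sharp d) (dq : Fin d → E d → H1sharp d),
        IsVectorPotential D M g q dq ∧
        (∀ (q' : E d → H1sharp d) (dq' : Fin d → E d → H1sharp d),
          IsVectorPotential D M g q' dq' → q' =ᵐ[vol D] q) ∧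
        (∀ᵐ x ∂(vol D), ∃ f : E d → C3, IsContRep (q x) f ∧
          (∀ (y : E d) (t : ℝ), f (y + t • basisVec d (d - 1)) = f y) ∧
          ∀ y, ‖f y‖ ≤ C₁ * ‖(WithLp.toLp 2 (fun i => g i x) : EuclideanSpace ℂ (Fin d))‖) ∧
        (∀ᵐ x ∂(vol D), ∀ i, ∃ f : E d → C3, IsContRep (dq i x) f) ∧
        ∀ ε : ℝ, 0 < ε →
          MemLp (curlXOsc ε dq) 2 (vol D) ∧
          eLpNorm (curlXOsc ε dq) 2 (vol D) ≤ C₁ * h2Semi D h ∧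
          ∃ c : E d → C3, IsHcurl D (osc ε q) c ∧
            (∀ γ : Fin d → E d → ℂ, (∀ j, IsTrace D (g j) (h j) (γ j)) →
              ∃ τ : E d → C3, IsTangentialTrace D (osc ε q) c τ ∧
                eLpNorm τ 2 (surf D) ≤
                  C₁ * (∑ j, eLpNorm (γ j) 2 (surf D) ^ 2) ^ (1 / 2 : ℝ)) ∧
            ∀ c₀ R₀ k : ℝ, 0 < c₀ → 0 < R₀ → 0 < k → D ⊆ Metric.ball 0 R₀ → c₀ ≤ k * R₀ →
              normalTraceNorm D c ≤
                C₂ c₀ * ENNReal.ofReal (1 + (k * ε) ^ (-(1 / 2) : ℝ)) *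
                  (ENNReal.ofReal k * h1Norm D u g + h2Norm D u g h) := by
  have hd3 : d ≤ 3 := by omega
  have hd1 : (1 : ℝ) ≤ d := by exact_mod_cast (show 1 ≤ d by omega)
  set C : ℝ := d * (1 / 2 * ((K₁ : ℝ) ^ 2 + latticeSum d s)) with hCdef
  have hC : 0 ≤ C := by
    have := latticeSum_nonneg d s
    positivity
  -- `d * K₂` bounds a column, as the sum of `d` entries each at most `K₂`.
  obtain ⟨C₂, hC₂⟩ := exists_normalTraceNorm_le hd3 hD hC (by positivity : (0 : ℝ) ≤ d * K₂)
  have hC₁ : 0 ≤ 6 * d ^ 2 * C := by positivity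
  -- One constant for three bounds: `dC` for the sup norm of `q(x,·)`, `6d²C` for the slow curl,
  -- `6dC` for the tangential trace.
  refine ⟨(6 * d ^ 2 * C).toNNReal, fun _ => C₂, fun M hM hK₁ hK₂ u g h hu => ?_⟩
  choose W Q P hW using exists_columnPotential hd hs hM hK₁ hK₂
  have hq := isVectorPotential_sum_smul hW hu.2
  have hrep : ∀ c : Fin d → ℂ, IsContRep (∑ j, c j • W j) fun y => ∑ j, c j • Q j y :=
    IsContRep.sum_smul fun j => (hW j).contRep
  -- The witnesses are `q = ∑ⱼ gⱼ W_j` and `∂ᵢq = ∑ⱼ h j i W_j`, so for every `x` both are finite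
  -- combinations of the `W_j` and have continuous representatives.
  refine ⟨_, _, hq, fun q' dq' h' => hq.ae_unique hd3 h', Eventually.of_forall fun x => ⟨_, hrep _,
    fun y t => ?_, fun y => ?_⟩, Eventually.of_forall fun x i => ⟨_, hrep _⟩, fun ε hε => ?_⟩
  · simp only [(hW _).indep y t]
  · refine (norm_sum_smul_le _ _ fun j => (hW j).bound y).trans ?_
    rw [Real.coe_toNNReal _ hC₁]
    have h1 : (d : ℝ) * C ≤ 6 * d ^ 2 * C := by
      have : (d : ℝ) ≤ 6 * d ^ 2 := by nlinarith
      exact mul_le_mul_of_nonneg_right this hC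
    exact mul_le_mul_of_nonneg_right h1 (norm_nonneg _)
  -- From here `ε` is fixed, and the oscillating field is a sum of rough fields with coefficients
  -- `∂ⱼu₀`.
  have hR : ∀ j, IsRoughField D C (ε⁻¹ * (d * K₂)) (fun x => Q j (ε⁻¹ • x))
      (fun x => ε⁻¹ • column M j (ε⁻¹ • x)) (fun n x => P j n (ε⁻¹ • x)) := fun j =>
    (hW j).isRoughField (aestronglyMeasurable_column hM j) (isPeriodic_column hM j)
      (ae_norm_column_le hd3 hM hK₂ j) hε hD.2.1
  have hosc : (osc ε fun x => ∑ j, g j x • W j) = sumField g fun j x => Q j (ε⁻¹ • x) := by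
    exact funext fun x => osc_sum_smul (fun j => (hW j).contRep) ε g x
  have hcurl : (curlXOsc ε fun i x => ∑ j, h j i x • W j) =
      fun x => ∑ j, cross (toC3 fun i => h j i x) (Q j (ε⁻¹ • x)) := by
    exact funext fun x => curlXOsc_sum_smul (fun j => (hW j).contRep) ε h x
  have hh : ∀ j i, AEStronglyMeasurable (h j i) (vol D) := fun j i => ((hu.2 j).memLp_deriv i).1
  have hcle := eLpNorm_sum_cross_le (D := D) hd3 hC (fun j x => (hR j).bound x) hh
  rw [hcurl, hosc]
  have hs2 : h2Semi D h < ⊤ :=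
    (h2Semi_le_h2Norm D u g h).trans_lt hu.h2Norm_ne_top.lt_top
  refine ⟨⟨aestronglyMeasurable_sum_cross (fun j => (hR j).cont) hh,
    hcle.trans_lt (ENNReal.mul_lt_top ENNReal.ofReal_lt_top hs2)⟩, hcle,
    sumCurl g h _ _, isHcurl_sumField hd3 hD.1 hR hu.2, fun γ hγ => ?_,
    fun c₀ R₀ k _ _ hk _ _ => hC₂ ε hε _ _ _ hR u g h hu k hk⟩
  obtain ⟨τ, hτ, hτle⟩ := exists_isTangentialTrace hd3 hD.1 hD.2.1 hR hC hu.2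
    (aestronglyMeasurable_nu hD) (norm_nu_le hd3 D) hγ
  refine ⟨τ, hτ, hτle.trans ((mul_le_mul' le_rfl (sum_le_mul_sqrt_sum_sq _)).trans ?_)⟩
  rw [← mul_assoc]
  refine mul_le_mul' ?_ le_rfl
  rw [← ENNReal.ofReal_natCast d, ← ENNReal.ofReal_mul (by positivity)]
  refine ENNReal.ofReal_le_ofReal ?_
  have : (d : ℝ) ≤ d ^ 2 := by nlinarith
  nlinarith [mul_le_mul_of_nonneg_left this hC]
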